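/- Let $d\ge 2$ and let $M(v)=(2\pi)^{-d/2}e^{-|v|^2/2}$ on $\mathbb R^d$. A Boltzmann kernel is a measurable function $B=B(r,\cos\theta)$, nonnegative and differentiable in $r$ for $r>0$, $-1<\cos\theta<1$, whose cross-section for momentum transfer $\mathcal M(z)=\int_{\mathbb S^{d-1}}(1-k\cdot\sigma)\,B(|z|,k\cdot\sigma)\,d\sigma$ (with $k=z/|z|$) is finite for every $z\neq 0$ and satisfies $\int_{|z|\le 1}|z|^2\mathcal M(z)\,dz<\infty$ (no angular cutoff is assumed). Put $$\overline\gamma(B)=\sup_{r>0}\ \sup_{-1<\cos\theta<1}\ \frac{r}{B}\left|\frac{\partial B}{\partial r}\right|(r,\cos\theta).$$ The spatially homogeneous linearised Boltzmann equation is $\partial_t h=\mathcal L_B h$, where $$\mathcal L_Bh(v)=\int_{\mathbb R^d}\int_{\mathbb S^{d-1}}\bigl[h(v')+h(v'_*)-h(v)-h(v_*)\bigr]\,M(v_*)\,B(|v-v_*|,k\cdot\sigma)\,d\sigma\,dv_*,$$ $k=\frac{v-v_*}{|v-v_*|}$, $v'=\frac{v+v_*}2+\frac{|v-v_*|}2\sigma$,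 $v'_*=\frac{v+v_*}2-\frac{|v-v_*|}2\sigma$, the integral being a principal value at $k\cdot\sigma=1$ (the limit as $\varepsilon\downarrow0$ of the integrals over $\{k\cdot\sigma<1-\varepsilon\}$). A solution on a time interval $J$ is a function $h(t,v)$, of class $C^3$ in $v$ for each $t \in J$, which satisfies the equation at every $t\in J$ and $v\in\mathbb R^d$ and such that for every compact $J'\subset J$ there are $a<1/4$ and $C$ with $|\nabla_v^n h(t,v)|\le Ce^{a|v|^2}$ for $0\le n\le 3$, $t\in J'$, $v\in\mathbb R^d$. **Theorem.** Let $B$ be a Boltzmann kernel. (i) If $\overline\gamma(B)\le 4$, then $t\mapsto\int_{\mathbb R^d}|\nabla h(t,v)|^2M(v)\,dv$ is nonincreasing on $J$ for every solution $h$ of the spatially homogeneous linearised Boltzmann equation on any time interval $J$. (ii) The same conclusion holds as soon as $\overline\gamma(B)\le\sqrt{8d}$. (iii) Let $\lambda_1(\mathbb{RP}^{d-1})$ $(=\lambda_2(\mathbb S^{d-1}))$ be the best constant in $\lambda\int_{\mathbb S^{d-1}}g^2\le\int_{\mathbb S^{d-1}}|\nabla g|^2$, and for $\beta:[-1,1]\to\mathbb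 R_+$ let $P_*(\beta)$ be the best constant in $$P_*\cdot\frac12\iint (g(\sigma)-g(k))^2\beta(k\cdot\sigma)\,dk\,d\sigma\ \le\ \frac12\iint\bigl|\nabla g(\sigma)-\nabla g(k)\bigr|^2_{k,\sigma}\,\beta(k\cdot\sigma)\,dk\,d\sigma,$$ both over all smooth even $g:\mathbb S^{d-1}\to\mathbb R$ with $\int g=0$; here $|y-x|^2_{k,\sigma}=|x|^2+|y|^2-2\,(P_{k\sigma}x)\cdot y$ and $P_{k\sigma}x=(k\cdot\sigma)x+(x\cdot k)\sigma-(\sigma\cdot x)k$. Then $P_*(\beta_r)\ge\lambda_1(\mathbb{RP}^{d-1})=2d$ for every section $\beta_r=B(r,\cdot)$, $r>0$. -/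

import Mathlib

open MeasureTheory Filter Set Topology
open scoped ENNReal ContDiff

noncomputable section

/-- The velocity space `ℝ^d` with its Euclidean structure. -/
abbrev Vel (d : ℕ) : Type := EuclideanSpace ℝ (Fin d)

/-- The unit sphere `S^{d-1}`. -/
abbrev USphere (d : ℕ) : Type := Metric.sphere (0 : Vel d) 1

/-- The surface measure on `S^{d-1}` (total mass `|S^{d-1}|`). -/
def surf (d : ℕ) : Measure (USphere d) := (volume : Measure (Vel d)).toSphere

/-- The direction `z / |z|`. -/
def dir {d : ℕ} (z : Vel d) : Vel d := ‖z‖⁻¹ • z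

/-- The centred Gaussian `M(v) = (2π)^{-d/2} exp(-|v|²/2)`. -/
def maxwellian {d : ℕ} (v : Vel d) : ℝ :=
  (2 * Real.pi) ^ (-(d : ℝ) / 2) * Real.exp (-‖v‖ ^ 2 / 2)

/-- The Dirichlet form `∫ |∇h|² M dv`. -/
def dirichletForm {d : ℕ} (h : Vel d → ℝ) : ℝ :=
  ∫ v, ‖gradient h v‖ ^ 2 * maxwellian v

/-! ### Collision kernels `B(|z|, cos θ)`, written `B r x` with `r = |z|` and `x = cos θ` -/

/-- The cross-section for momentum transfer
`∫ (1 - k·σ) B(|z|, k·σ) dσ`, where `k = z / |z|`. -/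
def momentumTransfer {d : ℕ} (B : ℝ → ℝ → ℝ) (z : Vel d) : ℝ≥0∞ :=
  ∫⁻ σ : USphere d,
    ENNReal.ofReal ((1 - inner ℝ (dir z) (σ : Vel d)) * B ‖z‖ (inner ℝ (dir z) (σ : Vel d))) ∂(surf d)

/-- Boltzmann kernels on `ℝ^d`, with or without angular cutoff. Only the values for `r > 0` and
`-1 < cos θ < 1` matter: `B` may be singular at grazing collisions (`cos θ = 1`) and at `r = 0`. -/
structure IsCollisionKernel (d : ℕ) (B : ℝ → ℝ → ℝ) : Prop where
  measurable : Measurable (Function.uncurry B)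
  nonneg : ∀ r, 0 < r → ∀ x ∈ Ioo (-1 : ℝ) 1, 0 ≤ B r x
  differentiable : ∀ r, 0 < r → ∀ x ∈ Ioo (-1 : ℝ) 1, DifferentiableAt ℝ (fun s => B s x) r
  momentum_finite : ∀ z : Vel d, z ≠ 0 → momentumTransfer B z < ⊤
  locally_integrable :
    ∫⁻ z in Metric.ball (0 : Vel d) 1, ENNReal.ofReal (‖z‖ ^ 2) * momentumTransfer B z < ⊤

/-- `γ̄(B, r) = sup_{cos θ} (r / B) |∂B/∂r| (r, cos θ)`, with values in `[0, ∞]`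
(and with `0 / 0 = 0`, `c / 0 = ∞` for `c > 0`). -/
def gammaBarAt (B : ℝ → ℝ → ℝ) (r : ℝ) : ℝ≥0∞ :=
  ⨆ x ∈ Ioo (-1 : ℝ) 1,
    ENNReal.ofReal (r * |deriv (fun s => B s x) r|) / ENNReal.ofReal (B r x)

/-- `γ̄(B) = sup_{r > 0} γ̄(B, r)`. -/
def gammaBar (B : ℝ → ℝ → ℝ) : ℝ≥0∞ := ⨆ r ∈ Ioi (0 : ℝ), gammaBarAt B r

/-! ### The linearised Boltzmann equation -/

/-- Post-collisional velocity `v' = (v + v_*)/2 + (|v - v_*|/2) σ`. -/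
def postV {d : ℕ} (v w σ : Vel d) : Vel d :=
  (2⁻¹ : ℝ) • (v + w) + (‖v - w‖ / 2) • σ

/-- Post-collisional velocity `v'_* = (v + v_*)/2 - (|v - v_*|/2) σ`. -/
def postW {d : ℕ} (v w σ : Vel d) : Vel d :=
  (2⁻¹ : ℝ) • (v + w) - (‖v - w‖ / 2) • σ

/-- The linearised collision integral restricted to the deviation angles with `cos θ < 1 - ε`:
`∫∫_{k·σ < 1-ε} [h(v') + h(v'_*) - h(v) - h(v_*)] B(|v - v_*|, k·σ) M(v_*) dσ dv_*`,
where `k = (v - v_*) / |v - v_*|`. -/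
def linBoltzmannTrunc {d : ℕ} (B : ℝ → ℝ → ℝ) (h : Vel d → ℝ) (v : Vel d) (ε : ℝ) : ℝ :=
  ∫ w : Vel d,
    (∫ σ in {σ : USphere d | inner ℝ (dir (v - w)) (σ : Vel d) < 1 - ε},
      (h (postV v w σ) + h (postW v w σ) - h v - h w)
        * B ‖v - w‖ (inner ℝ (dir (v - w)) (σ : Vel d)) ∂(surf d))
      * maxwellian w

/-- `(ℒ_B h)(v) = q`. The collision integral is a principal value at grazing collisions, as is
necessary for kernels without cutoff; it is the plain integral whenever that one converges
absolutely. -/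
def HasLinBoltzmann {d : ℕ} (B : ℝ → ℝ → ℝ) (h : Vel d → ℝ) (v : Vel d) (q : ℝ) : Prop :=
  Tendsto (linBoltzmannTrunc B h v) (𝓝[>] 0) (𝓝 q)

/-- `h = h(t, v)` is a classical solution of the spatially homogeneous linearised Boltzmann
equation `∂_t h = ℒ_B h` on the time interval `J`: `h(t, ·)` is three times continuously
differentiable, its derivatives of order at most three grow, locally uniformly in time, strictly
slower than `M^{-1/2}`, and the equation holds at every `t ∈ J` and every `v`. -/
structure IsLinBoltzmannSolution (d : ℕ) (B : ℝ → ℝ → ℝ) (J : Set ℝ) (h : ℝ → Vel d → ℝ) :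
    Prop where
  contDiff : ∀ t ∈ J, ContDiff ℝ 3 (h t)
  growth : ∀ s ∈ J, ∀ t ∈ J, ∃ a C : ℝ, a < 1 / 4 ∧
    ∀ τ ∈ Icc s t, ∀ n : ℕ, n ≤ 3 → ∀ v : Vel d,
      ‖iteratedFDeriv ℝ n (h τ) v‖ ≤ C * Real.exp (a * ‖v‖ ^ 2)
  equation : ∀ t ∈ J, ∀ v : Vel d, ∃ q : ℝ,
    HasLinBoltzmann B (h t) v q ∧ HasDerivWithinAt (fun τ => h τ v) q J t

/-- The Dirichlet form is nonincreasing along every solution of the spatially homogeneous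
linearised Boltzmann equation with kernel `B`. -/
def DirichletFormDecays (d : ℕ) (B : ℝ → ℝ → ℝ) : Prop :=
  ∀ (J : Set ℝ), J.OrdConnected → ∀ h : ℝ → Vel d → ℝ, IsLinBoltzmannSolution d B J h →
    AntitoneOn (fun t => dirichletForm (h t)) J

/-! ### Functional inequalities on the sphere -/

/-- Smooth even functions with zero mean on `S^{d-1}`, given as restrictions of smooth functions
on `ℝ^d`. -/
structure IsEvenZeroMean (d : ℕ) (g : Vel d → ℝ) : Prop where
  smooth : ContDiff ℝ ∞ g
  even : ∀ σ : USphere d, g (-(σ : Vel d)) = g σ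
  zero_mean : ∫ σ : USphere d, g σ ∂(surf d) = 0

/-- The intrinsic gradient on the sphere: the projection of the gradient on `σ^⊥`. -/
def sphereGrad {d : ℕ} (g : Vel d → ℝ) (σ : Vel d) : Vel d :=
  gradient g σ - inner ℝ σ (gradient g σ) • σ

/-- `P_{kσ} x = (k·σ) x + (x·k) σ - (σ·x) k`. -/
def collP {d : ℕ} (k σ x : Vel d) : Vel d :=
  inner ℝ k σ • x + inner ℝ x k • σ - inner ℝ σ x • k

/-- `|y - x|²_{k,σ} = |x|² + |y|² - 2 (P_{kσ} x)·y`. -/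
def collSq {d : ℕ} (k σ x y : Vel d) : ℝ :=
  ‖x‖ ^ 2 + ‖y‖ ^ 2 - 2 * inner ℝ (collP k σ x) y

/-- `∫ Γ_β(g) = ½ ∫∫ (g(σ) - g(k))² β(k·σ) dσ dk`. -/
def intGammaBeta (d : ℕ) (β : ℝ → ℝ) (g : Vel d → ℝ) : ℝ≥0∞ :=
  2⁻¹ * ∫⁻ k : USphere d, ∫⁻ σ : USphere d,
    ENNReal.ofReal ((g σ - g k) ^ 2 * β (inner ℝ (k : Vel d) (σ : Vel d))) ∂(surf d) ∂(surf d)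

/-- `∫ Γ_{1,β}(g) = ½ ∫∫ |∇g(σ) - ∇g(k)|²_{k,σ} β(k·σ) dσ dk`. -/
def intGammaOneBeta (d : ℕ) (β : ℝ → ℝ) (g : Vel d → ℝ) : ℝ≥0∞ :=
  2⁻¹ * ∫⁻ k : USphere d, ∫⁻ σ : USphere d,
    ENNReal.ofReal (collSq (k : Vel d) (σ : Vel d) (sphereGrad g k) (sphereGrad g σ)
      * β (inner ℝ (k : Vel d) (σ : Vel d))) ∂(surf d) ∂(surf d)

/-- `P_*`: the best constant in `∫ Γ_β(g) ≤ (1/P_*) ∫ Γ_{1,β}(g)` for even `g` with zero mean. -/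
def pStar (d : ℕ) (β : ℝ → ℝ) : ℝ≥0∞ :=
  sSup {P : ℝ≥0∞ | ∀ g : Vel d → ℝ, IsEvenZeroMean d g →
    P * intGammaBeta d β g ≤ intGammaOneBeta d β g}

/-- `λ₁(ℝP^{d-1}) = λ₂(S^{d-1})`: the best constant in the Poincaré inequality
`∫ g² ≤ (1/λ) ∫ |∇g|²` for even `g` with zero mean on the sphere. -/
def lambdaOneRP (d : ℕ) : ℝ≥0∞ :=
  sSup {L : ℝ≥0∞ | ∀ g : Vel d → ℝ, IsEvenZeroMean d g →
    L * ∫⁻ σ : USphere d, ENNReal.ofReal (g σ ^ 2) ∂(surf d)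
      ≤ ∫⁻ σ : USphere d, ENNReal.ofReal (‖sphereGrad g (σ : Vel d)‖ ^ 2) ∂(surf d)}

end

/-! Write `A h = Δh - v·∇h` (`ouOp (1 / 2)`). Formally, integration by parts against `M` gives `d/dt
∫ |∇h|² M = -2 ∫ (A h)(ℒ_B h) M`, so decay amounts to `∫ (A h)(ℒ_B h) M ≥ 0`.

Pass to the centre of mass `c` and half the relative velocity `y = r k`, so that `v = c + r k`, `v_*
= c - r k`, and put `U(c, y) = h(c + y) + h(c - y)`. The collision difference is the increment `U(c,
rσ) - U(c, rk)`, the product of Gaussians becomes a multiple of `e^{-|c|²} e^{-r²}`, and `A h(v) + A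
h(v_*) = ½ (Δ_c - 2c·∇_c) U + ½ (Δ_y - 2y·∇_y) U` (`symm2_ouOp`). Symmetrising over the four
velocities leaves the integral of (increment of `U`) × (increment of the right side), which has to
be nonpositive (`dissipation_nonpos`).

The `c`-part is minus a square after integration by parts at fixed `(r, k, σ)`. The `y`-part splits
in polar coordinates (`ouOp_polar`). Its radial piece can have the wrong sign only because `B`
depends on `r`; integrating by parts, using `r |∂_r B| ≤ γ B` and completing a square, it is at most
`γ²/4 ∬ B (ΔU)²/r²`, where `ΔU` denotes the increment (`radial_inequality`). The angular piece is at
most `-2d ∬ B (ΔU)²/r²` (`angular_inequality`), because `U` is even in `y`. The sum is nonpositive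
once `γ² ≤ 8d`. Since `d ≥ 2`, the value `γ = 4` is covered.

The angular estimate is the bound `P_* ≥ 2d`, proved in `kernel_poincare`. The form `∬ β(k·σ) (f(σ)
- f(k)) (g(σ) - g(k))` is rotation invariant, so the angular derivatives `x_a ∂_b - x_b ∂_a` are
skew and the spherical Laplacian is symmetric for it. Its eigenspaces are therefore orthogonal for
the form, whatever `β ≥ 0` is. On even functions the eigenvalues are `2j(2j + d - 2)`; constants
have zero increment, and the next eigenvalue is `2d`. This is done algebraically for even
homogeneous polynomials (`quadForm_pA_ge`) and carried to even `C¹` functions by averaging against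
`(x·σ)^{2n}`, which yields polynomials and commutes with angular derivatives. The twisted length
`|·|_{k,σ}` is the Euclidean length of a difference of bivectors (`collSq_eq`), so the estimate is
literally the one defining `P_*`. With `β = 1` it is the Poincaré inequality, which `σ_i σ_j`
saturates.

Two analytic points remain. Without cutoff, everything is done for the kernel truncated to `k·σ < 1
- ε`; a bound for the truncated operator uniform in `ε`, obtained by pairing `σ` with its reflection
about `k`, allows the limit (`exists_abs_linBoltzmannTrunc_le`). In time only `h`, not `∇h`, is
known to be differentiable; convexity of the Dirichlet form makes this enough
(`dirichletForm_sub_le`). -/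

/-! ### The surface measure and rotations -/

noncomputable section Sphere

open scoped Pointwise

variable {d : ℕ}

/-- The action of a linear isometry on the unit sphere. -/
def sphereMap (R : Vel d ≃ₗᵢ[ℝ] Vel d) (σ : USphere d) : USphere d := ⟨R σ, by simp⟩

@[simp] theorem coe_sphereMap (R : Vel d ≃ₗᵢ[ℝ] Vel d) (σ : USphere d) :
    (sphereMap R σ : Vel d) = R σ := rfl

theorem continuous_sphereMap (R : Vel d ≃ₗᵢ[ℝ] Vel d) : Continuous (sphereMap R) :=
  (R.continuous.comp continuous_subtype_val).subtype_mk _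

instance : IsFiniteMeasure (surf d) := inferInstanceAs (IsFiniteMeasure (Measure.toSphere _))

instance : (surf d).IsOpenPosMeasure :=
  inferInstanceAs (Measure.IsOpenPosMeasure (Measure.toSphere _))

theorem norm_usphere (σ : USphere d) : ‖(σ : Vel d)‖ = 1 := by simp

/-- The surface measure of a set is a multiple of the volume of the truncated cone over it; an
isometry carries cones to cones and preserves volume. -/
theorem measurePreserving_sphereMap (R : Vel d ≃ₗᵢ[ℝ] Vel d) :
    MeasurePreserving (sphereMap R) (surf d) (surf d) := by
  refine ⟨(continuous_sphereMap R).measurable, Measure.ext fun s hs => ?_⟩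
  rw [Measure.map_apply (continuous_sphereMap R).measurable hs, surf, Measure.toSphere_apply' _ hs,
    Measure.toSphere_apply' _ ((continuous_sphereMap R).measurable hs)]
  congr 1
  have h : Ioo (0 : ℝ) 1 • ((↑) '' (sphereMap R ⁻¹' s) : Set (Vel d))
      = R ⁻¹' (Ioo (0 : ℝ) 1 • ((↑) '' s)) := by
    ext x
    simp only [Set.mem_smul, mem_image, mem_preimage]
    constructor
    · rintro ⟨r, hr, _, ⟨σ, hσ, rfl⟩, rfl⟩
      exact ⟨r, hr, _, ⟨_, hσ, rfl⟩, by simp⟩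
    · rintro ⟨r, hr, _, ⟨σ, hσ, rfl⟩, hx⟩
      refine ⟨r, hr, _, ⟨sphereMap R.symm σ, ?_, rfl⟩, ?_⟩
      · have : sphereMap R (sphereMap R.symm σ) = σ := Subtype.ext (by simp)
        rwa [this]
      · apply R.injective
        simpa using hx
  rw [h]
  exact (R.measurePreserving).measure_preimage_equiv (f := R.toMeasurableEquiv) _

/-- The product of the surface measure with itself. -/
abbrev surf2 (d : ℕ) : Measure (USphere d × USphere d) := (surf d).prod (surf d)

theorem measurePreserving_sphereMap_prod (R : Vel d ≃ₗᵢ[ℝ] Vel d) :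
    MeasurePreserving (Prod.map (sphereMap R) (sphereMap R)) (surf2 d) (surf2 d) :=
  (measurePreserving_sphereMap R).prod (measurePreserving_sphereMap R)

/-! ### Rotation flows and integration by parts along them -/

/-- The one-parameter group of rotations generated by a skew-adjoint operator. -/
def rot (A : Vel d →L[ℝ] Vel d) (hA : A ∈ skewAdjoint (Vel d →L[ℝ] Vel d)) (t : ℝ) :
    Vel d ≃ₗᵢ[ℝ] Vel d :=
  Unitary.linearIsometryEquiv
    ⟨NormedSpace.exp (t • A),
      letI := NormedAlgebra.restrictScalars ℚ ℝ (Vel d →L[ℝ] Vel d)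
      NormedSpace.exp_mem_unitary_of_mem_skewAdjoint (skewAdjoint.smul_mem t hA)⟩

theorem rot_apply (A : Vel d →L[ℝ] Vel d) (hA) (t : ℝ) (x : Vel d) :
    rot A hA t x = NormedSpace.exp (t • A) x := rfl

theorem rot_zero (A : Vel d →L[ℝ] Vel d) (hA) (x : Vel d) : rot A hA 0 x = x := by
  have h : (0 : ℝ) • A = 0 := zero_smul ℝ A
  rw [rot_apply]
  erw [h]
  rw [NormedSpace.exp_zero, one_apply_eq_self]

theorem hasDerivAt_rot (A : Vel d →L[ℝ] Vel d) (hA) (t : ℝ) (x : Vel d) :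
    HasDerivAt (fun t => rot A hA t x) (A (rot A hA t x)) t := by
  have := (hasDerivAt_exp_smul_const' (𝕂 := ℝ) A t).clm_apply (hasDerivAt_const t x)
  simpa [rot_apply] using this

/-- The derivative of `f` along the linear vector field `A`. -/
def lieD (A : Vel d →L[ℝ] Vel d) (f : Vel d → ℝ) (x : Vel d) : ℝ := fderiv ℝ f x (A x)

theorem hasDerivAt_comp_rot (A : Vel d →L[ℝ] Vel d) (hA) {f : Vel d → ℝ} (hf : ContDiff ℝ 1 f)
    (t : ℝ) (x : Vel d) :
    HasDerivAt (fun t => f (rot A hA t x)) (lieD A f (rot A hA t x)) t :=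
  ((hf.differentiable one_ne_zero _).hasFDerivAt.comp_hasDerivAt t (hasDerivAt_rot A hA t x))

theorem contDiff_lieD (A : Vel d →L[ℝ] Vel d) {f : Vel d → ℝ} {m n : WithTop ℕ∞}
    (hf : ContDiff ℝ n f) (h : m + 1 ≤ n) : ContDiff ℝ m (lieD A f) :=
  (hf.fderiv_right h).clm_apply A.contDiff

theorem continuous_lieD (A : Vel d →L[ℝ] Vel d) {f : Vel d → ℝ} (hf : ContDiff ℝ 1 f) :
    Continuous (lieD A f) := (contDiff_lieD (m := 0) A hf (by simp)).continuous

/-- The integral of a derivative along a measure-preserving flow vanishes. -/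
theorem integral_deriv_flow_eq_zero {X : Type*} [MeasurableSpace X] {μ : Measure X}
    {R : ℝ → X → X} (hR : ∀ t, MeasurePreserving (R t) μ μ) (hR0 : ∀ x, R 0 x = x)
    {Φ Φ' bd : X → ℝ}
    (hΦ : Integrable Φ μ) (hΦ' : AEStronglyMeasurable Φ' μ) (hbd : Integrable bd μ)
    (hb : ∀ t x, |Φ' (R t x)| ≤ bd x)
    (hd : ∀ t x, HasDerivAt (fun t => Φ (R t x)) (Φ' (R t x)) t) : ∫ x, Φ' x ∂μ = 0 := by
  have key := hasDerivAt_integral_of_dominated_loc_of_deriv_le (μ := μ) (x₀ := (0 : ℝ))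
    (F := fun t x => Φ (R t x)) (F' := fun t x => Φ' (R t x)) (bound := bd) univ_mem
    (Eventually.of_forall fun t => ((hR t).integrable_comp_of_integrable hΦ).aestronglyMeasurable)
    (by simpa [hR0] using hΦ) (by simpa [hR0] using hΦ')
    (Eventually.of_forall fun x t _ => hb t x) hbd (Eventually.of_forall fun x t _ => hd t x)
  -- Invariance of `μ` makes the integral constant in `t`, while differentiating under the integral
  -- at `t = 0` gives `∫ Φ'`.
  have hc : (fun t => ∫ x, Φ (R t x) ∂μ) = fun _ => ∫ x, Φ x ∂μ := by
    funext t
    have h1 := integral_map (hR t).measurable.aemeasurable (μ := μ) (f := Φ)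
      (by rw [(hR t).map_eq]; exact hΦ.aestronglyMeasurable)
    rw [(hR t).map_eq] at h1
    exact h1.symm
  have h2 := key.2
  simp only [hc, hR0] at h2
  exact h2.unique (hasDerivAt_const _ _)

theorem exists_bound_on_sphere {f : Vel d → ℝ} (hf : Continuous f) :
    ∃ C, 0 ≤ C ∧ ∀ σ : USphere d, |f σ| ≤ C := by
  obtain ⟨C, hC⟩ := (isCompact_sphere (0 : Vel d) 1).exists_bound_of_continuousOn hf.continuousOn
  exact ⟨max C 0, le_max_right _ _, fun σ => (hC σ σ.2).trans (le_max_left _ _)⟩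

theorem integrable_sphere {f : USphere d → ℝ} (hf : Continuous f) : Integrable f (surf d) := by
  have : CompactSpace (USphere d) := inferInstance
  exact hf.integrable_of_hasCompactSupport (HasCompactSupport.of_compactSpace f)

theorem integral_lieD_eq_zero (A : Vel d →L[ℝ] Vel d)
    (hA : A ∈ skewAdjoint (Vel d →L[ℝ] Vel d)) {f : Vel d → ℝ} (hf : ContDiff ℝ 1 f) :
    ∫ σ : USphere d, lieD A f σ ∂(surf d) = 0 := by
  obtain ⟨C, -, hC⟩ := exists_bound_on_sphere (continuous_lieD A hf)
  refine integral_deriv_flow_eq_zero (R := fun t => sphereMap (rot A hA t)) (bd := fun _ => C)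
    (Φ := fun σ => f σ)
    (fun t => measurePreserving_sphereMap _) (fun x => Subtype.ext (by simp [rot_zero]))
    (integrable_sphere (hf.continuous.comp continuous_subtype_val))
    ((continuous_lieD A hf).comp continuous_subtype_val).aestronglyMeasurable
    (integrable_const _) (fun t x => hC _) (fun t x => hasDerivAt_comp_rot A hA hf t x)

/-- The increment `f σ - f k`. -/
def incr (f : Vel d → ℝ) (p : USphere d × USphere d) : ℝ := f p.2 - f p.1

/-- The cosine of the angle between two points of the sphere. -/
def cosA (p : USphere d × USphere d) : ℝ := inner ℝ (p.1 : Vel d) (p.2 : Vel d)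

theorem continuous_cosA : Continuous (cosA (d := d)) := by unfold cosA; fun_prop

theorem continuous_incr {f : Vel d → ℝ} (hf : Continuous f) : Continuous (incr f) := by
  unfold incr; fun_prop

theorem abs_incr_le {f : Vel d → ℝ} {C : ℝ} (hC : ∀ σ : USphere d, |f σ| ≤ C) (p) :
    |incr f p| ≤ 2 * C := by
  have h1 := hC p.1; have h2 := hC p.2
  rw [abs_le] at *
  unfold incr
  constructor <;> linarith [h1.1, h1.2, h2.1, h2.2]

theorem integrable_kernel_mul {β : ℝ → ℝ} (hβ : Integrable (fun p => β (cosA p)) (surf2 d))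
    {F : USphere d × USphere d → ℝ} (hF : Continuous F) :
    Integrable (fun p => β (cosA p) * F p) (surf2 d) := by
  obtain ⟨C, hC⟩ := isCompact_univ.exists_bound_of_continuousOn hF.continuousOn
  exact hβ.mul_bdd (c := C) hF.aestronglyMeasurable (Eventually.of_forall fun p => hC p (mem_univ _))

/-- Integration by parts on the sphere with a rotation-invariant kernel. -/
theorem integral_kernel_lieD {β : ℝ → ℝ} (hβ : Integrable (fun p => β (cosA p)) (surf2 d))
    (A : Vel d →L[ℝ] Vel d) (hA : A ∈ skewAdjoint (Vel d →L[ℝ] Vel d))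
    {f g : Vel d → ℝ} (hf : ContDiff ℝ 1 f) (hg : ContDiff ℝ 1 g) :
    ∫ p, β (cosA p) * (incr (lieD A f) p * incr g p) ∂(surf2 d)
      = - ∫ p, β (cosA p) * (incr f p * incr (lieD A g) p) ∂(surf2 d) := by
  have cf := continuous_incr hf.continuous
  have cg := continuous_incr hg.continuous
  have cf' := continuous_incr (continuous_lieD A hf)
  have cg' := continuous_incr (continuous_lieD A hg)
  rw [← sub_eq_zero, sub_neg_eq_add]
  refine (integral_add (integrable_kernel_mul hβ (cf'.mul cg))
    (integrable_kernel_mul hβ (cf.mul cg'))).symm.trans ?_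
  simp_rw [← mul_add]
  have cont := (cf'.mul cg).add (cf.mul cg')
  obtain ⟨C, hC⟩ := isCompact_univ.exists_bound_of_continuousOn cont.continuousOn
  refine integral_deriv_flow_eq_zero
    (R := fun t => Prod.map (sphereMap (rot A hA t)) (sphereMap (rot A hA t)))
    (bd := fun p => |β (cosA p)| * C) (Φ := fun p => β (cosA p) * (incr f p * incr g p))
    (fun t => measurePreserving_sphereMap_prod _)
    (fun x => Prod.ext (Subtype.ext (by simp [rot_zero])) (Subtype.ext (by simp [rot_zero])))
    (integrable_kernel_mul hβ (cf.mul cg))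
    (integrable_kernel_mul hβ cont).aestronglyMeasurable
    (hβ.abs.mul_const C) (fun t p => ?_) (fun t p => ?_)
  -- Rotating both points leaves the angle unchanged, so the derivative along the flow never falls
  -- on `β`, which may be merely integrable.
  · have : cosA (Prod.map (sphereMap (rot A hA t)) (sphereMap (rot A hA t)) p) = cosA p := by
      simp [cosA]
    rw [this, abs_mul]
    exact mul_le_mul_of_nonneg_left (hC _ (mem_univ _)) (abs_nonneg _)
  · have : ∀ t, cosA (Prod.map (sphereMap (rot A hA t)) (sphereMap (rot A hA t)) p) = cosA p := by
      intro t; simp [cosA]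
    simp_rw [this]
    refine HasDerivAt.const_mul _ ?_
    have h1 := (hasDerivAt_comp_rot A hA hf t p.2).sub (hasDerivAt_comp_rot A hA hf t p.1)
    have h2 := (hasDerivAt_comp_rot A hA hg t p.2).sub (hasDerivAt_comp_rot A hA hg t p.1)
    exact h1.mul h2

/-! ### Angular derivatives -/

/-- The standard basis vector. -/
def eb (a : Fin d) : Vel d := EuclideanSpace.single a 1

/-- The generator of the rotations in the plane of the coordinates `a`, `b`. -/
def angGen (a b : Fin d) : Vel d →L[ℝ] Vel d :=
  (EuclideanSpace.proj a : Vel d →L[ℝ] ℝ).smulRight (eb b)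
    - (EuclideanSpace.proj b : Vel d →L[ℝ] ℝ).smulRight (eb a)

theorem angGen_apply (a b : Fin d) (x : Vel d) : angGen a b x = x a • eb b - x b • eb a := rfl

theorem inner_eb (a : Fin d) (x : Vel d) : inner ℝ (eb a) x = x a := by
  simp [eb, EuclideanSpace.inner_single_left]

theorem angGen_mem (a b : Fin d) : angGen a b ∈ skewAdjoint (Vel d →L[ℝ] Vel d) := by
  rw [skewAdjoint.mem_iff, ContinuousLinearMap.star_eq_adjoint, eq_comm,
    ContinuousLinearMap.eq_adjoint_iff]
  intro x y
  simp only [neg_apply, angGen_apply, inner_neg_left, inner_sub_left,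
    inner_sub_right, inner_smul_left, inner_smul_right, inner_eb, real_inner_comm (eb _) x]
  simp
  ring

/-- The angular derivative `x_a ∂_b - x_b ∂_a`. -/
abbrev ang (a b : Fin d) : (Vel d → ℝ) → Vel d → ℝ := lieD (angGen a b)

/-- The partial derivative in the direction of a coordinate. -/
def pd (a : Fin d) (f : Vel d → ℝ) (x : Vel d) : ℝ := fderiv ℝ f x (eb a)

theorem ang_eq (a b : Fin d) (f : Vel d → ℝ) (x : Vel d) :
    ang a b f x = x a * pd b f x - x b * pd a f x := by
  simp [lieD, angGen_apply, pd]

end Sphere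


/-! ### Homogeneous polynomials and angular momentum -/

noncomputable section Poly

open MvPolynomial

variable {d : ℕ}

/-- The angular derivative `X_a ∂_b - X_b ∂_a` on polynomials. -/
def pL (a b : Fin d) : MvPolynomial (Fin d) ℝ →ₗ[ℝ] MvPolynomial (Fin d) ℝ :=
  LinearMap.mulLeft ℝ (X a) ∘ₗ (pderiv b).toLinearMap
    - LinearMap.mulLeft ℝ (X b) ∘ₗ (pderiv a).toLinearMap

theorem pL_apply (a b : Fin d) (p : MvPolynomial (Fin d) ℝ) :
    pL a b p = X a * pderiv b p - X b * pderiv a p := by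
  simp [pL]

/-- Minus the spherical Laplacian on polynomials. -/
def pA : MvPolynomial (Fin d) ℝ →ₗ[ℝ] MvPolynomial (Fin d) ℝ :=
  (-(1 / 2) : ℝ) • ∑ a, ∑ b, pL a b ∘ₗ pL a b

theorem pA_apply (p : MvPolynomial (Fin d) ℝ) :
    pA p = (-(1 / 2) : ℝ) • ∑ a, ∑ b, pL a b (pL a b p) := by
  simp [pA, LinearMap.sum_apply]

/-- The polynomial `|x|²`. -/
def pN : MvPolynomial (Fin d) ℝ := ∑ i, X i ^ 2

/-- The Laplacian on polynomials. -/
def pLap (p : MvPolynomial (Fin d) ℝ) : MvPolynomial (Fin d) ℝ := ∑ i, pderiv i (pderiv i p)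

theorem pL_pN (a b : Fin d) : pL a b pN = 0 := by
  have h : ∀ i : Fin d, pderiv i (pN : MvPolynomial (Fin d) ℝ) = 2 * X i := by
    intro i
    simp [pN, pderiv_X, Pi.single_apply]
  rw [pL_apply, h, h]; ring

theorem pL_mul (a b : Fin d) (p q : MvPolynomial (Fin d) ℝ) :
    pL a b (p * q) = pL a b p * q + p * pL a b q := by
  simp only [pL_apply, pderiv_mul]; ring

/-- Since `|x|²` is rotation invariant and equals one on the sphere, multiplying by it raises the
degree by two while keeping eigenvectors and their restrictions to the sphere. -/
theorem pA_pN_mul (p : MvPolynomial (Fin d) ℝ) : pA (pN * p) = pN * pA p := by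
  simp only [pA_apply, pL_mul, pL_pN, zero_mul, zero_add, ← Finset.mul_sum, mul_smul_comm]

/-- This is `|x|² Δ = E(E + d - 2) + Δ_S` with `E` the Euler operator, which acts as `m` on
homogeneous polynomials of degree `m`. The sums `hE` and `hEE` are Euler's identity, used once and
twice. -/
theorem pA_of_isHomogeneous {m : ℕ} {p : MvPolynomial (Fin d) ℝ} (hp : p.IsHomogeneous m) :
    pA p = ((m : ℝ) * (m + d - 2)) • p - pN * pLap p := by
  have hE : ∑ i, X i * pderiv i p = C (m : ℝ) * p := by
    rw [hp.sum_X_mul_pderiv, nsmul_eq_mul]; simp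
  have hEE : ∑ a, ∑ b, X a * X b * pderiv b (pderiv a p) = C ((m : ℝ) * (m - 1)) * p := by
    have : ∀ a, ∑ b, X a * X b * pderiv b (pderiv a p) = X a * ((m - 1 : ℕ) • pderiv a p) := by
      intro a
      rw [← (hp.pderiv (i := a)).sum_X_mul_pderiv, Finset.mul_sum]
      simp_rw [mul_assoc]
    simp_rw [this, mul_smul_comm, ← Finset.smul_sum, hE, nsmul_eq_mul, ← mul_assoc]
    congr 1
    -- The degree of a derivative is the truncated difference `m - 1`; for `m = 0` the factor `m`
    -- makes both sides vanish.
    rcases m with _ | m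
    · simp
    · simp; ring
  have h1 : ∀ a b : Fin d, pL a b (pL a b p) = X a ^ 2 * pderiv b (pderiv b p)
      + X b ^ 2 * pderiv a (pderiv a p)
      - X a * X b * pderiv b (pderiv a p) - X b * X a * pderiv a (pderiv b p)
      + (if a = b then X a * pderiv a p + X b * pderiv b p else 0)
      - X a * pderiv a p - X b * pderiv b p := by
    intro a b
    simp only [pL_apply, pderiv_mul, map_sub, pderiv_X, Pi.single_apply]
    by_cases h : a = b
    · subst h; simp; ring
    · simp [h, Ne.symm h]; ring
  have hS : ∑ a, ∑ b, pL a b (pL a b p) = 2 * (pN * pLap p) - 2 * (C ((m : ℝ) * (m - 1)) * p)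
      + (2 - 2 * C (d : ℝ)) * (C (m : ℝ) * p) := by
    simp_rw [h1, Finset.sum_sub_distrib, Finset.sum_add_distrib, Finset.sum_sub_distrib,
      Finset.sum_add_distrib]
    have e1 : ∑ a : Fin d, ∑ b : Fin d, X a ^ 2 * pderiv b (pderiv b p) = pN * pLap p := by
      rw [pN, pLap, Finset.sum_mul_sum]
    have e2 : ∑ a : Fin d, ∑ b : Fin d, X b ^ 2 * pderiv a (pderiv a p) = pN * pLap p := by
      rw [Finset.sum_comm, e1]
    have e3 : ∑ a : Fin d, ∑ b : Fin d, X b * X a * pderiv a (pderiv b p)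
        = C ((m : ℝ) * (m - 1)) * p := by
      rw [Finset.sum_comm, hEE]
    rw [e1, e2, e3, hEE]
    simp [Finset.sum_add_distrib, hE, ← Finset.mul_sum]
    ring
  rw [pA_apply, hS, smul_eq_C_mul, smul_eq_C_mul]
  have e : (C (-(1 / 2) : ℝ) : MvPolynomial (Fin d) ℝ) * 2 = -1 := by
    rw [show (2 : MvPolynomial (Fin d) ℝ) = C 2 from (map_ofNat C 2).symm, ← C_mul]
    norm_num
  simp only [C_mul, C_sub, C_add, C_1]
  rw [show (C 2 : MvPolynomial (Fin d) ℝ) = 2 from map_ofNat C 2]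
  linear_combination (pN * pLap p - (C (m : ℝ) * (C (m : ℝ) - 1) * p)
      + (1 - C (d : ℝ)) * (C (m : ℝ) * p)) * e

/-! ### Harmonic decomposition and the spectral gap on even polynomials -/

/-- The eigenvalues of the spherical Laplacian on even functions. -/
def lam (d j : ℕ) : ℝ := ((2 * j : ℕ) : ℝ) * ((2 * j : ℕ) + d - 2)

theorem lam_strictMono (hd : 2 ≤ d) : StrictMono (lam d) := by
  refine strictMono_nat_of_lt_succ fun j => ?_
  have h : (2 : ℝ) ≤ d := by exact_mod_cast hd
  have hj : (0 : ℝ) ≤ j := Nat.cast_nonneg j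
  simp only [lam]
  push_cast
  nlinarith

/-- Induction on the degree: decompose `Δp`, lift its components by `|x|²`, and correct `p` by them
so that the remainder is a new eigenvector. The last clause records that the component with
eigenvalue zero is a multiple of a power of `|x|²`, hence constant on the sphere. -/
theorem exists_harmonic_decomposition (hd : 2 ≤ d) (m : ℕ) :
    ∀ p : MvPolynomial (Fin d) ℝ, p.IsHomogeneous (2 * m) →
    ∃ (c : ℕ → MvPolynomial (Fin d) ℝ) (a : ℝ), p = ∑ j ∈ Finset.range (m + 1), c j ∧
      (∀ j, pA (c j) = lam d j • c j) ∧ c 0 = C a * pN ^ m := by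
  induction m with
  | zero =>
    intro p hp
    obtain ⟨a, rfl⟩ : ∃ a, p = C a := ⟨_, (totalDegree_eq_zero_iff_eq_C (p := p)).1
      (Nat.le_zero.1 hp.totalDegree_le)⟩
    refine ⟨fun j => if j = 0 then C a else 0, a, by simp, fun j => ?_, by simp⟩
    rcases j with _ | j
    · simp [pA_apply, pL_apply, lam]
    · simp
  | succ m ih =>
    intro p hp
    have hL : (pLap p).IsHomogeneous (2 * m) := by
      refine IsHomogeneous.sum _ _ _ fun i _ => ?_
      have := (hp.pderiv (i := i)).pderiv (i := i)
      rwa [show 2 * (m + 1) - 1 - 1 = 2 * m by omega] at this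
    obtain ⟨c, a, hc, hA, h0⟩ := ih _ hL
    have hne : ∀ j ∈ Finset.range (m + 1), lam d (m + 1) - lam d j ≠ 0 := fun j hj =>
      sub_ne_zero.2 (lam_strictMono hd (Finset.mem_range.1 hj)).ne'
    -- The coefficient solves `|x|² c_j + λ_j e_j = λ_{m+1} e_j`, which is exactly what makes `p - ∑
    -- e_j` an eigenvector for `λ_{m+1}`, given `pA p = λ_{m+1} p - |x|² Δp`.
    set e : ℕ → MvPolynomial (Fin d) ℝ := fun j => (lam d (m + 1) - lam d j)⁻¹ • (pN * c j) with he
    have heA : ∀ j, pA (e j) = lam d j • e j := by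
      intro j
      simp only [he, map_smul, pA_pN_mul, hA, mul_smul_comm]
      rw [smul_comm]
    refine ⟨fun j => if j < m + 1 then e j
      else if j = m + 1 then p - ∑ j ∈ Finset.range (m + 1), e j else 0,
      (lam d (m + 1) - lam d 0)⁻¹ * a, ?_, fun j => ?_, ?_⟩
    · rw [Finset.sum_range_succ]
      have : ∑ x ∈ Finset.range (m + 1), (if x < m + 1 then e x
          else if x = m + 1 then p - ∑ j ∈ Finset.range (m + 1), e j else 0)
          = ∑ x ∈ Finset.range (m + 1), e x :=
        Finset.sum_congr rfl fun x hx => by rw [if_pos (Finset.mem_range.1 hx)]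
      rw [this]; simp
    · beta_reduce
      split_ifs with h1 h2
      · exact heA j
      · subst h2
        rw [map_sub, map_sum, pA_of_isHomogeneous hp, hc, Finset.mul_sum, smul_sub,
          Finset.smul_sum, sub_sub, ← Finset.sum_add_distrib]
        congr 1
        refine Finset.sum_congr rfl fun j hj => ?_
        rw [heA]
        simp only [he, smul_smul]
        nth_rewrite 1 [← one_smul ℝ (pN * c j)]
        rw [← add_smul]
        congr 1
        have := hne j hj
        field_simp
        ring
      · simp
    · simp only [he, Nat.succ_pos, if_true, h0]
      rw [smul_eq_C_mul, C_mul, pow_succ]; ring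

/-- Symmetry of `pA` for `q` makes eigenvectors with distinct eigenvalues `q`-orthogonal, so both
sides become diagonal. The constant component is in the kernel of `q`, and the others have
eigenvalue at least `lam d 1 = 2d`. Semidefiniteness of `q` suffices. -/
theorem quadForm_pA_ge (hd : 2 ≤ d)
    (q : MvPolynomial (Fin d) ℝ →ₗ[ℝ] MvPolynomial (Fin d) ℝ →ₗ[ℝ] ℝ)
    (hpos : ∀ f, 0 ≤ q f f)
    (hA : ∀ f g, q (pA f) g = q f (pA g)) (hN : ∀ a m g, q (C a * pN ^ m) g = 0)
    {m : ℕ} {p : MvPolynomial (Fin d) ℝ} (hp : p.IsHomogeneous (2 * m)) :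
    2 * d * q p p ≤ q (pA p) p := by
  obtain ⟨c, a, hc, hcA, h0⟩ := exists_harmonic_decomposition hd m p hp
  have horth : ∀ i j, i ≠ j → q (c i) (c j) = 0 := by
    intro i j hij
    have h := hA (c i) (c j)
    rw [hcA, hcA, map_smul, map_smul, LinearMap.smul_apply, smul_eq_mul, smul_eq_mul,
      ← sub_eq_zero, ← sub_mul] at h
    exact (mul_eq_zero.1 h).resolve_left (sub_ne_zero.2 ((lam_strictMono hd).injective.ne hij))
  have hd' : (2 : ℝ) ≤ d := by exact_mod_cast hd
  have e1 : q p p = ∑ j ∈ Finset.range (m + 1), q (c j) (c j) := by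
    rw [hc]
    simp only [map_sum, LinearMap.sum_apply]
    refine Finset.sum_congr rfl fun i hi => ?_
    exact Finset.sum_eq_single_of_mem i hi fun j _ hj => horth _ _ hj
  have e2 : q (pA p) p = ∑ j ∈ Finset.range (m + 1), lam d j * q (c j) (c j) := by
    rw [hc]
    simp only [map_sum, LinearMap.sum_apply, hcA, map_smul, LinearMap.smul_apply, smul_eq_mul]
    refine Finset.sum_congr rfl fun i hi => ?_
    refine Finset.sum_eq_single_of_mem i hi fun j _ hj => ?_
    rw [horth _ _ hj, mul_zero]
  rw [e1, e2, Finset.mul_sum]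
  refine Finset.sum_le_sum fun j _ => ?_
  rcases Nat.eq_zero_or_pos j with rfl | hj
  · rw [h0, hN]; simp
  · refine mul_le_mul_of_nonneg_right ?_ (hpos _)
    have h1 : lam d 1 ≤ lam d j := (lam_strictMono hd).monotone hj
    refine le_trans (le_of_eq ?_) h1
    simp [lam]

/-! ### Polynomials as functions -/

/-- Evaluation of a polynomial as a function on `ℝ^d`. -/
def pev (p : MvPolynomial (Fin d) ℝ) (x : Vel d) : ℝ := eval (fun i => x i) p

theorem pev_C (a : ℝ) : pev (C a : MvPolynomial (Fin d) ℝ) = fun _ => a := by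
  funext x; simp [pev]

theorem pev_add (p q : MvPolynomial (Fin d) ℝ) : pev (p + q) = fun x => pev p x + pev q x := by
  funext x; simp [pev]

theorem pev_mul_X (p : MvPolynomial (Fin d) ℝ) (i : Fin d) :
    pev (p * X i) = fun x => pev p x * (EuclideanSpace.proj i : Vel d →L[ℝ] ℝ) x := by
  funext x; simp [pev]

theorem hasFDerivAt_pev (p : MvPolynomial (Fin d) ℝ) (x : Vel d) :
    HasFDerivAt (pev p)
      (∑ i, pev (pderiv i p) x • (EuclideanSpace.proj i : Vel d →L[ℝ] ℝ)) x := by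
  induction p using MvPolynomial.induction_on with
  | C a =>
    rw [pev_C]
    simpa [pev] using hasFDerivAt_const a x
  | add p q hp hq =>
    rw [pev_add]
    refine (hp.add hq).congr_fderiv ?_
    simp [pev, add_smul, Finset.sum_add_distrib]
  | mul_X p n hp =>
    rw [pev_mul_X]
    refine (hp.mul ((EuclideanSpace.proj n : Vel d →L[ℝ] ℝ).hasFDerivAt (x := x))).congr_fderiv ?_
    ext v
    have h : ∀ i, pev (pderiv i (p * X n)) x
        = (if i = n then pev p x else 0) + x n * pev (pderiv i p) x := by
      intro i
      by_cases h : i = n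
      · subst h; simp [pev, pderiv_X]
      · simp [pev, pderiv_X, h]
    simp only [h]
    simp [add_mul, Finset.sum_add_distrib, Finset.mul_sum, mul_assoc]

theorem pd_pev (a : Fin d) (p : MvPolynomial (Fin d) ℝ) : pd a (pev p) = pev (pderiv a p) := by
  funext x
  rw [pd, (hasFDerivAt_pev p x).fderiv]
  simp [eb]

theorem contDiff_pev (p : MvPolynomial (Fin d) ℝ) {n : WithTop ℕ∞} : ContDiff ℝ n (pev p) := by
  induction p using MvPolynomial.induction_on with
  | C a => rw [pev_C]; exact contDiff_const
  | add p q hp hq => rw [pev_add]; exact hp.add hq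
  | mul_X p i hp =>
    rw [pev_mul_X]
    exact hp.mul (EuclideanSpace.proj i : Vel d →L[ℝ] ℝ).contDiff

theorem ang_pev (a b : Fin d) (p : MvPolynomial (Fin d) ℝ) :
    ang a b (pev p) = pev (pL a b p) := by
  funext x
  rw [ang_eq, pd_pev, pd_pev, pL_apply]
  simp [pev]

end Poly


/-! ### The comparison of quadratic forms on the sphere -/

noncomputable section Core

open MvPolynomial

variable {d : ℕ}

/-- The operator with kernel `(x · σ)^n`. -/
def zonal (n : ℕ) (U : Vel d → ℝ) (x : Vel d) : ℝ :=
  ∫ σ : USphere d, inner ℝ x (σ : Vel d) ^ n * U σ ∂(surf d)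

theorem integrable_zonal (n : ℕ) {U : Vel d → ℝ} (hU : Continuous U) (x : Vel d) :
    Integrable (fun σ : USphere d => inner ℝ x (σ : Vel d) ^ n * U σ) (surf d) :=
  integrable_sphere (by fun_prop)

/-- Expanding `(∑ x_i σ_i)^n` over all maps `Fin n → Fin d` separates `x` from `σ`; the coefficients
are moments of `U`. -/
theorem exists_pev_eq_zonal (n : ℕ) {U : Vel d → ℝ} (hU : Continuous U) :
    ∃ p : MvPolynomial (Fin d) ℝ, p.IsHomogeneous n ∧ pev p = zonal n U := by
  refine ⟨∑ f : Fin n → Fin d, C (∫ σ : USphere d, (∏ j, (σ : Vel d) (f j)) * U σ ∂(surf d))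
    * ∏ j, X (f j), ?_, ?_⟩
  · refine IsHomogeneous.sum _ _ _ fun f _ => ?_
    have h1 : (∏ j, X (f j) : MvPolynomial (Fin d) ℝ).IsHomogeneous (∑ _j : Fin n, 1) :=
      IsHomogeneous.prod _ _ _ fun j _ => isHomogeneous_X _ _
    simpa using (isHomogeneous_C (Fin d) _).mul h1
  · funext x
    simp only [pev, map_sum, map_mul, eval_C, map_prod, eval_X, zonal]
    simp_rw [← integral_mul_const]
    rw [← integral_finsetSum _ fun f _ => integrable_sphere (by fun_prop)]
    refine integral_congr_ae (Eventually.of_forall fun σ => ?_)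
    have : inner ℝ x (σ : Vel d) ^ n = ∑ f : Fin n → Fin d, ∏ j, (x (f j) * (σ : Vel d) (f j)) := by
      have h := Finset.prod_univ_sum (fun _ : Fin n => Finset.univ)
        (fun _ i => x i * (σ : Vel d) i)
      rw [Fintype.piFinset_univ] at h
      rw [← h, PiLp.inner_apply]
      simp [mul_comm]
    beta_reduce
    rw [this, Finset.sum_mul]
    refine Finset.sum_congr rfl fun f _ => ?_
    rw [Finset.prod_mul_distrib]; ring

theorem contDiff_zonal (n : ℕ) {U : Vel d → ℝ} (hU : Continuous U) {m : WithTop ℕ∞} :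
    ContDiff ℝ m (zonal n U) := by
  obtain ⟨p, -, hp⟩ := exists_pev_eq_zonal n hU
  rw [← hp]; exact contDiff_pev p

theorem integral_comp_sphereMap (R : Vel d ≃ₗᵢ[ℝ] Vel d) (f : USphere d → ℝ) :
    ∫ σ, f (sphereMap R σ) ∂(surf d) = ∫ σ, f σ ∂(surf d) :=
  (measurePreserving_sphereMap R).integral_comp
    (Homeomorph.measurableEmbedding (⟨⟨sphereMap R, sphereMap R.symm, fun _ => Subtype.ext (by simp),
      fun _ => Subtype.ext (by simp)⟩, continuous_sphereMap _, continuous_sphereMap _⟩ :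
        USphere d ≃ₜ USphere d)) f

theorem zonal_comp_isometry (n : ℕ) (U : Vel d → ℝ) (R : Vel d ≃ₗᵢ[ℝ] Vel d) (x : Vel d) :
    zonal n (fun y => U (R y)) x = zonal n U (R x) := by
  have h := integral_comp_sphereMap R fun σ : USphere d => inner ℝ (R x) (σ : Vel d) ^ n * U σ
  simpa [zonal] using h

/-- The kernel `(x·σ)^n` depends only on an inner product, so the averaging commutes with rotations,
hence with their generators. One family of polynomials thus approximates `U` and all its angular
derivatives at once, although `U` is only `C¹`. -/
theorem lieD_zonal (n : ℕ) (A : Vel d →L[ℝ] Vel d)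
    (hA : A ∈ skewAdjoint (Vel d →L[ℝ] Vel d)) {U : Vel d → ℝ} (hU : ContDiff ℝ 1 U) :
    lieD A (zonal n U) = zonal n (lieD A U) := by
  funext x
  obtain ⟨C, hC0, hC⟩ := exists_bound_on_sphere (continuous_lieD A hU)
  have h1 := hasDerivAt_comp_rot A hA (contDiff_zonal n hU.continuous (m := 1)) 0 x
  have h2 := (hasDerivAt_integral_of_dominated_loc_of_deriv_le (μ := surf d) (x₀ := (0 : ℝ))
    (F := fun t σ => inner ℝ x (σ : Vel d) ^ n * U (rot A hA t σ))
    (F' := fun t σ => inner ℝ x (σ : Vel d) ^ n * lieD A U (rot A hA t σ))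
    (bound := fun _ => ‖x‖ ^ n * C) univ_mem
    (Eventually.of_forall fun t => (integrable_zonal n (U := fun y => U (rot A hA t y))
      (hU.continuous.comp (rot A hA t).continuous) x).aestronglyMeasurable)
    (integrable_zonal n (U := fun y => U (rot A hA 0 y))
      (hU.continuous.comp (rot A hA 0).continuous) x)
    (integrable_zonal n (U := fun y => lieD A U (rot A hA 0 y))
      ((continuous_lieD A hU).comp (rot A hA 0).continuous) x).aestronglyMeasurable
    (Eventually.of_forall fun σ t _ => ?_) (integrable_const _)
    (Eventually.of_forall fun σ t _ =>
      (hasDerivAt_comp_rot A hA hU t (σ : Vel d)).const_mul _)).2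
  · have h3 : (fun t => ∫ σ : USphere d, inner ℝ x (σ : Vel d) ^ n * U (rot A hA t σ) ∂(surf d))
        = fun t => zonal n U (rot A hA t x) := by
      funext t
      exact zonal_comp_isometry n U (rot A hA t) x
    rw [h3] at h2
    have h4 := h1.unique h2
    simpa [rot_zero, zonal] using h4
  · rw [norm_mul, norm_pow]
    have hi : ‖inner ℝ x (σ : Vel d)‖ ≤ ‖x‖ := by
      simpa [norm_usphere] using norm_inner_le_norm (𝕜 := ℝ) x (σ : Vel d)
    exact mul_le_mul (pow_le_pow_left₀ (norm_nonneg _) hi _)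
      (hC (sphereMap (rot A hA t) σ)) (norm_nonneg _) (by positivity)

theorem exists_isometry_map (x y : Vel d) (h : ‖x‖ = ‖y‖) : ∃ R : Vel d ≃ₗᵢ[ℝ] Vel d, R x = y :=
  ⟨_, Submodule.reflection_sub h⟩

/-- By transitivity of the isometries on the sphere, one normalising constant serves all base
points. -/
theorem zonal_one_eq (n : ℕ) (k k' : USphere d) : zonal n (fun _ => 1) (k : Vel d)
    = zonal n (fun _ => 1) (k' : Vel d) := by
  obtain ⟨R, hR⟩ := exists_isometry_map (k : Vel d) (k' : Vel d) (by simp)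
  rw [← hR, ← zonal_comp_isometry]

/-- The weight `(k·σ)^{2n}` peaks at both `k` and `-k`; evenness folds the integral onto a
hemisphere with a single peak. The equator belongs to only one of the two halves, and `n ≠ 0` makes
the weight vanish there. -/
theorem zonal_even_eq (n : ℕ) (hn : n ≠ 0) {U : Vel d → ℝ} (hU : Continuous U)
    (he : ∀ σ : USphere d, U (-(σ : Vel d)) = U σ) (k : Vel d) :
    zonal (2 * n) U k = 2 * ∫ σ in {σ : USphere d | 0 ≤ inner ℝ k (σ : Vel d)},
      (inner ℝ k (σ : Vel d) ^ 2) ^ n * U σ ∂(surf d) := by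
  set s : Set (USphere d) := {σ | 0 ≤ inner ℝ k (σ : Vel d)} with hs
  have ms : MeasurableSet s := (isClosed_le continuous_const (by fun_prop)).measurableSet
  have hi := integrable_zonal (2 * n) hU k
  have h := integral_comp_sphereMap (LinearIsometryEquiv.neg ℝ (E := Vel d))
    (sᶜ.indicator fun σ : USphere d => inner ℝ k (σ : Vel d) ^ (2 * n) * U σ)
  rw [zonal, ← integral_add_compl ms hi, ← integral_indicator ms.compl, ← h,
    ← integral_indicator ms, ← integral_indicator ms,
    show ∀ y : ℝ, 2 * y = y + y from two_mul]
  congr 1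
  · simp_rw [pow_mul]
  · refine integral_congr_ae (Eventually.of_forall fun σ => ?_)
    simp only [Set.indicator, mem_compl_iff, hs, mem_ofPred_eq, coe_sphereMap, not_le,
      LinearIsometryEquiv.coe_neg, inner_neg_right, he]
    rcases lt_trichotomy (inner ℝ k (σ : Vel d)) 0 with h | h | h
    · simp [h.not_ge, h.le]
    · simp [h, hn]
    · simp [h, h.le, pow_mul]

theorem abs_zonal_le (n : ℕ) {U : Vel d → ℝ} {C : ℝ}
    (hC : ∀ σ : USphere d, |U σ| ≤ C) (k : Vel d) :
    |zonal (2 * n) U k| ≤ zonal (2 * n) (fun _ => 1) k * C := by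
  rw [zonal, zonal, ← integral_mul_const, ← Real.norm_eq_abs]
  refine norm_integral_le_of_norm_le
    ((integrable_zonal (2 * n) (U := fun _ => 1) continuous_const k).mul_const C)
    (Eventually.of_forall fun σ => ?_)
  have : 0 ≤ inner ℝ k (σ : Vel d) ^ (2 * n) := by rw [pow_mul]; positivity
  rw [norm_mul, Real.norm_of_nonneg this, mul_one]
  exact mul_le_mul_of_nonneg_left (hC σ) this

/-- On the closed hemisphere `(k·σ)²` has its unique maximum at `k`, so its normalised powers form
an approximate identity there. -/
theorem tendsto_zonal {U : Vel d → ℝ} (hU : Continuous U)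
    (he : ∀ σ : USphere d, U (-(σ : Vel d)) = U σ) (k : USphere d) :
    Tendsto (fun n => (zonal (2 * n) (fun _ => 1) (k : Vel d))⁻¹ * zonal (2 * n) U (k : Vel d))
      atTop (𝓝 (U k)) := by
  set s : Set (USphere d) := {σ | 0 ≤ inner ℝ (k : Vel d) (σ : Vel d)} with hs
  have cs : IsClosed s := isClosed_le continuous_const (by fun_prop)
  have key := tendsto_setIntegral_pow_smul_of_unique_maximum_of_isCompact_of_continuousOn
    (μ := surf d) (s := s) (x₀ := k) (g := fun σ : USphere d => U σ)
    (c := fun σ : USphere d => inner ℝ (k : Vel d) (σ : Vel d) ^ 2)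
    cs.isCompact (by fun_prop) ?_ (fun _ _ => sq_nonneg _) (by simp) ?_
    (by fun_prop)
  · refine key.congr' ?_
    filter_upwards [eventually_ne_atTop 0] with n hn
    rw [zonal_even_eq n hn hU he, zonal_even_eq n hn continuous_const (fun _ => rfl), mul_inv,
      smul_eq_mul]
    simp only [mul_one, smul_eq_mul]
    rw [mul_mul_mul_comm, inv_mul_cancel₀ two_ne_zero, one_mul]
  · intro σ hσ hne
    have h1 : inner ℝ (k : Vel d) (σ : Vel d) < 1 := by
      have h2 := real_inner_le_norm (k : Vel d) (σ : Vel d)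
      rw [norm_usphere, norm_usphere, one_mul] at h2
      refine lt_of_le_of_ne h2 fun h => hne (Subtype.ext ?_)
      exact ((inner_eq_one_iff_of_norm_eq_one (𝕜 := ℝ) (norm_usphere k) (norm_usphere σ)).1 h).symm
    have h0 : 0 ≤ inner ℝ (k : Vel d) (σ : Vel d) := hσ
    simp only [real_inner_self_eq_norm_sq, norm_usphere]
    nlinarith
  · refine subset_closure (mem_interior.2 ⟨{σ | 0 < inner ℝ (k : Vel d) (σ : Vel d)},
      fun σ (hσ : 0 < inner ℝ (k : Vel d) (σ : Vel d)) => hσ.le, 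
      isOpen_lt continuous_const (by fun_prop), ?_⟩)
    simp

/-! ### The kernel form: from polynomials to even `C¹` functions -/

/-- The bilinear form `∬ β(k·σ) (f(σ) - f(k)) (g(σ) - g(k))` on polynomials. -/
def kernelForm (β : ℝ → ℝ) (hβ : Integrable (fun p => β (cosA (d := d) p)) (surf2 d)) :
    MvPolynomial (Fin d) ℝ →ₗ[ℝ] MvPolynomial (Fin d) ℝ →ₗ[ℝ] ℝ :=
  have hadd : ∀ f g : MvPolynomial (Fin d) ℝ, ∀ p, incr (pev (f + g)) p
      = incr (pev f) p + incr (pev g) p := fun f g p => by simp [incr, pev]; ring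
  have hsmul : ∀ (c : ℝ) (f : MvPolynomial (Fin d) ℝ), ∀ p, incr (pev (c • f)) p
      = c * incr (pev f) p := fun c f p => by simp [incr, pev]; ring
  have hint : ∀ f g : MvPolynomial (Fin d) ℝ,
      Integrable (fun p => β (cosA p) * (incr (pev f) p * incr (pev g) p)) (surf2 d) := fun f g =>
    integrable_kernel_mul hβ ((continuous_incr (contDiff_pev f (n := 0)).continuous).mul
      (continuous_incr (contDiff_pev g (n := 0)).continuous))
  LinearMap.mk₂ ℝ (fun f g => ∫ p, β (cosA p) * (incr (pev f) p * incr (pev g) p) ∂(surf2 d))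
    (fun f g h => by
      rw [← integral_add (hint _ _) (hint _ _)]
      exact integral_congr_ae (Eventually.of_forall fun p => by simp only [hadd]; ring))
    (fun c f g => by
      rw [smul_eq_mul, ← integral_const_mul]
      exact integral_congr_ae (Eventually.of_forall fun p => by simp only [hsmul]; ring))
    (fun f g h => by
      rw [← integral_add (hint _ _) (hint _ _)]
      exact integral_congr_ae (Eventually.of_forall fun p => by simp only [hadd]; ring))
    (fun c f g => by
      rw [smul_eq_mul, ← integral_const_mul]
      exact integral_congr_ae (Eventually.of_forall fun p => by simp only [hsmul]; ring))

theorem kernelForm_apply (β : ℝ → ℝ) (hβ : Integrable (fun p => β (cosA (d := d) p)) (surf2 d))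
    (f g : MvPolynomial (Fin d) ℝ) : kernelForm β hβ f g
      = ∫ p, β (cosA p) * (incr (pev f) p * incr (pev g) p) ∂(surf2 d) := rfl

theorem kernelForm_pL (β : ℝ → ℝ) (hβ : Integrable (fun p => β (cosA (d := d) p)) (surf2 d))
    (a b : Fin d) (f g : MvPolynomial (Fin d) ℝ) :
    kernelForm β hβ (pL a b f) g = - kernelForm β hβ f (pL a b g) := by
  rw [kernelForm_apply, kernelForm_apply, ← ang_pev, ← ang_pev]
  exact integral_kernel_lieD hβ _ (angGen_mem a b) (contDiff_pev f) (contDiff_pev g)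

theorem kernelForm_pA (β : ℝ → ℝ) (hβ : Integrable (fun p => β (cosA (d := d) p)) (surf2 d))
    (f g : MvPolynomial (Fin d) ℝ) :
    kernelForm β hβ (pA f) g = 1 / 2 * ∑ a, ∑ b, kernelForm β hβ (pL a b f) (pL a b g) := by
  rw [pA_apply]
  simp only [map_smul, map_sum, LinearMap.smul_apply, LinearMap.sum_apply, smul_eq_mul,
    kernelForm_pL _ _ _ _ (pL _ _ _), Finset.sum_neg_distrib]
  ring

theorem kernelForm_pA' (β : ℝ → ℝ) (hβ : Integrable (fun p => β (cosA (d := d) p)) (surf2 d))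
    (f g : MvPolynomial (Fin d) ℝ) :
    kernelForm β hβ f (pA g) = 1 / 2 * ∑ a, ∑ b, kernelForm β hβ (pL a b f) (pL a b g) := by
  rw [pA_apply]
  simp only [map_smul, map_sum, smul_eq_mul,
    kernelForm_pL, Finset.sum_neg_distrib]
  ring

theorem pev_pN (σ : USphere d) : pev (pN : MvPolynomial (Fin d) ℝ) (σ : Vel d) = 1 := by
  have := EuclideanSpace.norm_sq_eq (σ : Vel d)
  rw [norm_usphere] at this
  simp only [Real.norm_eq_abs, sq_abs, one_pow] at this
  simp [pev, pN, ← this]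

theorem kernelForm_const (β : ℝ → ℝ) (hβ : Integrable (fun p => β (cosA (d := d) p)) (surf2 d))
    (a : ℝ) (m : ℕ) (g : MvPolynomial (Fin d) ℝ) : kernelForm β hβ (C a * pN ^ m) g = 0 := by
  have : ∀ p : USphere d × USphere d, incr (pev (C a * pN ^ m)) p = 0 := by
    intro p
    have h := pev_pN p.1
    have h' := pev_pN p.2
    simp only [pev] at h h'
    simp [incr, pev, h, h']
  simp [kernelForm_apply, this]

theorem kernel_poincare_pev (hd : 2 ≤ d) {β : ℝ → ℝ} (hβ0 : ∀ x, 0 ≤ β x)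
    (hβ : Integrable (fun p => β (cosA (d := d) p)) (surf2 d))
    {m : ℕ} {f : MvPolynomial (Fin d) ℝ} (hf : f.IsHomogeneous (2 * m)) :
    2 * d * ∫ p, β (cosA p) * incr (pev f) p ^ 2 ∂(surf2 d)
      ≤ 1 / 2 * ∑ a, ∑ b, ∫ p, β (cosA p) * incr (ang a b (pev f)) p ^ 2 ∂(surf2 d) := by
  have h := quadForm_pA_ge hd (kernelForm β hβ)
    (fun f => integral_nonneg fun p => mul_nonneg (hβ0 _) (mul_self_nonneg _))
    (fun f g => by rw [kernelForm_pA, kernelForm_pA']) (kernelForm_const β hβ) hf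
  rw [kernelForm_pA] at h
  simpa only [kernelForm_apply, ang_pev, sq] using h

/-- Dominated convergence, with pointwise convergence at both endpoints. The normalisation is taken
at one fixed point `e` so that it leaves the integral as a scalar factor. -/
theorem tendsto_kernel_zonal {β : ℝ → ℝ} (hβ : Integrable (fun p => β (cosA (d := d) p)) (surf2 d))
    {U : Vel d → ℝ} (hU : Continuous U) (he : ∀ σ : USphere d, U (-(σ : Vel d)) = U σ)
    (e : USphere d) :
    Tendsto (fun n => (zonal (2 * n) (fun _ => 1) (e : Vel d))⁻¹ ^ 2 *
      ∫ p, β (cosA p) * incr (zonal (2 * n) U) p ^ 2 ∂(surf2 d)) atTop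
      (𝓝 (∫ p, β (cosA p) * incr U p ^ 2 ∂(surf2 d))) := by
  obtain ⟨C, hC0, hC⟩ := exists_bound_on_sphere hU
  -- A normalised average against a nonnegative weight does not exceed the supremum. A zero
  -- normaliser would be harmless, since its inverse is then zero.
  have hb : ∀ n, ∀ σ : USphere d,
      |(zonal (2 * n) (fun _ => 1) (e : Vel d))⁻¹ * zonal (2 * n) U (σ : Vel d)| ≤ C := by
    intro n σ
    have h1 := abs_zonal_le n hC (σ : Vel d)
    rw [zonal_one_eq (2 * n) σ e] at h1
    have h0 : 0 ≤ zonal (2 * n) (fun _ => 1) (e : Vel d) :=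
      integral_nonneg fun σ => by rw [pow_mul]; positivity
    rw [abs_mul, abs_of_nonneg (inv_nonneg.2 h0), inv_mul_eq_div]
    exact div_le_of_le_mul₀ h0 hC0 (h1.trans_eq (mul_comm _ _))
  simp_rw [← integral_const_mul]
  refine tendsto_integral_of_dominated_convergence (fun p => |β (cosA p)| * (2 * C) ^ 2)
    (fun n => ((integrable_kernel_mul hβ ((continuous_incr
      (contDiff_zonal (2 * n) hU (m := 0)).continuous).pow 2)).const_mul _).aestronglyMeasurable)
    (hβ.abs.mul_const _) (fun n => Eventually.of_forall fun p => ?_)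
    (Eventually.of_forall fun p => ?_)
  · have h := abs_incr_le (f := fun x => (zonal (2 * n) (fun _ => 1) (e : Vel d))⁻¹ *
      zonal (2 * n) U x) (hb n) p
    have e1 : (zonal (2 * n) (fun _ => 1) (e : Vel d))⁻¹ ^ 2 *
        (β (cosA p) * incr (zonal (2 * n) U) p ^ 2) = β (cosA p) *
        (incr (fun x => (zonal (2 * n) (fun _ => 1) (e : Vel d))⁻¹ * zonal (2 * n) U x) p) ^ 2 := by
      simp only [incr]; ring
    rw [e1, norm_mul, norm_pow, Real.norm_eq_abs, Real.norm_eq_abs]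
    gcongr
  · have h1 := (tendsto_zonal hU he p.1)
    have h2 := (tendsto_zonal hU he p.2)
    simp_rw [zonal_one_eq _ p.1 e] at h1
    simp_rw [zonal_one_eq _ p.2 e] at h2
    refine (((h2.sub h1).pow 2).const_mul (β (cosA p))).congr fun n => ?_
    simp only [incr]; ring

/-- The rotation flow stays on the sphere, so an angular derivative sees only the restriction of the
function. -/
theorem lieD_congr_sphere (A : Vel d →L[ℝ] Vel d) (hA : A ∈ skewAdjoint (Vel d →L[ℝ] Vel d))
    {f g : Vel d → ℝ} (hf : ContDiff ℝ 1 f) (hg : ContDiff ℝ 1 g)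
    (h : ∀ σ : USphere d, f σ = g σ) (σ : USphere d) : lieD A f σ = lieD A g σ := by
  have h1 := hasDerivAt_comp_rot A hA hf 0 (σ : Vel d)
  have h2 := hasDerivAt_comp_rot A hA hg 0 (σ : Vel d)
  have h3 : (fun t => f (rot A hA t (σ : Vel d))) = fun t => g (rot A hA t (σ : Vel d)) :=
    funext fun t => h (sphereMap (rot A hA t) σ)
  rw [h3] at h1
  simpa [rot_zero] using h1.unique h2

/-- A linear vector field commutes with `x ↦ -x`. Evenness holds only on the sphere, so the
derivatives of `U(-x)` and `U(x)` are compared there. -/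
theorem lieD_even (A : Vel d →L[ℝ] Vel d) (hA : A ∈ skewAdjoint (Vel d →L[ℝ] Vel d))
    {U : Vel d → ℝ} (hU : ContDiff ℝ 1 U)
    (he : ∀ σ : USphere d, U (-(σ : Vel d)) = U σ) (σ : USphere d) :
    lieD A U (-(σ : Vel d)) = lieD A U σ := by
  rw [← lieD_congr_sphere A hA (hU.comp contDiff_neg) hU he σ]
  have h := ((hU.differentiable one_ne_zero (-(σ : Vel d))).hasFDerivAt.comp (σ : Vel d)
    (hasFDerivAt_id (σ : Vel d)).neg).fderiv
  rw [lieD, lieD]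
  refine Eq.trans ?_ (congrArg (fun L : Vel d →L[ℝ] ℝ => L (A σ)) h).symm
  simp

/-- The comparison `2d ∬ β |ΔU|² ≤ ∬ β |Δ∇U|²` for even functions. -/
theorem kernel_poincare (hd : 2 ≤ d) {β : ℝ → ℝ} (hβ0 : ∀ x, 0 ≤ β x)
    (hβ : Integrable (fun p => β (cosA (d := d) p)) (surf2 d))
    {U : Vel d → ℝ} (hU : ContDiff ℝ 1 U) (he : ∀ σ : USphere d, U (-(σ : Vel d)) = U σ) :
    2 * d * ∫ p, β (cosA p) * incr U p ^ 2 ∂(surf2 d)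
      ≤ 1 / 2 * ∑ a, ∑ b, ∫ p, β (cosA p) * incr (ang a b U) p ^ 2 ∂(surf2 d) := by
  let e : USphere d := ⟨eb ⟨0, by omega⟩, by simp [eb]⟩
  -- Both sides are limits of the same expressions for the homogeneous polynomials `zonal (2 * n)
  -- U`, scaled by a common square factor, so the polynomial inequality passes to the limit.
  refine le_of_tendsto_of_tendsto'
    ((tendsto_kernel_zonal hβ hU.continuous he e).const_mul (2 * (d : ℝ)))
    ((tendsto_finsetSum _ fun a _ => tendsto_finsetSum _ fun b _ =>
      tendsto_kernel_zonal hβ (continuous_lieD (angGen a b) hU)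
        (lieD_even _ (angGen_mem a b) hU he) e).const_mul (1 / 2)) fun n => ?_
  obtain ⟨p, hp, hpz⟩ := exists_pev_eq_zonal (2 * n) hU.continuous
  have h := kernel_poincare_pev hd hβ0 hβ hp
  rw [hpz] at h
  simp only [ang, lieD_zonal _ _ (angGen_mem _ _) hU] at h
  have h2 := mul_le_mul_of_nonneg_left h (sq_nonneg (zonal (2 * n) (fun _ => 1) (e : Vel d))⁻¹)
  simp_rw [← Finset.mul_sum]
  calc _ = _ := by ring
    _ ≤ _ := h2
    _ = _ := by ring

end Core


/-! ### The constants `λ₁(ℝP^{d-1})` and `P_*` -/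

noncomputable section Constants

variable {d : ℕ}

/-- The Lagrange identity for the inner product of the bivectors `x ∧ y` and `z ∧ w`. It applies
because the angular derivatives of `f` at `x` are the coordinates of `x ∧ ∇f`. -/
theorem sum_wedge_mul_wedge (x y z w : Vel d) :
    1 / 2 * ∑ a, ∑ b, (x a * y b - x b * y a) * (z a * w b - z b * w a)
      = inner ℝ x z * inner ℝ y w - inner ℝ x w * inner ℝ y z := by
  have h : ∀ x y z w : Vel d, ∑ a, ∑ b, x a * y b * (z a * w b) = inner ℝ x z * inner ℝ y w := by
    intro x y z w
    simp only [PiLp.inner_apply, RCLike.inner_apply, conj_trivial, Finset.sum_mul_sum]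
    exact Finset.sum_congr rfl fun _ _ => Finset.sum_congr rfl fun _ _ => by ring
  have e : ∀ a b : Fin d, (x a * y b - x b * y a) * (z a * w b - z b * w a)
      = x a * y b * (z a * w b) - x a * y b * (w a * z b) - y a * x b * (z a * w b)
        + y a * x b * (w a * z b) := fun a b => by ring
  simp only [e, Finset.sum_add_distrib, Finset.sum_sub_distrib, h]
  ring

theorem gradient_apply (f : Vel d → ℝ) (x : Vel d) (i : Fin d) : gradient f x i = pd i f x := by
  rw [← inner_eb, pd, gradient, real_inner_comm, InnerProductSpace.toDual_symm_apply]

theorem norm_gradient_sq (f : Vel d → ℝ) (x : Vel d) :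
    ‖gradient f x‖ ^ 2 = ∑ i, pd i f x ^ 2 := by
  simp [EuclideanSpace.norm_sq_eq, gradient_apply]

theorem ang_eq_sphereGrad (a b : Fin d) (f : Vel d → ℝ) (x : Vel d) :
    ang a b f x = x a * sphereGrad f x b - x b * sphereGrad f x a := by
  rw [ang_eq, ← gradient_apply, ← gradient_apply, sphereGrad]
  simp
  ring

theorem inner_sphereGrad (f : Vel d → ℝ) (σ : USphere d) :
    inner ℝ (σ : Vel d) (sphereGrad f σ) = 0 := by
  rw [sphereGrad, inner_sub_right, inner_smul_right, real_inner_self_eq_norm_sq, norm_usphere]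
  ring

theorem norm_sphereGrad_sq (f : Vel d → ℝ) (σ : USphere d) :
    ‖sphereGrad f σ‖ ^ 2 = 1 / 2 * ∑ a, ∑ b, ang a b f σ ^ 2 := by
  simp only [ang_eq_sphereGrad, sq (_ - _), sum_wedge_mul_wedge, inner_sphereGrad,
    real_inner_self_eq_norm_sq, norm_usphere]
  ring

/-- For `x ⟂ k` and `y ⟂ σ`, `(P_{kσ} x)·y` is the inner product of `k ∧ x` with `σ ∧ y`, and these
bivectors have lengths `|x|` and `|y|`. The twisted length is therefore that of `σ ∧ y - k ∧ x`; in
particular it is nonnegative. -/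
theorem collSq_eq (f : Vel d → ℝ) (p : USphere d × USphere d) :
    collSq (p.1 : Vel d) (p.2 : Vel d) (sphereGrad f p.1) (sphereGrad f p.2)
      = 1 / 2 * ∑ a, ∑ b, incr (ang a b f) p ^ 2 := by
  have e : ∀ a b : Fin d, incr (ang a b f) p ^ 2 = ang a b f p.2 ^ 2 + ang a b f p.1 ^ 2
      - 2 * (((p.1 : Vel d) a * sphereGrad f p.1 b - (p.1 : Vel d) b * sphereGrad f p.1 a) *
        ((p.2 : Vel d) a * sphereGrad f p.2 b - (p.2 : Vel d) b * sphereGrad f p.2 a)) := by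
    intro a b
    rw [← ang_eq_sphereGrad, ← ang_eq_sphereGrad, incr]; ring
  have h := sum_wedge_mul_wedge (p.1 : Vel d) (sphereGrad f p.1) (p.2 : Vel d) (sphereGrad f p.2)
  have h1 := inner_sphereGrad f p.1
  have h2 := inner_sphereGrad f p.2
  simp only [e, Finset.sum_add_distrib, Finset.sum_sub_distrib, ← Finset.mul_sum]
  rw [show ∀ A B C : ℝ, 1 / 2 * (A + B - 2 * C) = 1 / 2 * A + 1 / 2 * B - 2 * (1 / 2 * C) by
    intros; ring, h, ← norm_sphereGrad_sq, ← norm_sphereGrad_sq, collSq, collP, inner_sub_left, inner_add_left,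
    inner_smul_left, inner_smul_left, inner_smul_left]
  rw [real_inner_comm] at h1
  simp only [h1, h2, conj_trivial]
  rw [real_inner_comm (p.2 : Vel d) (sphereGrad f p.1)]
  ring

/-- The cross term is the product of two vanishing means. This turns the kernel estimate with `β =
1` into a statement about a single point of the sphere. -/
theorem integral_incr_sq {g : Vel d → ℝ} (hg : Continuous g)
    (h0 : ∫ σ : USphere d, g σ ∂(surf d) = 0) :
    ∫ p, incr g p ^ 2 ∂(surf2 d)
      = 2 * (surf d).real univ * ∫ σ : USphere d, g σ ^ 2 ∂(surf d) := by
  have i2 : Integrable (fun σ : USphere d => g σ ^ 2) (surf d) := integrable_sphere (by fun_prop)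
  have i1 : Integrable (fun σ : USphere d => g σ) (surf d) := integrable_sphere (by fun_prop)
  have e : ∀ p : USphere d × USphere d, incr g p ^ 2
      = (g p.2 ^ 2 + g p.1 ^ 2) - 2 * (g p.1 * g p.2) := fun p => by rw [incr]; ring
  have i3 : Integrable (fun p : USphere d × USphere d => g p.2 ^ 2 + g p.1 ^ 2) (surf2 d) :=
    (i2.comp_snd _).add (i2.comp_fst _)
  simp only [e]
  rw [integral_sub i3 ((i1.mul_prod i1).const_mul 2),
    integral_add (i2.comp_snd _) (i2.comp_fst _), integral_const_mul,
    integral_prod_mul (fun σ : USphere d => g σ) (fun σ : USphere d => g σ), h0,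
    integral_fun_snd (fun σ : USphere d => g σ ^ 2), integral_fun_fst (fun σ : USphere d => g σ ^ 2)]
  simp only [smul_eq_mul]
  ring

theorem integral_norm_sphereGrad_sq {g : Vel d → ℝ} (hg : ContDiff ℝ 1 g) :
    ∫ p, ∑ a, ∑ b, incr (ang a b g) p ^ 2 ∂(surf2 d)
      = 4 * (surf d).real univ * ∫ σ : USphere d, ‖sphereGrad g σ‖ ^ 2 ∂(surf d) := by
  have hc : ∀ a b : Fin d, Continuous (ang a b g) := fun a b => continuous_lieD _ hg
  have hi : ∀ a b : Fin d, Integrable (fun p => incr (ang a b g) p ^ 2) (surf2 d) := fun a b => by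
    simpa using integrable_kernel_mul (β := fun _ => 1) (integrable_const _)
      ((continuous_incr (hc a b)).pow 2)
  have hs : ∀ a b : Fin d, Integrable (fun σ : USphere d => ang a b g σ ^ 2) (surf d) :=
    fun a b => integrable_sphere (((hc a b).comp continuous_subtype_val).pow 2)
  simp only [norm_sphereGrad_sq]
  rw [integral_finsetSum _ fun a _ => integrable_finsetSum _ fun b _ => hi a b,
    integral_const_mul, integral_finsetSum _ fun a _ => integrable_finsetSum _ fun b _ => hs a b]
  simp_rw [integral_finsetSum _ fun b _ => hi _ b, integral_finsetSum _ fun b _ => hs _ b]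
  simp_rw [integral_incr_sq (hc _ _) (integral_lieD_eq_zero _ (angGen_mem _ _) hg),
    ← Finset.mul_sum]
  ring

theorem continuous_norm_sphereGrad_sq {g : Vel d → ℝ} (hg : ContDiff ℝ 1 g) :
    Continuous fun σ : USphere d => ‖sphereGrad g σ‖ ^ 2 := by
  simp only [norm_sphereGrad_sq]
  exact continuous_const.mul (continuous_finsetSum _ fun a _ => continuous_finsetSum _ fun b _ =>
    ((continuous_lieD _ hg).comp continuous_subtype_val).pow 2)

theorem surf_real_univ_pos (hd : 2 ≤ d) : 0 < (surf d).real univ := by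
  have : Nonempty (USphere d) := ⟨⟨eb ⟨0, by omega⟩, by simp [eb]⟩⟩
  exact ENNReal.toReal_pos (isOpen_univ.measure_ne_zero _ univ_nonempty) (measure_ne_top _ _)

/-- The Poincaré inequality on the projective space. -/
theorem sphere_poincare (hd : 2 ≤ d) {g : Vel d → ℝ} (hg : ContDiff ℝ 1 g)
    (he : ∀ σ : USphere d, g (-(σ : Vel d)) = g σ)
    (h0 : ∫ σ : USphere d, g σ ∂(surf d) = 0) :
    2 * d * ∫ σ : USphere d, g σ ^ 2 ∂(surf d) ≤ ∫ σ : USphere d, ‖sphereGrad g σ‖ ^ 2 ∂(surf d) := by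
  -- The Poincaré inequality is the kernel inequality for the constant kernel; angular derivatives
  -- have zero mean, so `integral_incr_sq` applies to both sides.
  have h := kernel_poincare hd (β := fun _ => 1) (fun _ => zero_le_one) (integrable_const _) hg he
  have hi : ∀ a b : Fin d, Integrable (fun p => incr (ang a b g) p ^ 2) (surf2 d) := fun a b => by
    simpa using integrable_kernel_mul (β := fun _ => 1) (integrable_const _)
      ((continuous_incr (continuous_lieD (angGen a b) hg)).pow 2)
  simp only [one_mul] at h
  simp_rw [← integral_finsetSum _ fun b _ => hi _ b] at h
  rw [← integral_finsetSum _ fun a _ => integrable_finsetSum _ fun b _ => hi a b,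
    integral_incr_sq hg.continuous h0, integral_norm_sphereGrad_sq hg] at h
  have := surf_real_univ_pos hd
  refine le_of_mul_le_mul_left (a := 2 * (surf d).real univ) ?_ (by positivity)
  linarith

open MvPolynomial in
-- The function `σ_i σ_j` with `i ≠ j` is the restriction of a harmonic quadratic form, hence an
-- eigenfunction for exactly `2d`.
theorem exists_extremal (hd : 2 ≤ d) : ∃ g : Vel d → ℝ, IsEvenZeroMean d g ∧
    ∫ σ : USphere d, ‖sphereGrad g σ‖ ^ 2 ∂(surf d) = 2 * d * ∫ σ : USphere d, g σ ^ 2 ∂(surf d) ∧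
    0 < ∫ σ : USphere d, g σ ^ 2 ∂(surf d) := by
  set i : Fin d := ⟨0, by omega⟩
  set j : Fin d := ⟨1, by omega⟩
  have hij : i ≠ j := by simp [i, j]
  set p : MvPolynomial (Fin d) ℝ := X i * X j with hp
  have hev : ∀ x : Vel d, pev p x = x i * x j := fun x => by simp [pev, hp]
  have hA : pA p = (2 * d : ℝ) • p := by
    rw [pA_of_isHomogeneous (m := 2) ((isHomogeneous_X _ i).mul (isHomogeneous_X _ j))]
    have : pLap p = 0 := by
      refine Finset.sum_eq_zero fun k _ => ?_
      simp only [hp, pderiv_mul, pderiv_X, Pi.single_apply]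
      by_cases h1 : k = i
      · subst h1; simp [hij.symm]
      · by_cases h2 : k = j
        · subst h2; simp [hij]
        · simp [Ne.symm h1, Ne.symm h2]
    rw [this, hp]; norm_num
  have hsm : ContDiff ℝ 1 (pev p) := contDiff_pev p
  have h0 : ∫ σ : USphere d, pev p σ ∂(surf d) = 0 := by
    -- An eigenfunction with nonzero eigenvalue is a sum of angular derivatives, each of which
    -- integrates to zero; this gives the zero mean.
    have h1 : ∀ x, (2 * d : ℝ) * pev p x = -(1 / 2) * ∑ a, ∑ b, ang a b (pev (pL a b p)) x := by
      intro x
      have := congrArg (fun q => pev q x) hA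
      simp only [pA_apply] at this
      simp only [ang_pev]
      simpa [pev] using this.symm
    have h2 : ∫ σ : USphere d, (2 * d : ℝ) * pev p σ ∂(surf d) = 0 := by
      simp_rw [h1, integral_const_mul]
      have hc : ∀ a b : Fin d, Integrable (fun σ : USphere d => ang a b (pev (pL a b p)) σ) (surf d) :=
        fun a b => integrable_sphere
          ((continuous_lieD _ (contDiff_pev _)).comp continuous_subtype_val)
      rw [integral_finsetSum _ fun a _ => integrable_finsetSum _ fun b _ => hc a b]
      simp_rw [integral_finsetSum _ fun b _ => hc _ b,
        integral_lieD_eq_zero _ (angGen_mem _ _) (contDiff_pev _)]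
      simp
    rw [integral_const_mul] at h2
    exact (mul_eq_zero.1 h2).resolve_left (by positivity)
  refine ⟨pev p, ⟨contDiff_pev p, fun σ => by simp [hev], h0⟩, ?_, ?_⟩
  · have hβ : Integrable (fun q => (fun _ : ℝ => (1 : ℝ)) (cosA (d := d) q)) (surf2 d) :=
      integrable_const _
    have h := kernelForm_pA (fun _ => 1) hβ p p
    rw [hA, map_smul, LinearMap.smul_apply, smul_eq_mul] at h
    simp only [kernelForm_apply, one_mul, ← ang_pev, ← sq] at h
    have hi : ∀ a b : Fin d, Integrable (fun q => incr (ang a b (pev p)) q ^ 2) (surf2 d) :=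
      fun a b => by
        simpa using integrable_kernel_mul (β := fun _ => 1) hβ
            ((continuous_incr (continuous_lieD (angGen a b) hsm)).pow 2)
    simp_rw [← integral_finsetSum _ fun b _ => hi _ b] at h
    rw [← integral_finsetSum _ fun a _ => integrable_finsetSum _ fun b _ => hi a b,
      integral_incr_sq hsm.continuous h0, integral_norm_sphereGrad_sq hsm] at h
    have := surf_real_univ_pos hd
    refine mul_left_cancel₀ (a := 2 * (surf d).real univ) (by positivity) ?_
    linarith
  · have hc : Continuous fun σ : USphere d => pev p σ ^ 2 :=
      (hsm.continuous.comp continuous_subtype_val).pow 2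
    have hn : ‖eb i + eb j‖ ≠ 0 := by
      rw [norm_ne_zero_iff]
      intro h
      have := congrArg (fun x : Vel d => x i) h
      simp [eb, hij] at this
    -- The normalised diagonal vector `e_i + e_j` is a point of the sphere where `σ_i σ_j` does not
    -- vanish.
    refine hc.integral_pos_of_hasCompactSupport_nonneg_nonzero (HasCompactSupport.of_compactSpace _)
      (fun σ => sq_nonneg _)
      (x := ⟨‖eb i + eb j‖⁻¹ • (eb i + eb j), by
        rw [mem_sphere_zero_iff_norm, norm_smul, norm_inv, norm_norm, inv_mul_cancel₀ hn]⟩) ?_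
    simp [hev, eb, hij, hij.symm]
    simpa [eb] using hn

theorem lambdaOneRP_eq (hd : 2 ≤ d) : lambdaOneRP d = 2 * (d : ℝ≥0∞) := by
  have hcast : (2 * (d : ℝ≥0∞)) = ENNReal.ofReal (2 * d) := by
    rw [ENNReal.ofReal_mul zero_le_two]; simp
  have hl : ∀ f : USphere d → ℝ, Continuous f → (∀ σ, 0 ≤ f σ) →
      ∫⁻ σ, ENNReal.ofReal (f σ) ∂(surf d) = ENNReal.ofReal (∫ σ, f σ ∂(surf d)) := fun f hf h0 =>
    (ofReal_integral_eq_lintegral_ofReal (integrable_sphere hf) (Eventually.of_forall h0)).symm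
  have hl1 : ∀ g : Vel d → ℝ, ContDiff ℝ 1 g → ∫⁻ σ : USphere d, ENNReal.ofReal (g σ ^ 2) ∂(surf d)
      = ENNReal.ofReal (∫ σ : USphere d, g σ ^ 2 ∂(surf d)) := fun g hg =>
    hl _ ((hg.continuous.comp continuous_subtype_val).pow 2) fun σ => sq_nonneg _
  have hl2 : ∀ g : Vel d → ℝ, ContDiff ℝ 1 g → ∫⁻ σ : USphere d, ENNReal.ofReal (‖sphereGrad g σ‖ ^ 2) ∂(surf d)
      = ENNReal.ofReal (∫ σ : USphere d, ‖sphereGrad g σ‖ ^ 2 ∂(surf d)) := fun g hg =>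
    hl _ (continuous_norm_sphereGrad_sq hg) fun σ => sq_nonneg _
  refine le_antisymm (sSup_le fun L hL => ?_) (le_sSup fun g hg => ?_)
  · obtain ⟨g, hg, heq, hpos⟩ := exists_extremal hd
    have hg1 : ContDiff ℝ 1 g := hg.smooth.of_le (by exact_mod_cast le_top)
    have h := hL g hg
    rw [hl1 g hg1, hl2 g hg1, heq, ENNReal.ofReal_mul (by positivity), ← hcast] at h
    exact (ENNReal.mul_le_mul_iff_left (ENNReal.ofReal_pos.2 hpos).ne' ENNReal.ofReal_ne_top).1 h
  · have hg1 : ContDiff ℝ 1 g := hg.smooth.of_le (by exact_mod_cast le_top)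
    rw [hl1 g hg1, hl2 g hg1, hcast, ← ENNReal.ofReal_mul (by positivity)]
    exact ENNReal.ofReal_le_ofReal (sphere_poincare hd hg1 hg.even hg.zero_mean)

/-- Sections of singular kernels need not be integrable, and either integral may be infinite.
Bounded truncations are integrable; the left side is their supremum by monotone convergence, and
each truncated right side is at most the full one. -/
theorem le_pStar (hd : 2 ≤ d) {β : ℝ → ℝ} (hβ : Measurable β) : 2 * (d : ℝ≥0∞) ≤ pStar d β := by
  refine le_sSup fun g hg => ?_
  have hg1 : ContDiff ℝ 1 g := hg.smooth.of_le (by exact_mod_cast le_top)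
  have mβ : Measurable fun p => β (cosA (d := d) p) := hβ.comp continuous_cosA.measurable
  have ci := continuous_incr hg1.continuous
  have ca : ∀ a b : Fin d, Continuous (incr (ang a b g)) := fun a b =>
    continuous_incr (continuous_lieD (angGen a b) hg1)
  have cs : Continuous fun p : USphere d × USphere d => 1 / 2 * ∑ a, ∑ b, incr (ang a b g) p ^ 2 :=
    continuous_const.mul (continuous_finsetSum _ fun a _ => continuous_finsetSum _ fun b _ =>
      (ca a b).pow 2)
  have e1 : intGammaBeta d β g
      = 2⁻¹ * ∫⁻ p, ENNReal.ofReal (incr g p ^ 2 * β (cosA p)) ∂(surf2 d) := by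
    have hm : Measurable fun p => ENNReal.ofReal (incr g p ^ 2 * β (cosA p)) :=
      ((ci.measurable.pow_const 2).mul mβ).ennreal_ofReal
    rw [intGammaBeta, lintegral_prod _ hm.aemeasurable]; rfl
  have e2 : intGammaOneBeta d β g = 2⁻¹ * ∫⁻ p, ENNReal.ofReal
      ((1 / 2 * ∑ a, ∑ b, incr (ang a b g) p ^ 2) * β (cosA p)) ∂(surf2 d) := by
    have hm : Measurable fun p : USphere d × USphere d => ENNReal.ofReal
        ((1 / 2 * ∑ a, ∑ b, incr (ang a b g) p ^ 2) * β (cosA p)) :=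
      (cs.measurable.mul mβ).ennreal_ofReal
    rw [intGammaOneBeta, lintegral_prod _ hm.aemeasurable]
    simp_rw [← collSq_eq]; rfl
  -- Negative values of `β` are invisible to `ENNReal.ofReal`, so `β` may be replaced by its
  -- positive part.
  have hmax : ∀ a x : ℝ, 0 ≤ a → ENNReal.ofReal (a * x) = ENNReal.ofReal (a * max x 0) := by
    intro a x ha
    rcases le_total x 0 with h | h
    · rw [max_eq_right h, mul_zero, ENNReal.ofReal_zero, ENNReal.ofReal_eq_zero]
      exact mul_nonpos_of_nonneg_of_nonpos ha h
    · rw [max_eq_left h]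
  have hnn : ∀ p : USphere d × USphere d, 0 ≤ 1 / 2 * ∑ a, ∑ b, incr (ang a b g) p ^ 2 :=
    fun p => by positivity
  rw [e1, e2, mul_left_comm]
  refine mul_le_mul_right ?_ _
  rw [lintegral_congr fun p => hmax _ (β (cosA p)) (sq_nonneg (incr g p)),
    lintegral_congr fun p => hmax _ (β (cosA p)) (hnn p)]
  set βn : ℕ → ℝ → ℝ := fun n x => min (max (β x) 0) n with hβn
  have mβn : ∀ n, Measurable fun p => βn n (cosA (d := d) p) := fun n =>
    ((mβ.max measurable_const).min measurable_const)
  have hβn0 : ∀ n x, 0 ≤ βn n x := fun n x => le_min (le_max_right _ _) n.cast_nonneg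
  have iβn : ∀ n, Integrable (fun p => βn n (cosA (d := d) p)) (surf2 d) := fun n =>
    Integrable.of_bound (mβn n).aestronglyMeasurable n (Eventually.of_forall fun p => by
      rw [Real.norm_of_nonneg (hβn0 _ _)]; exact min_le_right _ _)
  have hsup : ∫⁻ p, ENNReal.ofReal (incr g p ^ 2 * max (β (cosA p)) 0) ∂(surf2 d)
      = ⨆ n, ∫⁻ p, ENNReal.ofReal (incr g p ^ 2 * βn n (cosA p)) ∂(surf2 d) := by
    have hm : ∀ n, Measurable fun p => ENNReal.ofReal (incr g p ^ 2 * βn n (cosA p)) := fun n =>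
      ((ci.measurable.pow_const 2).mul (mβn n)).ennreal_ofReal
    rw [← lintegral_iSup hm]
    · refine lintegral_congr fun p => le_antisymm ?_ (iSup_le fun n => ENNReal.ofReal_le_ofReal ?_)
      · obtain ⟨n, hn⟩ := exists_nat_ge (max (β (cosA p)) 0)
        refine le_iSup_of_le n ?_
        rw [hβn]; simp only [min_eq_left hn]; exact le_rfl
      · exact mul_le_mul_of_nonneg_left (min_le_left _ _) (sq_nonneg _)
    · intro m n hmn p
      refine ENNReal.ofReal_le_ofReal (mul_le_mul_of_nonneg_left ?_ (sq_nonneg _))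
      exact min_le_min_left _ (by exact_mod_cast hmn)
  rw [hsup, ENNReal.mul_iSup]
  refine iSup_le fun n => ?_
  have h := kernel_poincare hd (hβn0 n) (iβn n) hg1 hg.even
  have hi : ∀ a b : Fin d, Integrable (fun p => βn n (cosA p) * incr (ang a b g) p ^ 2) (surf2 d) :=
    fun a b => integrable_kernel_mul (iβn n) ((ca a b).pow 2)
  simp_rw [← integral_finsetSum _ fun b _ => hi _ b] at h
  rw [← integral_finsetSum _ fun a _ => integrable_finsetSum _ fun b _ => hi a b,
    ← integral_const_mul (1 / 2 : ℝ)] at h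
  have hcast : (2 * (d : ℝ≥0∞)) = ENNReal.ofReal (2 * d) := by
    rw [ENNReal.ofReal_mul zero_le_two]; simp
  have hL : ∫⁻ p, ENNReal.ofReal (incr g p ^ 2 * βn n (cosA p)) ∂(surf2 d)
      = ENNReal.ofReal (∫ p, βn n (cosA p) * incr g p ^ 2 ∂(surf2 d)) := by
    have hI : Integrable (fun p => βn n (cosA p) * incr g p ^ 2) (surf2 d) :=
      integrable_kernel_mul (iβn n) (ci.pow 2)
    rw [ofReal_integral_eq_lintegral_ofReal hI
      (Eventually.of_forall fun p => mul_nonneg (hβn0 _ _) (sq_nonneg _))]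
    simp_rw [mul_comm]
  rw [hL, hcast, ← ENNReal.ofReal_mul (by positivity)]
  refine (ENNReal.ofReal_le_ofReal h).trans ?_
  rw [ofReal_integral_eq_lintegral_ofReal]
  · refine lintegral_mono fun p => ENNReal.ofReal_le_ofReal ?_
    simp_rw [← Finset.mul_sum]
    rw [mul_left_comm, mul_comm (βn n (cosA p))]
    exact mul_le_mul_of_nonneg_left (min_le_left _ _) (hnn p)
  · exact (integrable_finsetSum _ fun a _ => integrable_finsetSum _ fun b _ => hi a b).const_mul _
  · refine Eventually.of_forall fun p => mul_nonneg (by norm_num) (Finset.sum_nonneg fun a _ =>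
      Finset.sum_nonneg fun b _ => mul_nonneg (hβn0 _ _) (sq_nonneg _))

end Constants


/-! ### Polar coordinates and integration by parts -/

noncomputable section Polar

variable {d : ℕ}

/-- The radial measure `r^{d-1} dr` on `(0, ∞)`. -/
def radial (d : ℕ) : Measure ℝ :=
  (volume.restrict (Ioi 0)).withDensity fun r => ENNReal.ofReal (r ^ (d - 1))

instance : SFinite (radial d) := by unfold radial; infer_instance

theorem measurePreserving_polar (hd : 2 ≤ d) :
    MeasurePreserving (fun p : ℝ × USphere d => p.1 • (p.2 : Vel d))
      ((radial d).prod (surf d)) volume := by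
  have : Nontrivial (Vel d) := ⟨⟨eb ⟨0, by omega⟩, 0, fun h => by
    have := congrArg norm h; simp [eb] at this⟩⟩
  have h1 := Measure.measurePreserving_homeomorphUnitSphereProd (volume : Measure (Vel d))
  have h2 : MeasurePreserving (homeomorphUnitSphereProd (Vel d)).symm
      ((surf d).prod (Measure.volumeIoiPow (d - 1)))
      ((volume : Measure (Vel d)).comap ((↑) : ({0}ᶜ : Set (Vel d)) → Vel d)) := by
    have := h1.symm (e := (homeomorphUnitSphereProd (Vel d)).toMeasurableEquiv)
    simpa [surf] using! this
  have h3 : MeasurePreserving ((↑) : ({0}ᶜ : Set (Vel d)) → Vel d)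
      ((volume : Measure (Vel d)).comap (↑)) volume := by
    refine ⟨measurable_subtype_coe, ?_⟩
    rw [map_comap_subtype_coe (measurableSet_singleton _).compl, restrict_compl_singleton]
  have h4 : MeasurePreserving ((↑) : Ioi (0 : ℝ) → ℝ) (Measure.volumeIoiPow (d - 1)) (radial d) := by
    refine ⟨measurable_subtype_coe, Measure.ext fun s hs => ?_⟩
    rw [Measure.map_apply measurable_subtype_coe hs, Measure.volumeIoiPow, radial,
      withDensity_apply _ (measurable_subtype_coe hs), withDensity_apply _ hs,
      Measure.restrict_restrict hs,
      setLIntegral_subtype measurableSet_Ioi _ fun r : ℝ => ENNReal.ofReal (r ^ (d - 1)),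
      Subtype.image_preimage_coe, inter_comm]
  have h5 := (h4.prod (MeasurePreserving.id (surf d))).comp
    (Measure.measurePreserving_swap (μ := surf d) (ν := Measure.volumeIoiPow (d - 1)))
  have h6 := h3.comp h2
  refine ⟨by fun_prop, ?_⟩
  rw [← h5.map_eq, Measure.map_map (by fun_prop) h5.measurable, ← h6.map_eq]
  rfl

theorem radial_ae_pos : ∀ᵐ r ∂(radial d), 0 < r := by
  refine (withDensity_absolutelyContinuous _ _).ae_le ?_
  exact ae_restrict_mem measurableSet_Ioi

theorem integral_radial (f : ℝ → ℝ) :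
    ∫ r, f r ∂(radial d) = ∫ r in Ioi 0, r ^ (d - 1) * f r := by
  rw [radial, integral_withDensity_eq_integral_toReal_smul (by fun_prop)
    (Eventually.of_forall fun _ => ENNReal.ofReal_lt_top)]
  refine setIntegral_congr_fun measurableSet_Ioi fun r (hr : 0 < r) => ?_
  simp [ENNReal.toReal_ofReal (pow_nonneg hr.le (d - 1))]

theorem integrable_radial_iff {f : ℝ → ℝ} :
    Integrable f (radial d) ↔ IntegrableOn (fun r => r ^ (d - 1) * f r) (Ioi 0) := by
  rw [radial, integrable_withDensity_iff_integrable_smul' (by fun_prop)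
    (Eventually.of_forall fun _ => ENNReal.ofReal_lt_top)]
  refine integrableOn_congr_fun (fun r (hr : 0 < r) => ?_) measurableSet_Ioi
  simp [ENNReal.toReal_ofReal (pow_nonneg hr.le (d - 1))]

/-- The integral of a derivative over `(0, ∞)` vanishes when the function is small near `0` and
`∞` in an averaged sense. -/
theorem integral_Ioi_deriv_eq_zero {f f' : ℝ → ℝ}
    (hd : ∀ r, 0 < r → HasDerivAt f (f' r) r) (hf' : IntegrableOn f' (Ioi 0))
    (hf : IntegrableOn (fun r => f r / r) (Ioi 0)) : ∫ r in Ioi 0, f' r = 0 := by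
  -- Substituting `r = e^x` moves the problem to the whole line: the measure `dr/r` becomes `dx`, so
  -- integrability of `f(r)/r` is that of `f(e^x)`, and no pointwise boundary values are needed.
  have hexp : ∀ x ∈ (univ : Set ℝ), HasDerivWithinAt Real.exp (Real.exp x) univ x :=
    fun x _ => (Real.hasDerivAt_exp x).hasDerivWithinAt
  have hinj : InjOn Real.exp univ := Real.exp_injective.injOn
  have himg : Real.exp '' univ = Ioi 0 := by rw [image_univ, Real.range_exp]
  have e1 := integral_image_eq_integral_abs_deriv_smul MeasurableSet.univ hexp hinj f'
  have e2 := integrableOn_image_iff_integrableOn_abs_deriv_smul MeasurableSet.univ hexp hinj f'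
  have e3 := integrableOn_image_iff_integrableOn_abs_deriv_smul MeasurableSet.univ hexp hinj
    (fun r => f r / r)
  rw [himg] at e1 e2 e3
  rw [e1, setIntegral_univ]
  have h2 := integrableOn_univ.1 (e2.1 hf')
  have h3 := integrableOn_univ.1 (e3.1 hf)
  refine integral_eq_zero_of_hasDerivAt_of_integrable (f := fun x => f (Real.exp x))
    (fun x => ?_) h2 ?_
  · have := (hd (Real.exp x) (Real.exp_pos x)).comp x (Real.hasDerivAt_exp x)
    simpa [mul_comm] using! this
  · refine h3.congr (Eventually.of_forall fun x => ?_)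
    simp only [abs_of_pos (Real.exp_pos x), smul_eq_mul]
    field_simp

end Polar


/-! ### Functions of Gaussian growth -/

noncomputable section Growth

variable {d : ℕ}

/-- `f` is of class `C²` and its derivatives of order at most two are bounded by `C e^{a|v|²}`. -/
structure GaussGrowth (a C : ℝ) (f : Vel d → ℝ) : Prop where
  contDiff : ContDiff ℝ 2 f
  bound : ∀ n : ℕ, n ≤ 2 → ∀ v, ‖iteratedFDeriv ℝ n f v‖ ≤ C * Real.exp (a * ‖v‖ ^ 2)

theorem contDiff_pd {f : Vel d → ℝ} {m n : WithTop ℕ∞} (hf : ContDiff ℝ n f) (h : m + 1 ≤ n)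
    (i : Fin d) : ContDiff ℝ m (pd i f) :=
  (hf.fderiv_right h).clm_apply contDiff_const

theorem continuous_pd {f : Vel d → ℝ} (hf : ContDiff ℝ 1 f) (i : Fin d) : Continuous (pd i f) :=
  (contDiff_pd (m := 0) hf (by simp) i).continuous

theorem pd_pd {f : Vel d → ℝ} (hf : ContDiff ℝ 2 f) (i j : Fin d) (v : Vel d) :
    pd i (pd j f) v = fderiv ℝ (fderiv ℝ f) v (eb i) (eb j) := by
  have h : HasFDerivAt (fderiv ℝ f) (fderiv ℝ (fderiv ℝ f) v) v :=
    ((hf.fderiv_right (m := 1) (by norm_num)).differentiable one_ne_zero v).hasFDerivAt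
  have := (h.clm_apply (hasFDerivAt_const (eb j) v)).fderiv
  unfold pd
  rw [this]; simp

@[simp] theorem norm_eb (i : Fin d) : ‖(eb i : Vel d)‖ = 1 := by simp [eb]

namespace GaussGrowth

variable {a C : ℝ} {f : Vel d → ℝ}

theorem abs_le (h : GaussGrowth a C f) (v : Vel d) : |f v| ≤ C * Real.exp (a * ‖v‖ ^ 2) := by
  simpa using h.bound 0 (by norm_num) v

theorem fderiv_le (h : GaussGrowth a C f) (v : Vel d) :
    ‖fderiv ℝ f v‖ ≤ C * Real.exp (a * ‖v‖ ^ 2) := by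
  rw [← norm_iteratedFDeriv_one]; exact h.bound 1 (by norm_num) v

theorem fderiv2_le (h : GaussGrowth a C f) (v : Vel d) :
    ‖fderiv ℝ (fderiv ℝ f) v‖ ≤ C * Real.exp (a * ‖v‖ ^ 2) := by
  rw [← norm_iteratedFDeriv_one, norm_iteratedFDeriv_fderiv]; exact h.bound 2 (by norm_num) v

theorem contDiff_one (h : GaussGrowth a C f) : ContDiff ℝ 1 f := h.contDiff.of_le (by norm_num)

theorem nonneg (h : GaussGrowth a C f) : 0 ≤ C := by
  have := (abs_nonneg _).trans (h.abs_le 0)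
  exact (mul_nonneg_iff_left_nonneg_of_pos (Real.exp_pos _)).1 (by rwa [mul_comm] at this)

theorem abs_pd_le (h : GaussGrowth a C f) (i : Fin d) (v : Vel d) :
    |pd i f v| ≤ C * Real.exp (a * ‖v‖ ^ 2) := by
  have := (fderiv ℝ f v).le_opNorm (eb i)
  rw [norm_eb, mul_one] at this
  exact this.trans (h.fderiv_le v)

theorem abs_pd_pd_le (h : GaussGrowth a C f) (i j : Fin d) (v : Vel d) :
    |pd i (pd j f) v| ≤ C * Real.exp (a * ‖v‖ ^ 2) := by
  have := (fderiv ℝ (fderiv ℝ f) v).le_opNorm₂ (eb i) (eb j)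
  rw [norm_eb, norm_eb, mul_one, mul_one] at this
  rw [pd_pd h.contDiff]
  exact this.trans (h.fderiv2_le v)

theorem mono {a' C' : ℝ} (h : GaussGrowth a C f) (ha : a ≤ a') (hC : C ≤ C') :
    GaussGrowth a' C' f :=
  ⟨h.contDiff, fun n hn v => (h.bound n hn v).trans (by
    have := h.nonneg
    have := h.nonneg.trans hC
    gcongr)⟩

theorem add {C' : ℝ} {g : Vel d → ℝ} (h : GaussGrowth a C f) (h' : GaussGrowth a C' g) :
    GaussGrowth a (C + C') (fun v => f v + g v) := by
  refine ⟨h.contDiff.add h'.contDiff, fun n hn v => ?_⟩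
  have hn' : (n : WithTop ℕ∞) ≤ 2 := by exact_mod_cast hn
  rw [fun_iteratedFDeriv_add_apply (h.contDiff.of_le hn').contDiffAt
    (h'.contDiff.of_le hn').contDiffAt, add_mul]
  exact (norm_add_le _ _).trans (add_le_add (h.bound n hn v) (h'.bound n hn v))

theorem sub {C' : ℝ} {g : Vel d → ℝ} (h : GaussGrowth a C f) (h' : GaussGrowth a C' g) :
    GaussGrowth a (C + C') (fun v => f v - g v) := by
  refine ⟨h.contDiff.sub h'.contDiff, fun n hn v => ?_⟩
  have hn' : (n : WithTop ℕ∞) ≤ 2 := by exact_mod_cast hn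
  rw [fun_iteratedFDeriv_sub_apply (h.contDiff.of_le hn').contDiffAt
    (h'.contDiff.of_le hn').contDiffAt, add_mul]
  exact (norm_sub_le _ _).trans (add_le_add (h.bound n hn v) (h'.bound n hn v))

theorem comp_isometry (h : GaussGrowth a C f) (R : Vel d ≃ₗᵢ[ℝ] Vel d) :
    GaussGrowth a C (fun v => f (R v)) :=
  ⟨h.contDiff.comp R.contDiff, fun n hn v => by
    have := R.norm_iteratedFDeriv_comp_right (𝕜 := ℝ) f v n
    rw [show (fun v => f (R v)) = f ∘ R from rfl, this, ← R.norm_map v]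
    exact h.bound n hn _⟩

/-- From `|v + y|² ≤ 2|v|² + 2|y|²`. This doubling is the source of the threshold `a < 1/4`: a
product of two such functions grows like `e^{4a|c|²}` and must be integrable against `e^{-|c|²}`. -/
theorem comp_add_right (h : GaussGrowth a C f) (ha : 0 ≤ a) (y : Vel d) :
    GaussGrowth (2 * a) (C * Real.exp (2 * a * ‖y‖ ^ 2)) (fun v => f (v + y)) := by
  refine ⟨h.contDiff.comp (contDiff_id.add contDiff_const), fun n hn v => ?_⟩
  rw [iteratedFDeriv_comp_add_right]
  refine (h.bound n hn _).trans ?_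
  rw [mul_assoc, ← Real.exp_add]
  have h1 : ‖v + y‖ ^ 2 ≤ 2 * ‖v‖ ^ 2 + 2 * ‖y‖ ^ 2 := by
    have := norm_add_le v y
    nlinarith [norm_nonneg (v + y), sq_nonneg (‖v‖ - ‖y‖)]
  have := h.nonneg
  gcongr
  nlinarith

end GaussGrowth

/-- The symmetric extension `h(c + y) + h(c - y)`. -/
def symm2 (h : Vel d → ℝ) (c y : Vel d) : ℝ := h (c + y) + h (c - y)

theorem symm2_neg (h : Vel d → ℝ) (c y : Vel d) : symm2 h c (-y) = symm2 h c y := by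
  simp [symm2, add_comm, ← sub_eq_add_neg]

theorem GaussGrowth.symm2_left {a C : ℝ} {h : Vel d → ℝ} (hh : GaussGrowth a C h) (ha : 0 ≤ a)
    (y : Vel d) :
    GaussGrowth (2 * a) (2 * (C * Real.exp (2 * a * ‖y‖ ^ 2))) (fun c => symm2 h c y) := by
  rw [two_mul (C * _)]
  have h2 := hh.comp_add_right ha (-y)
  rw [norm_neg] at h2
  simpa [symm2, sub_eq_add_neg] using (hh.comp_add_right ha y).add h2

theorem GaussGrowth.symm2_right {a C : ℝ} {h : Vel d → ℝ} (hh : GaussGrowth a C h) (ha : 0 ≤ a)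
    (c : Vel d) :
    GaussGrowth (2 * a) (2 * (C * Real.exp (2 * a * ‖c‖ ^ 2))) (symm2 h c) := by
  rw [two_mul (C * _)]
  have h1 := hh.comp_add_right ha c
  have h2 := h1.comp_isometry (LinearIsometryEquiv.neg ℝ)
  have := h1.add h2
  simpa [symm2, sub_eq_add_neg, add_comm] using! this

theorem pd_symm2_left {h : Vel d → ℝ} (hh : ContDiff ℝ 1 h) (y : Vel d) (i : Fin d) (c : Vel d) :
    pd i (fun c => symm2 h c y) c = pd i h (c + y) + pd i h (c - y) := by
  have hd := hh.differentiable one_ne_zero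
  have h1 : HasFDerivAt (fun c => h (c + y)) (fderiv ℝ h (c + y)) c := by
    simpa using! (hd (c + y)).hasFDerivAt.comp c ((hasFDerivAt_id c).add_const y)
  have h2 : HasFDerivAt (fun c => h (c - y)) (fderiv ℝ h (c - y)) c := by
    simpa using! (hd (c - y)).hasFDerivAt.comp c ((hasFDerivAt_id c).sub_const y)
  have h3 : HasFDerivAt (fun c => symm2 h c y) (fderiv ℝ h (c + y) + fderiv ℝ h (c - y)) c :=
    h1.add h2
  simp [pd, h3.fderiv]

theorem pd_symm2_right {h : Vel d → ℝ} (hh : ContDiff ℝ 1 h) (c : Vel d) (i : Fin d) (y : Vel d) :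
    pd i (symm2 h c) y = pd i h (c + y) - pd i h (c - y) := by
  have hd := hh.differentiable one_ne_zero
  have h1 : HasFDerivAt (fun y => h (c + y)) (fderiv ℝ h (c + y)) y := by
    simpa using! (hd (c + y)).hasFDerivAt.comp y ((hasFDerivAt_id y).const_add c)
  have h2 : HasFDerivAt (fun y => h (c - y)) (-fderiv ℝ h (c - y)) y := by
    simpa using! (hd (c - y)).hasFDerivAt.comp y ((hasFDerivAt_id y).const_sub c)
  have h3 : HasFDerivAt (symm2 h c) (fderiv ℝ h (c + y) + -fderiv ℝ h (c - y)) y := h1.add h2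
  simp [pd, h3.fderiv, sub_eq_add_neg]

theorem pd_pd_symm2_left {h : Vel d → ℝ} (hh : ContDiff ℝ 2 h) (y : Vel d) (i j : Fin d)
    (c : Vel d) : pd i (pd j fun c => symm2 h c y) c
      = pd i (pd j h) (c + y) + pd i (pd j h) (c - y) := by
  have h1 : ContDiff ℝ 1 h := hh.of_le (by norm_num)
  have e : pd j (fun c => symm2 h c y) = fun c => symm2 (pd j h) c y :=
    funext fun c => pd_symm2_left h1 y j c
  rw [e, pd_symm2_left (contDiff_pd hh (by norm_num) j)]

theorem pd_pd_symm2_right {h : Vel d → ℝ} (hh : ContDiff ℝ 2 h) (c : Vel d) (i j : Fin d)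
    (y : Vel d) : pd i (pd j (symm2 h c)) y
      = pd i (pd j h) (c + y) + pd i (pd j h) (c - y) := by
  have h1 : ContDiff ℝ 1 h := hh.of_le (by norm_num)
  have e : pd j (symm2 h c) = fun y => pd j h (c + y) - pd j h (c - y) :=
    funext fun y => pd_symm2_right h1 c j y
  have hd := (contDiff_pd (m := 1) hh (by norm_num) j).differentiable one_ne_zero
  have h1 : HasFDerivAt (fun y => pd j h (c + y)) (fderiv ℝ (pd j h) (c + y)) y := by
    simpa using! (hd (c + y)).hasFDerivAt.comp y ((hasFDerivAt_id y).const_add c)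
  have h2 : HasFDerivAt (fun y => pd j h (c - y)) (-fderiv ℝ (pd j h) (c - y)) y := by
    simpa using! (hd (c - y)).hasFDerivAt.comp y ((hasFDerivAt_id y).const_sub c)
  have h3 : HasFDerivAt (fun y => pd j h (c + y) - pd j h (c - y))
      (fderiv ℝ (pd j h) (c + y) - -fderiv ℝ (pd j h) (c - y)) y := h1.sub h2
  rw [e, pd, h3.fderiv]
  simp [pd]

/-! ### Integration by parts for Gaussian weights -/

theorem integrable_exp_neg_mul_norm_sq {s : ℝ} (hs : 0 < s) :
    Integrable fun v : Vel d => Real.exp (-s * ‖v‖ ^ 2) := by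
  have h := (GaussianFourier.integrable_cexp_neg_mul_sq_norm_add (V := Vel d) (b := (s : ℂ))
    (by simpa using hs) 0 0).norm
  refine h.congr (Eventually.of_forall fun v => ?_)
  simp only [Complex.norm_exp]
  congr 1
  simp [← Complex.ofReal_pow]

theorem one_add_le_mul_exp {s : ℝ} (hs : 0 < s) (x : ℝ) :
    1 + x ≤ (2 + 1 / s) * Real.exp (s * x ^ 2) := by
  have h1 := Real.add_one_le_exp (s * x ^ 2)
  have h2 : 1 ≤ Real.exp (s * x ^ 2) := Real.one_le_exp (by positivity)
  have h3 : x ≤ 1 + x ^ 2 := by nlinarith [sq_nonneg (x - 1)]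
  have h4 : x ^ 2 ≤ 1 / s * Real.exp (s * x ^ 2) := by
    rw [one_div, inv_mul_eq_div, le_div_iff₀ hs]; linarith
  nlinarith

theorem integrable_one_add_norm_mul_exp {s : ℝ} (hs : 0 < s) :
    Integrable fun v : Vel d => (1 + ‖v‖) * Real.exp (-s * ‖v‖ ^ 2) := by
  refine ((integrable_exp_neg_mul_norm_sq (d := d) (half_pos hs)).const_mul (2 + 1 / (s / 2))).mono'
    (by fun_prop) (Eventually.of_forall fun v => ?_)
  rw [Real.norm_of_nonneg (by positivity)]
  calc (1 + ‖v‖) * Real.exp (-s * ‖v‖ ^ 2)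
      ≤ ((2 + 1 / (s / 2)) * Real.exp (s / 2 * ‖v‖ ^ 2)) * Real.exp (-s * ‖v‖ ^ 2) := by
        gcongr; exact one_add_le_mul_exp (half_pos hs) _
    _ = _ := by rw [mul_assoc, ← Real.exp_add]; congr 2; ring

theorem gauss_mul_le {s a C C' : ℝ} {p q r x : ℝ} (hp : |p| ≤ C * Real.exp (a * x ^ 2))
    (hq : |q| ≤ C' * Real.exp (a * x ^ 2)) (hr : |r| ≤ 1 + |x|) (hC : 0 ≤ C) (hC' : 0 ≤ C') :
    |Real.exp (-s * x ^ 2) * (p * q * r)|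
      ≤ C * C' * ((1 + |x|) * Real.exp (-(s - 2 * a) * x ^ 2)) := by
  rw [abs_mul, Real.abs_exp, abs_mul, abs_mul]
  calc Real.exp (-s * x ^ 2) * (|p| * |q| * |r|)
      ≤ Real.exp (-s * x ^ 2) * (C * Real.exp (a * x ^ 2) * (C' * Real.exp (a * x ^ 2))
        * (1 + |x|)) := by gcongr
    _ = C * C' * ((1 + |x|) * (Real.exp (-s * x ^ 2) * Real.exp (a * x ^ 2)
        * Real.exp (a * x ^ 2))) := by ring
    _ = _ := by rw [← Real.exp_add, ← Real.exp_add]; congr 3; ring_nf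

theorem integrable_gauss_mul {s a C C' : ℝ} (h : 2 * a < s) {p q r : Vel d → ℝ}
    (cp : Continuous p) (cq : Continuous q) (cr : Continuous r)
    (hp : ∀ v, |p v| ≤ C * Real.exp (a * ‖v‖ ^ 2)) (hq : ∀ v, |q v| ≤ C' * Real.exp (a * ‖v‖ ^ 2))
    (hr : ∀ v, |r v| ≤ 1 + ‖v‖) (hC : 0 ≤ C) (hC' : 0 ≤ C') :
    Integrable fun v => Real.exp (-s * ‖v‖ ^ 2) * (p v * q v * r v) := by
  refine ((integrable_one_add_norm_mul_exp (d := d) (sub_pos.2 h)).const_mul (C * C')).mono'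
    (by fun_prop) (Eventually.of_forall fun v => ?_)
  have := gauss_mul_le (s := s) (r := r v) (hp v) (hq v) (by rw [abs_norm]; exact hr v) hC hC'
  rwa [abs_norm] at this

theorem abs_coord_le (v : Vel d) (i : Fin d) : |v i| ≤ ‖v‖ := PiLp.norm_apply_le v i

theorem hasFDerivAt_exp_neg_mul_norm_sq (s : ℝ) (v : Vel d) :
    HasFDerivAt (fun v : Vel d => Real.exp (-s * ‖v‖ ^ 2))
      (Real.exp (-s * ‖v‖ ^ 2) • (-s) • (2 • innerSL ℝ v)) v :=
  ((hasStrictFDerivAt_norm_sq v).hasFDerivAt.const_mul (-s)).exp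

/-- Integrate by parts the product of `e^{-s|v|²} f` with `∂_i g`; the term `-2s v_i` comes from
differentiating the weight. The condition `2a < s` makes every product integrable, so nothing is
left at infinity. -/
theorem integral_gauss_by_parts_coord {s a C C' : ℝ} (h : 2 * a < s) {f g : Vel d → ℝ}
    (hf : GaussGrowth a C f) (hg : GaussGrowth a C' g) (i : Fin d) :
    Integrable (fun v => Real.exp (-s * ‖v‖ ^ 2) * (f v * (pd i (pd i g) v - 2 * s * v i * pd i g v)))
    ∧ Integrable (fun v => Real.exp (-s * ‖v‖ ^ 2) * (pd i f v * pd i g v))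
    ∧ ∫ v, Real.exp (-s * ‖v‖ ^ 2) * (f v * (pd i (pd i g) v - 2 * s * v i * pd i g v))
      = - ∫ v, Real.exp (-s * ‖v‖ ^ 2) * (pd i f v * pd i g v) := by
  have cf := hf.contDiff.continuous
  have cpf := continuous_pd hf.contDiff_one i
  have cpg := continuous_pd hg.contDiff_one i
  have cppg := continuous_pd (contDiff_pd (m := 1) hg.contDiff (by norm_num) i) i
  have hC := hf.nonneg
  have hC' := hg.nonneg
  have one_le : ∀ v : Vel d, |(1 : ℝ)| ≤ 1 + ‖v‖ := fun v => by simp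
  have ci : ∀ v : Vel d, |v i| ≤ 1 + ‖v‖ := fun v => (abs_coord_le v i).trans (by linarith)
  have i1 : Integrable fun v => Real.exp (-s * ‖v‖ ^ 2) * (f v * pd i (pd i g) v * 1) :=
    integrable_gauss_mul h cf cppg continuous_const hf.abs_le (hg.abs_pd_pd_le i i) one_le hC hC'
  have i2 : Integrable fun v => Real.exp (-s * ‖v‖ ^ 2) * (f v * pd i g v * v i) :=
    integrable_gauss_mul h cf cpg (by fun_prop) hf.abs_le (hg.abs_pd_le i) ci hC hC'
  have i3 : Integrable fun v => Real.exp (-s * ‖v‖ ^ 2) * (f v * pd i g v * 1) :=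
    integrable_gauss_mul h cf cpg continuous_const hf.abs_le (hg.abs_pd_le i) one_le hC hC'
  have i4 : Integrable fun v => Real.exp (-s * ‖v‖ ^ 2) * (pd i f v * pd i g v * 1) :=
    integrable_gauss_mul h cpf cpg continuous_const (hf.abs_pd_le i) (hg.abs_pd_le i) one_le hC hC'
  simp only [mul_one] at i1 i3 i4
  have hF : ∀ v, HasFDerivAt (fun v => Real.exp (-s * ‖v‖ ^ 2) * f v)
      (Real.exp (-s * ‖v‖ ^ 2) • fderiv ℝ f v
        + f v • (Real.exp (-s * ‖v‖ ^ 2) • (-s) • (2 • innerSL ℝ v))) v := fun v =>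
    (hasFDerivAt_exp_neg_mul_norm_sq s v).mul
      (hf.contDiff.differentiable (by norm_num) v).hasFDerivAt
  have hFv : ∀ v, fderiv ℝ (fun v => Real.exp (-s * ‖v‖ ^ 2) * f v) v (eb i)
      = Real.exp (-s * ‖v‖ ^ 2) * (pd i f v - 2 * s * v i * f v) := by
    intro v
    rw [(hF v).fderiv]
    have hv : inner ℝ v (eb i) = v i := by rw [real_inner_comm, inner_eb]
    simp [pd, hv]
    ring
  have key := integral_mul_fderiv_eq_neg_fderiv_mul_of_integrable (μ := (volume : Measure (Vel d)))
    (f := fun v => Real.exp (-s * ‖v‖ ^ 2) * f v) (g := pd i g) (v := eb i)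
    (by
      simp_rw [hFv]
      refine (i4.sub (i2.const_mul (2 * s))).congr (Eventually.of_forall fun v => ?_)
      simp only [Pi.sub_apply]; ring)
    (by
      refine i1.congr (Eventually.of_forall fun v => ?_)
      simp only [pd]; ring)
    (by
      refine i3.congr (Eventually.of_forall fun v => ?_)
      ring)
    (fun v _ => (hF v).differentiableAt)
    (fun v _ => (contDiff_pd (m := 1) hg.contDiff (by norm_num) i).differentiable one_ne_zero v)
  refine ⟨(i1.sub (i2.const_mul (2 * s))).congr (Eventually.of_forall fun v => ?_), i4, ?_⟩
  · simp only [Pi.sub_apply]; ring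
  · have e1 : ∫ v, Real.exp (-s * ‖v‖ ^ 2) * (f v * (pd i (pd i g) v - 2 * s * v i * pd i g v))
        = (∫ v, Real.exp (-s * ‖v‖ ^ 2) * (f v * pd i (pd i g) v))
          - 2 * s * ∫ v, Real.exp (-s * ‖v‖ ^ 2) * (f v * pd i g v * v i) := by
      rw [← integral_const_mul, ← integral_sub i1 (i2.const_mul (2 * s))]
      exact integral_congr_ae (Eventually.of_forall fun v => by ring)
    have e2 : ∫ v, fderiv ℝ (fun v => Real.exp (-s * ‖v‖ ^ 2) * f v) v (eb i) * pd i g v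
        = (∫ v, Real.exp (-s * ‖v‖ ^ 2) * (pd i f v * pd i g v))
          - 2 * s * ∫ v, Real.exp (-s * ‖v‖ ^ 2) * (f v * pd i g v * v i) := by
      rw [← integral_const_mul, ← integral_sub i4 (i2.const_mul (2 * s))]
      refine integral_congr_ae (Eventually.of_forall fun v => ?_)
      simp only [hFv]; ring
    have e3 : ∫ v, Real.exp (-s * ‖v‖ ^ 2) * f v * fderiv ℝ (pd i g) v (eb i)
        = ∫ v, Real.exp (-s * ‖v‖ ^ 2) * (f v * pd i (pd i g) v) :=
      integral_congr_ae (Eventually.of_forall fun v => by simp only [pd]; ring)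
    rw [e3, e2] at key
    rw [e1, key]; ring

/-- The Ornstein–Uhlenbeck operator `Δg - 2s v·∇g`. -/
def ouOp (s : ℝ) (g : Vel d → ℝ) (v : Vel d) : ℝ :=
  ∑ i, (pd i (pd i g) v - 2 * s * v i * pd i g v)

theorem continuous_ouOp (s : ℝ) {g : Vel d → ℝ} (hg : ContDiff ℝ 2 g) :
    Continuous (ouOp s g) := by
  refine continuous_finsetSum _ fun i _ => ?_
  have h1 := continuous_pd (contDiff_pd (m := 1) hg (by norm_num) i) i
  have h2 := continuous_pd (hg.of_le (m := 1) (by norm_num)) i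
  fun_prop

theorem GaussGrowth.abs_ouOp_le {a C s : ℝ} {g : Vel d → ℝ} (hg : GaussGrowth a C g) (hs : 0 ≤ s)
    (v : Vel d) :
    |ouOp s g v| ≤ d * (1 + 2 * s) * C * ((1 + ‖v‖) * Real.exp (a * ‖v‖ ^ 2)) := by
  refine (Finset.abs_sum_le_sum_abs _ _).trans ?_
  have h : ∀ i ∈ Finset.univ, |pd i (pd i g) v - 2 * s * v i * pd i g v|
      ≤ (1 + 2 * s) * C * ((1 + ‖v‖) * Real.exp (a * ‖v‖ ^ 2)) := by
    intro i _
    refine (abs_sub _ _).trans ?_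
    rw [abs_mul, abs_mul, abs_of_nonneg (by positivity : 0 ≤ 2 * s)]
    have h1 := hg.abs_pd_pd_le i i v
    have h2 := hg.abs_pd_le i v
    have h3 := abs_coord_le v i
    have hC := hg.nonneg
    calc _ ≤ C * Real.exp (a * ‖v‖ ^ 2) + 2 * s * ‖v‖ * (C * Real.exp (a * ‖v‖ ^ 2)) := by gcongr
      _ = (1 + 2 * s * ‖v‖) * (C * Real.exp (a * ‖v‖ ^ 2)) := by ring
      _ ≤ ((1 + 2 * s) * (1 + ‖v‖)) * (C * Real.exp (a * ‖v‖ ^ 2)) := by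
        gcongr
        nlinarith [norm_nonneg v]
      _ = _ := by ring
  refine (Finset.sum_le_sum h).trans (le_of_eq ?_)
  simp; ring

theorem integral_gauss_by_parts {s a C C' : ℝ} (h : 2 * a < s) {f g : Vel d → ℝ}
    (hf : GaussGrowth a C f) (hg : GaussGrowth a C' g) :
    Integrable (fun v => Real.exp (-s * ‖v‖ ^ 2) * (f v * ouOp s g v))
    ∧ Integrable (fun v => Real.exp (-s * ‖v‖ ^ 2) * ∑ i, pd i f v * pd i g v)
    ∧ ∫ v, Real.exp (-s * ‖v‖ ^ 2) * (f v * ouOp s g v)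
      = - ∫ v, Real.exp (-s * ‖v‖ ^ 2) * ∑ i, pd i f v * pd i g v := by
  have hi := fun i => integral_gauss_by_parts_coord h hf hg i
  simp only [ouOp, Finset.mul_sum]
  refine ⟨integrable_finsetSum _ fun i _ => (hi i).1, integrable_finsetSum _ fun i _ => (hi i).2.1,
    ?_⟩
  rw [integral_finsetSum _ fun i _ => (hi i).1, integral_finsetSum _ fun i _ => (hi i).2.1,
    ← Finset.sum_neg_distrib]
  exact Finset.sum_congr rfl fun i _ => (hi i).2.2

end Growth


/-! ### The dissipation inequality in the relative velocity -/

noncomputable section Relative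

variable {d : ℕ}

theorem sum_coord_smul_eb (x : Vel d) : ∑ i, x i • eb i = x := by
  ext j
  simp [eb, Pi.single_apply]

theorem fderiv_eq_sum (f : Vel d → ℝ) (y s : Vel d) :
    fderiv ℝ f y s = ∑ i, s i * pd i f y := by
  conv_lhs => rw [← sum_coord_smul_eb s]
  simp [pd]

theorem fderiv2_eq_sum {f : Vel d → ℝ} (hf : ContDiff ℝ 2 f) (y s : Vel d) :
    fderiv ℝ (fderiv ℝ f) y s s = ∑ i, ∑ j, s i * s j * pd i (pd j f) y := by
  conv_lhs => rw [← sum_coord_smul_eb s]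
  simp only [map_sum, map_smul, sum_apply, smul_apply, smul_eq_mul, ← pd_pd hf, Finset.mul_sum,
    mul_assoc]
  rw [Finset.sum_comm]
  exact Finset.sum_congr rfl fun i _ => Finset.sum_congr rfl fun j _ => by ring

theorem pd_coord_mul {f : Vel d → ℝ} {x : Vel d} (hf : DifferentiableAt ℝ f x) (i a : Fin d) :
    pd i (fun x => x a * f x) x = (if i = a then f x else 0) + x a * pd i f x := by
  have h1 : HasFDerivAt (fun x : Vel d => x a) (EuclideanSpace.proj a : Vel d →L[ℝ] ℝ) x :=
    (EuclideanSpace.proj a : Vel d →L[ℝ] ℝ).hasFDerivAt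
  have h := (h1.mul hf.hasFDerivAt).fderiv
  have h' : pd i (fun x => x a * f x) x
      = (x a • fderiv ℝ f x + f x • (EuclideanSpace.proj a : Vel d →L[ℝ] ℝ)) (eb i) :=
    congrArg (fun L : Vel d →L[ℝ] ℝ => L (eb i)) h
  rw [h']
  by_cases hi : i = a
  · subst hi; simp [pd, eb]; ring
  · simp [pd, eb, hi, Ne.symm hi]

theorem pd_sub {f g : Vel d → ℝ} {x : Vel d} (hf : DifferentiableAt ℝ f x)
    (hg : DifferentiableAt ℝ g x) (i : Fin d) :
    pd i (fun x => f x - g x) x = pd i f x - pd i g x := by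
  unfold pd
  rw [fderiv_fun_sub hf hg]; rfl

theorem ang_ang {V : Vel d → ℝ} (hV : ContDiff ℝ 2 V) (a b : Fin d) (x : Vel d) :
    ang a b (ang a b V) x = x a ^ 2 * pd b (pd b V) x + x b ^ 2 * pd a (pd a V) x
      - x a * x b * pd b (pd a V) x - x b * x a * pd a (pd b V) x
      + (if a = b then x a * pd a V x + x b * pd b V x else 0)
      - x a * pd a V x - x b * pd b V x := by
  have hd : ∀ i, DifferentiableAt ℝ (pd i V) x := fun i =>
    (contDiff_pd (m := 1) hV (by norm_num) i).differentiable one_ne_zero x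
  have hm : ∀ i j, DifferentiableAt ℝ (fun x : Vel d => x i * pd j V x) x := fun i j =>
    ((EuclideanSpace.proj i : Vel d →L[ℝ] ℝ).differentiableAt).mul (hd j)
  have e : ang a b V = fun x => x a * pd b V x - x b * pd a V x := funext fun x => ang_eq a b V x
  rw [ang_eq, e, pd_sub (hm _ _) (hm _ _), pd_sub (hm _ _) (hm _ _), pd_coord_mul (hd _),
    pd_coord_mul (hd _), pd_coord_mul (hd _), pd_coord_mul (hd _)]
  by_cases h : a = b
  · subst h; simp; ring
  · simp [h, Ne.symm h]; ring

/-- The spherical Laplacian in terms of the Laplacian and the radial derivatives. -/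
theorem sum_ang_ang {V : Vel d → ℝ} (hV : ContDiff ℝ 2 V) {x : Vel d} (hx : ‖x‖ = 1) :
    1 / 2 * ∑ a, ∑ b, ang a b (ang a b V) x
      = ∑ i, pd i (pd i V) x - fderiv ℝ (fderiv ℝ V) x x x - (d - 1) * fderiv ℝ V x x := by
  have hN : ∑ i, x i ^ 2 = 1 := by
    have := EuclideanSpace.norm_sq_eq x
    rw [hx] at this
    simpa using this.symm
  have e1 : ∑ a : Fin d, ∑ b : Fin d, x a ^ 2 * pd b (pd b V) x = ∑ i, pd i (pd i V) x := by
    rw [← Finset.sum_mul_sum, hN, one_mul]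
  have e2 : ∑ a : Fin d, ∑ b : Fin d, x b ^ 2 * pd a (pd a V) x = ∑ i, pd i (pd i V) x := by
    rw [Finset.sum_comm, e1]
  have e3 : ∑ a : Fin d, ∑ b : Fin d, x b * x a * pd a (pd b V) x
      = fderiv ℝ (fderiv ℝ V) x x x := by
    rw [fderiv2_eq_sum hV]
    exact Finset.sum_congr rfl fun i _ => Finset.sum_congr rfl fun j _ => by ring
  have e4 : ∑ a : Fin d, ∑ b : Fin d, x a * x b * pd b (pd a V) x
      = fderiv ℝ (fderiv ℝ V) x x x := by
    rw [Finset.sum_comm, e3]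
  simp_rw [ang_ang hV, Finset.sum_sub_distrib, Finset.sum_add_distrib, Finset.sum_sub_distrib,
    Finset.sum_add_distrib]
  rw [e1, e2, e3, e4, fderiv_eq_sum]
  simp [Finset.sum_add_distrib, ← Finset.mul_sum]
  ring

theorem pd_dilate {U : Vel d → ℝ} (hU : ContDiff ℝ 1 U) (r : ℝ) (i : Fin d) (x : Vel d) :
    pd i (fun x => U (r • x)) x = r * pd i U (r • x) := by
  have h1 : HasFDerivAt (fun x : Vel d => r • x) (r • ContinuousLinearMap.id ℝ (Vel d)) x :=
    (hasFDerivAt_id x).const_smul r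
  have h := ((hU.differentiable one_ne_zero (r • x)).hasFDerivAt.comp x h1).fderiv
  refine (congrArg (fun L : Vel d →L[ℝ] ℝ => L (eb i)) h).trans ?_
  simp [pd]

theorem pd_pd_dilate {U : Vel d → ℝ} (hU : ContDiff ℝ 2 U) (r : ℝ) (i j : Fin d) (x : Vel d) :
    pd i (pd j fun x => U (r • x)) x = r ^ 2 * pd i (pd j U) (r • x) := by
  have e : pd j (fun x => U (r • x)) = fun x => r * pd j U (r • x) :=
    funext fun x => pd_dilate (hU.of_le (by norm_num)) r j x
  have hc := contDiff_pd (m := 1) hU (by norm_num) j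
  have hd : DifferentiableAt ℝ (fun x => pd j U (r • x)) x :=
    (hc.comp (contDiff_const_smul r)).differentiable one_ne_zero x
  have h2 : pd i (fun x => r * pd j U (r • x)) x = r * pd i (fun x => pd j U (r • x)) x := by
    have h3 : HasFDerivAt (fun x => r * pd j U (r • x))
        (r • fderiv ℝ (fun x => pd j U (r • x)) x) x := hd.hasFDerivAt.const_mul r
    rw [pd, h3.fderiv]; rfl
  rw [e, h2, pd_dilate hc]; ring

theorem contDiff_dilate {U : Vel d → ℝ} {n : WithTop ℕ∞} (hU : ContDiff ℝ n U) (r : ℝ) :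
    ContDiff ℝ n (fun x => U (r • x)) := hU.comp (contDiff_const_smul r)

/-- The decomposition of the Ornstein–Uhlenbeck operator in polar coordinates. -/
theorem ouOp_polar {U : Vel d → ℝ} (hU : ContDiff ℝ 2 U) {r : ℝ} (hr : 0 < r) (s : USphere d) :
    ouOp 1 U (r • (s : Vel d)) = (fderiv ℝ (fderiv ℝ U) (r • (s : Vel d)) s s
        + ((d - 1) / r - 2 * r) * fderiv ℝ U (r • (s : Vel d)) s)
      + 1 / r ^ 2 * (1 / 2 * ∑ a, ∑ b, ang a b (ang a b fun x => U (r • x)) s) := by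
  rw [sum_ang_ang (contDiff_dilate hU r) (norm_usphere s),
    fderiv2_eq_sum (contDiff_dilate hU r), fderiv_eq_sum (fun x => U (r • x)), fderiv2_eq_sum hU,
    fderiv_eq_sum U, ouOp]
  simp only [pd_pd_dilate hU, pd_dilate (hU.of_le (by norm_num) : ContDiff ℝ 1 U)]
  have e1 : ∑ i, (s : Vel d) i * (r * pd i U (r • (s : Vel d)))
      = r * ∑ i, (s : Vel d) i * pd i U (r • (s : Vel d)) := by
    rw [Finset.mul_sum]; exact Finset.sum_congr rfl fun i _ => by ring
  have e2 : ∑ i, ∑ j, (s : Vel d) i * (s : Vel d) j * (r ^ 2 * pd i (pd j U) (r • (s : Vel d)))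
      = r ^ 2 * ∑ i, ∑ j, (s : Vel d) i * (s : Vel d) j * pd i (pd j U) (r • (s : Vel d)) := by
    simp only [Finset.mul_sum]
    exact Finset.sum_congr rfl fun i _ => Finset.sum_congr rfl fun j _ => by ring
  have e3 : ∑ i, 2 * 1 * (r • (s : Vel d)) i * pd i U (r • (s : Vel d))
      = 2 * r * ∑ i, (s : Vel d) i * pd i U (r • (s : Vel d)) := by
    rw [Finset.mul_sum]; exact Finset.sum_congr rfl fun i _ => by simp; ring
  rw [Finset.sum_sub_distrib, e1, e2, e3, ← Finset.mul_sum]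
  field_simp
  ring

/-! ### Bounds for even functions -/

theorem fderiv_neg_of_even {U : Vel d → ℝ} (hU : ContDiff ℝ 1 U) (he : ∀ y, U (-y) = U y)
    (y : Vel d) : fderiv ℝ U (-y) = - fderiv ℝ U y := by
  have h : HasFDerivAt (fun y => U (-y))
      ((fderiv ℝ U (-y)).comp (-ContinuousLinearMap.id ℝ (Vel d))) y :=
    (hU.differentiable one_ne_zero (-y)).hasFDerivAt.comp y (hasFDerivAt_id y).fun_neg
  rw [funext he] at h
  rw [h.fderiv]
  ext; simp

/-- The gradient of an even function is odd, hence zero at the origin. The resulting powers of `r`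
matter because the kernels are integrable near `r = 0` only against `r²`. -/
theorem norm_fderiv_le_of_even {U : Vel d → ℝ} (hU : ContDiff ℝ 2 U) (he : ∀ y, U (-y) = U y)
    {R K : ℝ} (hK : ∀ y, ‖y‖ ≤ R → ‖fderiv ℝ (fderiv ℝ U) y‖ ≤ K) {y : Vel d} (hy : ‖y‖ ≤ R) :
    ‖fderiv ℝ U y‖ ≤ K * ‖y‖ := by
  have h0 : fderiv ℝ U 0 = 0 := by
    have := fderiv_neg_of_even (hU.of_le (by norm_num)) he 0
    rw [neg_zero] at this
    ext x
    have := congrArg (fun L : Vel d →L[ℝ] ℝ => L x) this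
    simp at this ⊢
    linarith
  have hR : (0 : ℝ) ≤ R := (norm_nonneg _).trans hy
  have := (convex_closedBall (0 : Vel d) R).norm_image_sub_le_of_norm_fderiv_le (𝕜 := ℝ)
    (f := fderiv ℝ U) (C := K) (x := 0) (y := y)
    (fun z _ => (hU.fderiv_right (m := 1) (by norm_num)).differentiable one_ne_zero z)
    (fun z hz => hK z (by simpa using hz)) (by simpa using hR) (by simpa using hy)
  simpa [h0] using this

theorem abs_sub_zero_le_of_even {U : Vel d → ℝ} (hU : ContDiff ℝ 2 U) (he : ∀ y, U (-y) = U y)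
    {R K : ℝ} (hK : ∀ y, ‖y‖ ≤ R → ‖fderiv ℝ (fderiv ℝ U) y‖ ≤ K) {y : Vel d} (hy : ‖y‖ ≤ R) :
    |U y - U 0| ≤ K * R ^ 2 := by
  have hR : (0 : ℝ) ≤ R := (norm_nonneg _).trans hy
  have hK0 : 0 ≤ K := (norm_nonneg (fderiv ℝ (fderiv ℝ U) 0)).trans (hK 0 (by simpa using hR))
  have := (convex_closedBall (0 : Vel d) R).norm_image_sub_le_of_norm_fderiv_le (𝕜 := ℝ)
    (f := U) (C := K * R) (x := 0) (y := y) (fun z _ => hU.differentiable (by norm_num) z)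
    (fun z hz => by
      have hz' : ‖z‖ ≤ R := by simpa using hz
      exact (norm_fderiv_le_of_even hU he hK hz').trans (by gcongr))
    (by simpa using hR) (by simpa using hy)
  rw [sub_zero, Real.norm_eq_abs] at this
  calc _ ≤ K * R * ‖y‖ := this
    _ ≤ K * R * R := by gcongr
    _ = _ := by ring

theorem abs_incr_dilate_le {U : Vel d → ℝ} (hU : ContDiff ℝ 2 U) (he : ∀ y, U (-y) = U y)
    {R K : ℝ} (hR : 0 ≤ R) (hK : ∀ y, ‖y‖ ≤ R → ‖fderiv ℝ (fderiv ℝ U) y‖ ≤ K)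
    (p : USphere d × USphere d) : |incr (fun x => U (R • x)) p| ≤ 2 * K * R ^ 2 := by
  have hn : ∀ s : USphere d, ‖R • (s : Vel d)‖ ≤ R := fun s => by
    rw [norm_smul, norm_usphere, Real.norm_of_nonneg hR, mul_one]
  have h1 := abs_sub_zero_le_of_even hU he hK (hn p.1)
  have h2 := abs_sub_zero_le_of_even hU he hK (hn p.2)
  rw [abs_le] at *
  unfold incr
  constructor <;> linarith [h1.1, h1.2, h2.1, h2.2]

/-! ### The radial inequality -/

/-- With `F = r^{d-1} e^{-r²} β g g₁`, the left integrand is `F'` minus `β g₁²` and `β' g g₁`, up to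
the weight. The integral of `F'` vanishes, and `|β'| ≤ γβ/r` bounds the rest by completing the
square, whence the constant `γ²/4`. -/
theorem radial_inequality {γ α K : ℝ} (hd : 2 ≤ d) (hγ : 0 ≤ γ) {β g g1 g2 : ℝ → ℝ}
    (hβ0 : ∀ r, 0 < r → 0 ≤ β r) (hβd : ∀ r, 0 < r → DifferentiableAt ℝ β r)
    (hβ' : ∀ r, 0 < r → r * |deriv β r| ≤ γ * β r)
    (hg : ∀ r, 0 < r → HasDerivAt g (g1 r) r) (hg1 : ∀ r, 0 < r → HasDerivAt g1 (g2 r) r)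
    (b0 : ∀ r, 0 < r → |g r| ≤ K * Real.exp (α * r ^ 2) * r ^ 2)
    (b1 : ∀ r, 0 < r → |g1 r| ≤ K * Real.exp (α * r ^ 2) * r)
    (b2 : ∀ r, 0 < r → |g2 r| ≤ K * Real.exp (α * r ^ 2))
    (hint : Integrable (fun r => r ^ 2 * (1 + r ^ 2) * Real.exp (-(1 - 2 * α) * r ^ 2) * β r)
      (radial d))
    (hL : Integrable (fun r => Real.exp (-r ^ 2) * β r * (g r * (g2 r + ((d - 1) / r - 2 * r) * g1 r)))
      (radial d))
    (hR : Integrable (fun r => Real.exp (-r ^ 2) * β r * (g r ^ 2 / r ^ 2)) (radial d)) :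
    ∫ r, Real.exp (-r ^ 2) * β r * (g r * (g2 r + ((d - 1) / r - 2 * r) * g1 r)) ∂(radial d)
      ≤ γ ^ 2 / 4 * ∫ r, Real.exp (-r ^ 2) * β r * (g r ^ 2 / r ^ 2) ∂(radial d) := by
  rw [integral_radial, integral_radial]
  rw [integrable_radial_iff] at hint hL hR
  set F : ℝ → ℝ := fun r => r ^ (d - 1) * Real.exp (-r ^ 2) * β r * (g r * g1 r) with hF
  set F' : ℝ → ℝ := fun r => r ^ (d - 1) * Real.exp (-r ^ 2) *
    (β r * (((d - 1) / r - 2 * r) * (g r * g1 r) + g1 r * g1 r + g r * g2 r)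
      + deriv β r * (g r * g1 r)) with hF'
  have hdF : ∀ r, 0 < r → HasDerivAt F (F' r) r := by
    intro r hr
    have h1 : HasDerivAt (fun r : ℝ => r ^ (d - 1)) (((d - 1 : ℕ) : ℝ) * r ^ (d - 1 - 1)) r :=
      hasDerivAt_pow _ _
    have h2 : HasDerivAt (fun r : ℝ => Real.exp (-r ^ 2)) (Real.exp (-r ^ 2) * -(2 * r)) r := by
      simpa using ((hasDerivAt_pow 2 r).neg).exp
    have h3 := ((h1.mul h2).mul (hβd r hr).hasDerivAt).mul ((hg r hr).mul (hg1 r hr))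
    refine h3.congr_deriv ?_
    obtain ⟨n, rfl⟩ : ∃ n, d = n + 2 := ⟨d - 2, by omega⟩
    simp only [hF', show n + 2 - 1 = n + 1 by omega, show n + 1 - 1 = n by omega, Pi.mul_apply]
    push_cast
    field_simp
    ring
  have hβK : ∀ r : ℝ, 0 < r → 0 ≤ K := fun r hr => by
    have := (abs_nonneg _).trans (b2 r hr)
    exact (mul_nonneg_iff_left_nonneg_of_pos (Real.exp_pos _)).1 (by rwa [mul_comm] at this)
  have hexp : ∀ r : ℝ, Real.exp (-r ^ 2) * (Real.exp (α * r ^ 2) * Real.exp (α * r ^ 2))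
      = Real.exp (-(1 - 2 * α) * r ^ 2) := fun r => by
    rw [← Real.exp_add, ← Real.exp_add]; ring_nf
  have hd1 : (0 : ℝ) ≤ d - 1 := by
    have : (2 : ℝ) ≤ d := by exact_mod_cast hd
    linarith
  have hgg1 : ∀ r, 0 < r → |g r * g1 r| ≤ K ^ 2 * (Real.exp (α * r ^ 2) * Real.exp (α * r ^ 2)) * r ^ 3 :=
    fun r hr => by
      rw [abs_mul]
      calc _ ≤ (K * Real.exp (α * r ^ 2) * r ^ 2) * (K * Real.exp (α * r ^ 2) * r) :=
            mul_le_mul (b0 r hr) (b1 r hr) (abs_nonneg _) ((abs_nonneg _).trans (b0 r hr))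
        _ = _ := by ring
  have hF'int : IntegrableOn F' (Ioi 0) := by
    -- On `(0, ∞)` the function `F'` agrees with `deriv F`, and a derivative is measurable;
    -- continuity of `β'` is not needed.
    have hm : AEStronglyMeasurable F' (volume.restrict (Ioi 0)) := by
      refine (measurable_deriv F).aestronglyMeasurable.congr ?_
      filter_upwards [ae_restrict_mem measurableSet_Ioi] with r hr
      exact (hdF r hr).deriv
    refine Integrable.mono' (Integrable.const_mul hint (K ^ 2 * (d + 3 + γ))) hm ?_
    filter_upwards [ae_restrict_mem measurableSet_Ioi] with r (hr : 0 < r)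
    have hB := hβ0 r hr
    set e := Real.exp (α * r ^ 2) * Real.exp (α * r ^ 2) with he
    have he0 : 0 ≤ e := by positivity
    have hK := hβK r hr
    have k1 : |((d - 1) / r - 2 * r) * (g r * g1 r)| ≤ K ^ 2 * e * ((d - 1) * r ^ 2 + 2 * r ^ 4) := by
      rw [abs_mul]
      calc _ ≤ ((d - 1) / r + 2 * r) * (K ^ 2 * e * r ^ 3) := by
            refine mul_le_mul ?_ (hgg1 r hr) (abs_nonneg _) (by positivity)
            refine (abs_sub _ _).trans ?_
            rw [abs_of_nonneg (by positivity), abs_of_nonneg (by positivity)]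
        _ = _ := by field_simp
    have k2 : |g1 r * g1 r| ≤ K ^ 2 * e * r ^ 2 := by
      rw [abs_mul]
      calc _ ≤ (K * Real.exp (α * r ^ 2) * r) * (K * Real.exp (α * r ^ 2) * r) :=
            mul_le_mul (b1 r hr) (b1 r hr) (abs_nonneg _) ((abs_nonneg _).trans (b1 r hr))
        _ = _ := by rw [he]; ring
    have k3 : |g r * g2 r| ≤ K ^ 2 * e * r ^ 2 := by
      rw [abs_mul]
      calc _ ≤ (K * Real.exp (α * r ^ 2) * r ^ 2) * (K * Real.exp (α * r ^ 2)) :=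
            mul_le_mul (b0 r hr) (b2 r hr) (abs_nonneg _) ((abs_nonneg _).trans (b0 r hr))
        _ = _ := by rw [he]; ring
    have k4 : |deriv β r * (g r * g1 r)| ≤ γ * β r * (K ^ 2 * e * r ^ 2) := by
      rw [abs_mul]
      calc _ ≤ |deriv β r| * (K ^ 2 * e * r ^ 3) :=
            mul_le_mul_of_nonneg_left (hgg1 r hr) (abs_nonneg _)
        _ = (r * |deriv β r|) * (K ^ 2 * e * r ^ 2) := by ring
        _ ≤ _ := mul_le_mul_of_nonneg_right (hβ' r hr) (by positivity)
    rw [hF', Real.norm_eq_abs, abs_mul, abs_of_nonneg (by positivity :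
      0 ≤ r ^ (d - 1) * Real.exp (-r ^ 2))]
    have k5 : |β r * (((d - 1) / r - 2 * r) * (g r * g1 r) + g1 r * g1 r + g r * g2 r)
        + deriv β r * (g r * g1 r)| ≤ β r * (K ^ 2 * e * (r ^ 2 * (1 + r ^ 2)) * (d + 3 + γ)) := by
      refine (abs_add_le _ _).trans ?_
      rw [abs_mul, abs_of_nonneg hB]
      have k6 := (abs_add_three (((d - 1) / r - 2 * r) * (g r * g1 r)) (g1 r * g1 r) (g r * g2 r))
      have k7 : K ^ 2 * e * ((d - 1) * r ^ 2 + 2 * r ^ 4) + K ^ 2 * e * r ^ 2 + K ^ 2 * e * r ^ 2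
          + γ * (K ^ 2 * e * r ^ 2) ≤ K ^ 2 * e * (r ^ 2 * (1 + r ^ 2)) * (d + 3 + γ) := by
        have : 0 ≤ K ^ 2 * e := by positivity
        have k8 : ((d - 1) * r ^ 2 + 2 * r ^ 4) + r ^ 2 + r ^ 2 + γ * r ^ 2
          ≤ (r ^ 2 * (1 + r ^ 2)) * (d + 3 + γ) := by
          have h2 : 0 ≤ r ^ 2 := by positivity
          have h4 : 0 ≤ r ^ 4 := by positivity
          nlinarith [mul_nonneg hγ h4, mul_nonneg hd1 h4]
        nlinarith
      calc _ ≤ β r * (K ^ 2 * e * ((d - 1) * r ^ 2 + 2 * r ^ 4) + K ^ 2 * e * r ^ 2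
            + K ^ 2 * e * r ^ 2) + γ * β r * (K ^ 2 * e * r ^ 2) := by
            refine add_le_add (mul_le_mul_of_nonneg_left ?_ hB) k4
            linarith
        _ = β r * (K ^ 2 * e * ((d - 1) * r ^ 2 + 2 * r ^ 4) + K ^ 2 * e * r ^ 2
            + K ^ 2 * e * r ^ 2 + γ * (K ^ 2 * e * r ^ 2)) := by ring
        _ ≤ _ := mul_le_mul_of_nonneg_left k7 hB
    calc _ ≤ r ^ (d - 1) * Real.exp (-r ^ 2)
          * (β r * (K ^ 2 * e * (r ^ 2 * (1 + r ^ 2)) * (d + 3 + γ))) := by gcongr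
      _ = K ^ 2 * (d + 3 + γ) * (r ^ (d - 1) * (r ^ 2 * (1 + r ^ 2) * (Real.exp (-r ^ 2) * e) * β r)) := by
          ring
      _ = _ := by rw [he, hexp]
  -- This replaces the vanishing of the boundary terms at `0` and `∞`. It holds because `g g₁` is of
  -- order `r³`.
  have hFint : IntegrableOn (fun r => F r / r) (Ioi 0) := by
    have hm : AEStronglyMeasurable (fun r => F r / r) (volume.restrict (Ioi 0)) := by
      refine ContinuousOn.aestronglyMeasurable (fun r (hr : 0 < r) => ?_) measurableSet_Ioi
      exact ((hdF r hr).continuousAt.div continuousAt_id hr.ne').continuousWithinAt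
    refine Integrable.mono' (Integrable.const_mul hint (K ^ 2)) hm ?_
    filter_upwards [ae_restrict_mem measurableSet_Ioi] with r (hr : 0 < r)
    have hB := hβ0 r hr
    rw [hF, Real.norm_eq_abs, abs_div, abs_mul, abs_of_nonneg (by positivity :
      0 ≤ r ^ (d - 1) * Real.exp (-r ^ 2) * β r), abs_of_pos hr, div_le_iff₀ hr]
    calc _ ≤ r ^ (d - 1) * Real.exp (-r ^ 2) * β r *
          (K ^ 2 * (Real.exp (α * r ^ 2) * Real.exp (α * r ^ 2)) * r ^ 3) :=
          mul_le_mul_of_nonneg_left (hgg1 r hr) (by positivity)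
      _ = K ^ 2 * (r ^ (d - 1) * (r ^ 2 * (Real.exp (-r ^ 2) *
          (Real.exp (α * r ^ 2) * Real.exp (α * r ^ 2))) * β r)) * r := by ring
      _ ≤ _ := by
        rw [hexp]
        gcongr
        nlinarith [sq_nonneg r]
  have h0 := integral_Ioi_deriv_eq_zero hdF hF'int hFint
  have hmono : ∫ r in Ioi 0, r ^ (d - 1) * (Real.exp (-r ^ 2) * β r *
      (g r * (g2 r + ((d - 1) / r - 2 * r) * g1 r)))
      ≤ ∫ r in Ioi 0, (F' r + γ ^ 2 / 4 * (r ^ (d - 1) * (Real.exp (-r ^ 2) * β r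
        * (g r ^ 2 / r ^ 2)))) := by
    refine setIntegral_mono_on hL (hF'int.add (Integrable.const_mul hR _)) measurableSet_Ioi
      fun r (hr : 0 < r) => ?_
    have hB := hβ0 r hr
    -- The sum is at least `β (|g₁| - (γ/2)|g|/r)²`.
    have k : 0 ≤ β r * (g1 r * g1 r) + deriv β r * (g r * g1 r)
        + γ ^ 2 / 4 * (β r * (g r ^ 2 / r ^ 2)) := by
      have k1 : -(γ * β r / r * (|g r| * |g1 r|)) ≤ deriv β r * (g r * g1 r) := by
        refine neg_le_of_abs_le ?_
        rw [abs_mul, abs_mul]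
        refine mul_le_mul_of_nonneg_right ?_ (by positivity)
        rw [le_div_iff₀ hr, mul_comm]
        exact hβ' r hr
      have k2 : 0 ≤ β r * (|g1 r| - γ / 2 * (|g r| / r)) ^ 2 := by positivity
      have k3 : β r * (|g1 r| - γ / 2 * (|g r| / r)) ^ 2 = β r * (g1 r * g1 r)
          - γ * β r / r * (|g r| * |g1 r|) + γ ^ 2 / 4 * (β r * (g r ^ 2 / r ^ 2)) := by
        rw [← sq_abs (g r), ← abs_mul_abs_self (g1 r)]
        field_simp
        ring
      linarith
    have k4 := mul_nonneg (by positivity : 0 ≤ r ^ (d - 1) * Real.exp (-r ^ 2)) k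
    rw [hF', ← sub_nonneg]
    refine k4.trans_eq ?_
    ring
  refine hmono.trans (le_of_eq ?_)
  have h3 := integral_add hF'int (Integrable.const_mul hR (γ ^ 2 / 4))
  rw [h3, h0, zero_add, integral_const_mul]

end Relative


/-! ### The relative velocity: radial and angular parts combined -/

noncomputable section RelativeIntegrated

variable {d : ℕ}

/-- Kernels `b(r, cos θ)` without angular singularity, with controlled logarithmic derivative
in `r`. -/
structure RadialKernel (d : ℕ) (γ : ℝ) (b : ℝ → ℝ → ℝ) : Prop where
  measurable : Measurable (Function.uncurry b)
  nonneg : ∀ r, 0 < r → ∀ x, 0 ≤ b r x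
  differentiable : ∀ r, 0 < r → ∀ x, DifferentiableAt ℝ (fun s => b s x) r
  deriv_le : ∀ r, 0 < r → ∀ x, r * |deriv (fun s => b s x) r| ≤ γ * b r x
  integrable : ∀ θ, 0 < θ → Integrable (fun q : ℝ × (USphere d × USphere d) =>
    q.1 ^ 2 * (1 + q.1 ^ 2) * Real.exp (-θ * q.1 ^ 2) * b q.1 (cosA q.2))
    ((radial d).prod (surf2 d))

theorem ae_fst_pos : ∀ᵐ q ∂((radial d).prod (surf2 d)), 0 < q.1 :=
  Measure.quasiMeasurePreserving_fst.ae radial_ae_pos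

namespace RadialKernel

variable {γ : ℝ} {b : ℝ → ℝ → ℝ}

theorem measurable_comp (hb : RadialKernel d γ b) :
    Measurable fun q : ℝ × (USphere d × USphere d) => b q.1 (cosA q.2) :=
  hb.measurable.comp (measurable_fst.prodMk (continuous_cosA.measurable.comp measurable_snd))

theorem integrable_of_le (hb : RadialKernel d γ b) {θ C : ℝ} (hθ : 0 < θ)
    {f : ℝ × (USphere d × USphere d) → ℝ} (hf : Measurable f)
    (h : ∀ q, 0 < q.1 →
      |f q| ≤ C * (q.1 ^ 2 * (1 + q.1 ^ 2) * Real.exp (-θ * q.1 ^ 2) * b q.1 (cosA q.2))) :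
    Integrable f ((radial d).prod (surf2 d)) :=
  ((hb.integrable θ hθ).const_mul C).mono' hf.aestronglyMeasurable (ae_fst_pos.mono h)

theorem ae_integrable (hb : RadialKernel d γ b) :
    ∀ᵐ r ∂(radial d), Integrable (fun p => b r (cosA p)) (surf2 d) := by
  filter_upwards [(hb.integrable 1 one_pos).prod_right_ae, radial_ae_pos] with r h hr
  have := h.const_mul (r ^ 2 * (1 + r ^ 2) * Real.exp (-1 * r ^ 2))⁻¹
  refine this.congr (Eventually.of_forall fun p => ?_)
  have : r ^ 2 * (1 + r ^ 2) * Real.exp (-1 * r ^ 2) ≠ 0 := by positivity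
  simp only
  rw [← mul_assoc, inv_mul_cancel₀ this, one_mul]

end RadialKernel

/-- The angular part of the dissipation. -/
theorem angular_inequality (hd : 2 ≤ d) {β : ℝ → ℝ} (hβ0 : ∀ x, 0 ≤ β x)
    (hβ : Integrable (fun p => β (cosA p)) (surf2 d)) {V : Vel d → ℝ} (hV : ContDiff ℝ 2 V)
    (he : ∀ y, V (-y) = V y) :
    ∫ p, β (cosA p) * (incr V p * incr (fun x => 1 / 2 * ∑ a, ∑ b, ang a b (ang a b V) x) p)
      ∂(surf2 d) ≤ -(2 * d * ∫ p, β (cosA p) * incr V p ^ 2 ∂(surf2 d)) := by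
  have hV1 : ContDiff ℝ 1 V := hV.of_le (by norm_num)
  have hA : ∀ a b : Fin d, ContDiff ℝ 1 (ang a b V) := fun a b =>
    contDiff_lieD _ hV (by norm_num)
  have hAA : ∀ a b : Fin d, Continuous (ang a b (ang a b V)) := fun a b =>
    continuous_lieD _ (hA a b)
  have hi : ∀ a b : Fin d, Integrable (fun p : USphere d × USphere d =>
      β (cosA p) * (incr V p * incr (ang a b (ang a b V)) p)) (surf2 d) := fun a b =>
    integrable_kernel_mul hβ ((continuous_incr hV.continuous).mul (continuous_incr (hAA a b)))
  -- Each second angular derivative gives up one factor to the other increment, by skewness of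
  -- rotation generators for the kernel form.
  have h1 : ∀ a b : Fin d, ∫ p, β (cosA p) * (incr V p * incr (ang a b (ang a b V)) p) ∂(surf2 d)
      = -∫ p, β (cosA p) * incr (ang a b V) p ^ 2 ∂(surf2 d) := by
    intro a b
    have := integral_kernel_lieD hβ (angGen a b) (angGen_mem a b) hV1 (hA a b)
    simp only [pow_two]
    linarith
  have h2 : ∀ p, β (cosA p) * (incr V p * incr (fun x => 1 / 2 * ∑ a, ∑ b, ang a b (ang a b V) x) p)
      = 1 / 2 * ∑ a, ∑ b, β (cosA p) * (incr V p * incr (ang a b (ang a b V)) p) := by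
    intro p
    simp only [incr, ← Finset.mul_sum, Finset.sum_sub_distrib]
    ring
  simp_rw [h2]
  rw [integral_const_mul, integral_finsetSum _ fun a _ => integrable_finsetSum _ fun b _ => hi a b]
  simp_rw [integral_finsetSum _ fun b _ => hi _ b, h1]
  simp only [Finset.sum_neg_distrib]
  have := kernel_poincare hd hβ0 hβ hV1 (fun σ => he σ)
  linarith

theorem hasDerivAt_dilate {U : Vel d → ℝ} (hU : ContDiff ℝ 1 U) (s : Vel d) (r : ℝ) :
    HasDerivAt (fun r : ℝ => U (r • s)) (fderiv ℝ U (r • s) s) r := by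
  have h := (hU.differentiable one_ne_zero (r • s)).hasFDerivAt.comp_hasDerivAt r
    ((hasDerivAt_id r).smul_const s)
  simpa using! h

theorem hasDerivAt_fderiv_dilate {U : Vel d → ℝ} (hU : ContDiff ℝ 2 U) (s : Vel d) (r : ℝ) :
    HasDerivAt (fun r : ℝ => fderiv ℝ U (r • s) s) (fderiv ℝ (fderiv ℝ U) (r • s) s s) r := by
  have h1 : ContDiff ℝ 1 (fderiv ℝ U) := hU.fderiv_right (by norm_num)
  have h2 : HasDerivAt (fun r : ℝ => fderiv ℝ U (r • s)) (fderiv ℝ (fderiv ℝ U) (r • s) s) r := by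
    have h := (h1.differentiable one_ne_zero (r • s)).hasFDerivAt.comp_hasDerivAt r
      ((hasDerivAt_id r).smul_const s)
    simpa using! h
  simpa using! h2.clm_apply (hasDerivAt_const r s)

/-- For a fixed centre of mass, the dissipation is controlled as soon as `γ² ≤ 8d`. -/
theorem relative_inequality (hd : 2 ≤ d) {γ α K : ℝ} {b : ℝ → ℝ → ℝ} (hγ : 0 ≤ γ)
    (hγd : γ ^ 2 ≤ 8 * d) (hb : RadialKernel d γ b) {U : Vel d → ℝ} (hU : GaussGrowth α K U)
    (he : ∀ y, U (-y) = U y) (hα0 : 0 ≤ α) (hα : 2 * α < 1) :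
    ∫ q, Real.exp (-q.1 ^ 2) * b q.1 (cosA q.2) * (incr (fun x => U (q.1 • x)) q.2
      * incr (fun x => ouOp 1 U (q.1 • x)) q.2) ∂((radial d).prod (surf2 d)) ≤ 0 := by
  have hθ : 0 < 1 - 2 * α := by linarith
  have hU1 := hU.contDiff_one
  have hK := hU.nonneg
  have hd1 : (0 : ℝ) ≤ d - 1 := by
    have : (2 : ℝ) ≤ d := by exact_mod_cast hd
    linarith
  set g : ℝ × (USphere d × USphere d) → ℝ := fun q => incr (fun x => U (q.1 • x)) q.2 with hg
  set g1 : ℝ × (USphere d × USphere d) → ℝ := fun q =>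
    fderiv ℝ U (q.1 • (q.2.2 : Vel d)) q.2.2 - fderiv ℝ U (q.1 • (q.2.1 : Vel d)) q.2.1 with hg1
  set g2 : ℝ × (USphere d × USphere d) → ℝ := fun q =>
    fderiv ℝ (fderiv ℝ U) (q.1 • (q.2.2 : Vel d)) q.2.2 q.2.2
      - fderiv ℝ (fderiv ℝ U) (q.1 • (q.2.1 : Vel d)) q.2.1 q.2.1 with hg2
  have cU := hU1.continuous
  have cU1 : Continuous (fderiv ℝ U) := hU1.continuous_fderiv one_ne_zero
  have cU2 : Continuous (fderiv ℝ (fderiv ℝ U)) :=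
    (hU.contDiff.fderiv_right (m := 1) (by norm_num)).continuous_fderiv one_ne_zero
  have mg : Measurable g := by
    refine Continuous.measurable ?_
    simp only [hg, incr]; fun_prop
  have mg1 : Measurable g1 := by
    refine Continuous.measurable ?_
    simp only [hg1]; fun_prop
  have mg2 : Measurable g2 := by
    refine Continuous.measurable ?_
    simp only [hg2]; fun_prop
  have mo : Measurable fun q : ℝ × (USphere d × USphere d) =>
      incr (fun x => ouOp 1 U (q.1 • x)) q.2 := by
    refine Continuous.measurable ?_
    have := continuous_ouOp 1 hU.contDiff
    simp only [incr]; fun_prop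
  have mb := hb.measurable_comp
  have me : Measurable fun q : ℝ × (USphere d × USphere d) => Real.exp (-q.1 ^ 2) := by fun_prop
  have mr : Measurable fun q : ℝ × (USphere d × USphere d) => (d - 1) / q.1 - 2 * q.1 := by
    fun_prop
  have hD2 : ∀ r : ℝ, ∀ y : Vel d, ‖y‖ ≤ r →
      ‖fderiv ℝ (fderiv ℝ U) y‖ ≤ K * Real.exp (α * r ^ 2) := fun r y hy =>
    (hU.fderiv2_le y).trans (by gcongr)
  have hn : ∀ r : ℝ, 0 < r → ∀ s : USphere d, ‖r • (s : Vel d)‖ = r := fun r hr s => by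
    rw [norm_smul, norm_usphere, Real.norm_of_nonneg hr.le, mul_one]
  -- Evenness of `U` gives order `r²` for the increment and order `r` for its radial derivative,
  -- enough to absorb the factors `1/r` and `1/r²` of polar coordinates.
  have b0 : ∀ q, 0 < q.1 → |g q| ≤ 2 * K * Real.exp (α * q.1 ^ 2) * q.1 ^ 2 := fun q hq => by
    have := abs_incr_dilate_le hU.contDiff he hq.le (hD2 q.1) q.2
    rwa [← mul_assoc 2 K] at this
  have b1 : ∀ q, 0 < q.1 → |g1 q| ≤ 2 * K * Real.exp (α * q.1 ^ 2) * q.1 := fun q hq => by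
    have h : ∀ s : USphere d, |fderiv ℝ U (q.1 • (s : Vel d)) s|
        ≤ K * Real.exp (α * q.1 ^ 2) * q.1 := fun s => by
      have h1 := (fderiv ℝ U (q.1 • (s : Vel d))).le_opNorm s
      rw [norm_usphere, mul_one] at h1
      have h2 := norm_fderiv_le_of_even hU.contDiff he (hD2 q.1) (hn _ hq s).le
      rw [hn _ hq s] at h2
      exact h1.trans h2
    refine (abs_sub _ _).trans ?_
    linarith [h q.2.1, h q.2.2]
  have b2 : ∀ q, 0 < q.1 → |g2 q| ≤ 2 * K * Real.exp (α * q.1 ^ 2) := fun q hq => by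
    have h : ∀ s : USphere d, |fderiv ℝ (fderiv ℝ U) (q.1 • (s : Vel d)) s s|
        ≤ K * Real.exp (α * q.1 ^ 2) := fun s => by
      have h1 := (fderiv ℝ (fderiv ℝ U) (q.1 • (s : Vel d))).le_opNorm₂ s s
      rw [norm_usphere, mul_one, mul_one] at h1
      exact h1.trans (hD2 q.1 _ (hn _ hq s).le)
    refine (abs_sub _ _).trans ?_
    linarith [h q.2.1, h q.2.2]
  have hexp : ∀ r : ℝ, Real.exp (-r ^ 2) * (Real.exp (α * r ^ 2) * Real.exp (α * r ^ 2))
      = Real.exp (-(1 - 2 * α) * r ^ 2) := fun r => by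
    rw [← Real.exp_add, ← Real.exp_add]; ring_nf
  have iR : Integrable (fun q => Real.exp (-q.1 ^ 2) * b q.1 (cosA q.2) *
      (g q * (g2 q + ((d - 1) / q.1 - 2 * q.1) * g1 q))) ((radial d).prod (surf2 d)) := by
    refine hb.integrable_of_le (C := 4 * K ^ 2 * (d + 2)) hθ
      ((me.mul mb).mul (mg.mul (mg2.add (mr.mul mg1)))) fun q hq => ?_
    have hB := hb.nonneg q.1 hq (cosA q.2)
    have h3 : |g2 q + ((d - 1) / q.1 - 2 * q.1) * g1 q|
        ≤ 2 * K * Real.exp (α * q.1 ^ 2) * (d + 2 * q.1 ^ 2) := by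
      refine (abs_add_le _ _).trans ?_
      rw [abs_mul]
      have h4 : |(d - 1) / q.1 - 2 * q.1| ≤ (d - 1) / q.1 + 2 * q.1 := by
        refine (abs_sub _ _).trans ?_
        rw [abs_of_nonneg (by positivity), abs_of_nonneg (by positivity)]
      calc _ ≤ 2 * K * Real.exp (α * q.1 ^ 2)
            + ((d - 1) / q.1 + 2 * q.1) * (2 * K * Real.exp (α * q.1 ^ 2) * q.1) :=
            add_le_add (b2 q hq) (mul_le_mul h4 (b1 q hq) (abs_nonneg _) (by positivity))
        _ = _ := by field_simp; ring
    rw [abs_mul, abs_of_nonneg (by positivity :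
      0 ≤ Real.exp (-q.1 ^ 2) * b q.1 (cosA q.2)), abs_mul]
    calc _ ≤ Real.exp (-q.1 ^ 2) * b q.1 (cosA q.2) * ((2 * K * Real.exp (α * q.1 ^ 2) * q.1 ^ 2)
          * (2 * K * Real.exp (α * q.1 ^ 2) * (d + 2 * q.1 ^ 2))) := by
          refine mul_le_mul_of_nonneg_left ?_ (by positivity)
          exact mul_le_mul (b0 q hq) h3 (abs_nonneg _) (by positivity)
      _ = 4 * K ^ 2 * (q.1 ^ 2 * (d + 2 * q.1 ^ 2) * (Real.exp (-q.1 ^ 2) *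
          (Real.exp (α * q.1 ^ 2) * Real.exp (α * q.1 ^ 2))) * b q.1 (cosA q.2)) := by ring
      _ ≤ 4 * K ^ 2 * (q.1 ^ 2 * ((d + 2) * (1 + q.1 ^ 2)) * (Real.exp (-q.1 ^ 2) *
          (Real.exp (α * q.1 ^ 2) * Real.exp (α * q.1 ^ 2))) * b q.1 (cosA q.2)) := by
          gcongr
          nlinarith [sq_nonneg q.1]
      _ = _ := by rw [hexp]; ring
  have i2 : Integrable (fun q => Real.exp (-q.1 ^ 2) * b q.1 (cosA q.2) * (g q ^ 2 / q.1 ^ 2))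
      ((radial d).prod (surf2 d)) := by
    refine hb.integrable_of_le (C := 4 * K ^ 2) hθ
      ((me.mul mb).mul ((mg.pow_const 2).div (measurable_fst.pow_const 2))) fun q hq => ?_
    have hB := hb.nonneg q.1 hq (cosA q.2)
    rw [abs_of_nonneg (by positivity)]
    calc _ ≤ Real.exp (-q.1 ^ 2) * b q.1 (cosA q.2)
          * ((2 * K * Real.exp (α * q.1 ^ 2) * q.1 ^ 2) ^ 2 / q.1 ^ 2) := by
          rw [← sq_abs (g q)]
          gcongr
          exact b0 q hq
      _ = 4 * K ^ 2 * (q.1 ^ 2 * (1 + 0) * (Real.exp (-q.1 ^ 2) *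
          (Real.exp (α * q.1 ^ 2) * Real.exp (α * q.1 ^ 2))) * b q.1 (cosA q.2)) := by
          field_simp; ring
      _ ≤ _ := by
          rw [hexp]
          gcongr
          positivity
  have iT : Integrable (fun q => Real.exp (-q.1 ^ 2) * b q.1 (cosA q.2) * (g q
      * incr (fun x => ouOp 1 U (q.1 • x)) q.2)) ((radial d).prod (surf2 d)) := by
    refine hb.integrable_of_le (C := 2 * K * (2 * (d * (1 + 2 * 1) * K)) * 2) hθ
      ((me.mul mb).mul (mg.mul mo))
      fun q hq => ?_
    have hB := hb.nonneg q.1 hq (cosA q.2)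
    have h3 : |incr (fun x => ouOp 1 U (q.1 • x)) q.2|
        ≤ 2 * (d * (1 + 2 * 1) * K) * ((1 + q.1) * Real.exp (α * q.1 ^ 2)) := by
      have h1 := hU.abs_ouOp_le zero_le_one (q.1 • (q.2.1 : Vel d))
      have h2 := hU.abs_ouOp_le zero_le_one (q.1 • (q.2.2 : Vel d))
      rw [hn _ hq] at h1 h2
      refine (abs_sub _ _).trans ?_
      linarith
    rw [abs_mul, abs_of_nonneg (by positivity :
      0 ≤ Real.exp (-q.1 ^ 2) * b q.1 (cosA q.2)), abs_mul]
    calc _ ≤ Real.exp (-q.1 ^ 2) * b q.1 (cosA q.2) * ((2 * K * Real.exp (α * q.1 ^ 2) * q.1 ^ 2)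
          * (2 * (d * (1 + 2 * 1) * K) * ((1 + q.1) * Real.exp (α * q.1 ^ 2)))) := by
          refine mul_le_mul_of_nonneg_left ?_ (by positivity)
          exact mul_le_mul (b0 q hq) h3 (abs_nonneg _) (by positivity)
      _ = 2 * K * (2 * (d * (1 + 2 * 1) * K)) * (q.1 ^ 2 * (1 + q.1) * (Real.exp (-q.1 ^ 2) *
          (Real.exp (α * q.1 ^ 2) * Real.exp (α * q.1 ^ 2))) * b q.1 (cosA q.2)) := by ring
      _ ≤ 2 * K * (2 * (d * (1 + 2 * 1) * K)) * (q.1 ^ 2 * (2 * (1 + q.1 ^ 2)) *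
          (Real.exp (-q.1 ^ 2) * (Real.exp (α * q.1 ^ 2) * Real.exp (α * q.1 ^ 2)))
          * b q.1 (cosA q.2)) := by
          gcongr
          nlinarith [sq_nonneg (q.1 - 1)]
      _ = _ := by rw [hexp]; ring
  set A : ℝ → Vel d → ℝ := fun r x =>
    1 / 2 * ∑ i, ∑ j, ang i j (ang i j fun x => U (r • x)) x with hA
  have hsplit : ∀ q : ℝ × (USphere d × USphere d), 0 < q.1 →
      incr (fun x => ouOp 1 U (q.1 • x)) q.2
        = (g2 q + ((d - 1) / q.1 - 2 * q.1) * g1 q) + 1 / q.1 ^ 2 * incr (A q.1) q.2 := by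
    intro q hq
    simp only [incr, hA, hg1, hg2]
    rw [ouOp_polar hU.contDiff hq, ouOp_polar hU.contDiff hq]
    ring
  have iA : Integrable (fun q => Real.exp (-q.1 ^ 2) * b q.1 (cosA q.2) *
      (g q * (1 / q.1 ^ 2 * incr (A q.1) q.2))) ((radial d).prod (surf2 d)) := by
    refine (iT.sub iR).congr (ae_fst_pos.mono fun q hq => ?_)
    simp only [Pi.sub_apply]
    rw [hsplit q hq]; ring
  have eT : ∫ q, Real.exp (-q.1 ^ 2) * b q.1 (cosA q.2) * (g q
      * incr (fun x => ouOp 1 U (q.1 • x)) q.2) ∂((radial d).prod (surf2 d))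
      = (∫ q, Real.exp (-q.1 ^ 2) * b q.1 (cosA q.2) *
      (g q * (g2 q + ((d - 1) / q.1 - 2 * q.1) * g1 q)) ∂((radial d).prod (surf2 d)))
      + ∫ q, Real.exp (-q.1 ^ 2) * b q.1 (cosA q.2) *
      (g q * (1 / q.1 ^ 2 * incr (A q.1) q.2)) ∂((radial d).prod (surf2 d)) := by
    rw [← integral_add iR iA]
    refine integral_congr_ae (ae_fst_pos.mono fun q hq => ?_)
    simp only
    rw [hsplit q hq]; ring
  have hRle : ∫ q, Real.exp (-q.1 ^ 2) * b q.1 (cosA q.2) *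
      (g q * (g2 q + ((d - 1) / q.1 - 2 * q.1) * g1 q)) ∂((radial d).prod (surf2 d))
      ≤ γ ^ 2 / 4 * ∫ q, Real.exp (-q.1 ^ 2) * b q.1 (cosA q.2) * (g q ^ 2 / q.1 ^ 2)
        ∂((radial d).prod (surf2 d)) := by
    -- For the radial part the pair `(k, σ)` is frozen, so `b(r, k·σ)` becomes a function of `r`
    -- alone.
    rw [integral_prod_symm _ iR, integral_prod_symm _ i2, ← integral_const_mul]
    refine integral_mono_ae iR.integral_prod_right (i2.integral_prod_right.const_mul _) ?_
    filter_upwards [iR.prod_left_ae, i2.prod_left_ae,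
      (hb.integrable (1 - 2 * α) hθ).prod_left_ae] with p hp1 hp2 hp3
    exact radial_inequality (K := 2 * K) (α := α) hd hγ (fun r hr => hb.nonneg r hr _)
      (fun r hr => hb.differentiable r hr _) (fun r hr => hb.deriv_le r hr _)
      (fun r _ => (hasDerivAt_dilate hU1 p.2 r).sub (hasDerivAt_dilate hU1 p.1 r))
      (fun r _ => (hasDerivAt_fderiv_dilate hU.contDiff p.2 r).sub
        (hasDerivAt_fderiv_dilate hU.contDiff p.1 r))
      (fun r hr => b0 (r, p) hr) (fun r hr => b1 (r, p) hr) (fun r hr => b2 (r, p) hr)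
      hp3 hp1 hp2
  have hAle : ∫ q, Real.exp (-q.1 ^ 2) * b q.1 (cosA q.2) *
      (g q * (1 / q.1 ^ 2 * incr (A q.1) q.2)) ∂((radial d).prod (surf2 d))
      ≤ -(2 * d) * ∫ q, Real.exp (-q.1 ^ 2) * b q.1 (cosA q.2) * (g q ^ 2 / q.1 ^ 2)
        ∂((radial d).prod (surf2 d)) := by
    -- For the angular part the radius is frozen, so the kernel is a function of the angle,
    -- integrable for almost every `r`.
    rw [integral_prod _ iA, integral_prod _ i2, ← integral_const_mul]
    refine integral_mono_ae iA.integral_prod_left (i2.integral_prod_left.const_mul _) ?_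
    filter_upwards [hb.ae_integrable, radial_ae_pos] with r hr hr0
    have h1 := angular_inequality hd (hb.nonneg r hr0) hr (contDiff_dilate hU.contDiff r)
      (fun y => by rw [smul_neg, he])
    have e1 : ∫ p, Real.exp (-r ^ 2) * b r (cosA p) * (g (r, p) * (1 / r ^ 2 * incr (A r) p))
        ∂(surf2 d) = Real.exp (-r ^ 2) / r ^ 2 *
          ∫ p, b r (cosA p) * (incr (fun x => U (r • x)) p * incr (A r) p) ∂(surf2 d) := by
      rw [← integral_const_mul]
      exact integral_congr_ae (Eventually.of_forall fun p => by simp only [hg]; ring)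
    have e2 : ∫ p, Real.exp (-r ^ 2) * b r (cosA p) * (g (r, p) ^ 2 / r ^ 2)
        ∂(surf2 d) = Real.exp (-r ^ 2) / r ^ 2 *
          ∫ p, b r (cosA p) * incr (fun x => U (r • x)) p ^ 2 ∂(surf2 d) := by
      rw [← integral_const_mul]
      exact integral_congr_ae (Eventually.of_forall fun p => by simp only [hg]; ring)
    rw [e1, e2]
    have := mul_le_mul_of_nonneg_left h1 (by positivity : 0 ≤ Real.exp (-r ^ 2) / r ^ 2)
    refine this.trans (le_of_eq ?_)
    ring
  have h2 : 0 ≤ ∫ q, Real.exp (-q.1 ^ 2) * b q.1 (cosA q.2) * (g q ^ 2 / q.1 ^ 2)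
      ∂((radial d).prod (surf2 d)) :=
    integral_nonneg_of_ae (ae_fst_pos.mono fun q hq => by
      have := hb.nonneg q.1 hq (cosA q.2)
      simp only [Pi.zero_apply]
      positivity)
  rw [eT]
  -- The total is at most `(γ²/4 - 2d)` times a nonnegative integral; this is where `γ² ≤ 8d` is
  -- used.
  nlinarith

end RelativeIntegrated


/-! ### The dissipation inequality -/

noncomputable section Dissipation

variable {d : ℕ} {γ : ℝ} {b : ℝ → ℝ → ℝ}

/-- The measure `dc ⊗ r^{d-1} dr ⊗ dk ⊗ dσ` of centre of mass and relative velocities. -/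
def collisionMeasure (d : ℕ) : Measure (Vel d × (ℝ × (USphere d × USphere d))) :=
  (volume : Measure (Vel d)).prod ((radial d).prod (surf2 d))

theorem ae_radius_pos : ∀ᵐ q ∂(collisionMeasure d), 0 < q.2.1 :=
  Measure.quasiMeasurePreserving_snd.ae ae_fst_pos

theorem RadialKernel.integrable_collision_of_le (hb : RadialKernel d γ b) {θ C : ℝ} (hθ : 0 < θ)
    {f : Vel d × (ℝ × (USphere d × USphere d)) → ℝ} (hf : Measurable f)
    (h : ∀ q, 0 < q.2.1 → |f q| ≤ C * (((1 + ‖q.1‖) * Real.exp (-θ * ‖q.1‖ ^ 2)) *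
      (q.2.1 ^ 2 * (1 + q.2.1 ^ 2) * Real.exp (-θ * q.2.1 ^ 2) * b q.2.1 (cosA q.2.2)))) :
    Integrable f (collisionMeasure d) :=
  ((((integrable_one_add_norm_mul_exp hθ).mul_prod (hb.integrable θ hθ)).const_mul C)).mono'
    hf.aestronglyMeasurable (ae_radius_pos.mono h)

theorem ouOp_symm2_left {h : Vel d → ℝ} (hh : ContDiff ℝ 2 h) (c y : Vel d) :
    ouOp 1 (fun c => symm2 h c y) c = ∑ i, (pd i (pd i h) (c + y) + pd i (pd i h) (c - y)
      - 2 * 1 * c i * (pd i h (c + y) + pd i h (c - y))) := by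
  simp only [ouOp, pd_pd_symm2_left hh, pd_symm2_left (hh.of_le (by norm_num) : ContDiff ℝ 1 h)]

theorem ouOp_symm2_right {h : Vel d → ℝ} (hh : ContDiff ℝ 2 h) (c y : Vel d) :
    ouOp 1 (symm2 h c) y = ∑ i, (pd i (pd i h) (c + y) + pd i (pd i h) (c - y)
      - 2 * 1 * y i * (pd i h (c + y) - pd i h (c - y))) := by
  simp only [ouOp, pd_pd_symm2_right hh, pd_symm2_right (hh.of_le (by norm_num) : ContDiff ℝ 1 h)]

/-- The generator splits into a centre of mass part and a relative part. -/
theorem symm2_ouOp {h : Vel d → ℝ} (hh : ContDiff ℝ 2 h) (c y : Vel d) :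
    symm2 (ouOp (1 / 2) h) c y
      = 1 / 2 * ouOp 1 (fun c => symm2 h c y) c + 1 / 2 * ouOp 1 (symm2 h c) y := by
  rw [ouOp_symm2_left hh, ouOp_symm2_right hh, symm2, ouOp, ouOp, ← mul_add,
    ← Finset.sum_add_distrib, ← Finset.sum_add_distrib, Finset.mul_sum]
  refine Finset.sum_congr rfl fun i _ => ?_
  simp only [PiLp.add_apply, PiLp.sub_apply]
  ring

theorem ouOp_sub (s : ℝ) {f g : Vel d → ℝ} (hf : ContDiff ℝ 2 f) (hg : ContDiff ℝ 2 g) (v : Vel d) :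
    ouOp s (fun v => f v - g v) v = ouOp s f v - ouOp s g v := by
  have h1 : ContDiff ℝ 1 f := hf.of_le (by norm_num)
  have h2 : ContDiff ℝ 1 g := hg.of_le (by norm_num)
  have e : ∀ i : Fin d, pd i (fun v => f v - g v) = fun v => pd i f v - pd i g v := fun i =>
    funext fun v => pd_sub (h1.differentiable one_ne_zero v) (h2.differentiable one_ne_zero v) i
  rw [ouOp, ouOp, ouOp, ← Finset.sum_sub_distrib]
  refine Finset.sum_congr rfl fun i _ => ?_
  rw [e, pd_sub ((contDiff_pd (m := 1) hf (by norm_num) i).differentiable one_ne_zero v)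
    ((contDiff_pd (m := 1) hg (by norm_num) i).differentiable one_ne_zero v)]
  ring

/-- For fixed relative velocities the dissipation has a sign. -/
theorem integral_mul_ouOp_nonpos {a C : ℝ} {f : Vel d → ℝ} (hf : GaussGrowth a C f)
    (ha : 2 * a < 1) : ∫ v, Real.exp (-‖v‖ ^ 2) * (f v * ouOp 1 f v) ≤ 0 := by
  have h := (integral_gauss_by_parts ha hf hf).2.2
  simp only [neg_mul, one_mul] at h
  rw [h, neg_nonpos]
  exact integral_nonneg fun v => mul_nonneg (Real.exp_pos _).le
    (Finset.sum_nonneg fun i _ => mul_self_nonneg _)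

theorem norm_smul_usphere {r : ℝ} (hr : 0 < r) (s : USphere d) : ‖r • (s : Vel d)‖ = r := by
  rw [norm_smul, norm_usphere, Real.norm_of_nonneg hr.le, mul_one]

section

variable {a C : ℝ} {h : Vel d → ℝ}

theorem GaussGrowth.abs_incr_symm2_le (hh : GaussGrowth a C h) (ha : 0 ≤ a) (c : Vel d) {r : ℝ}
    (hr : 0 < r) (p : USphere d × USphere d) :
    |incr (fun x => symm2 h c (r • x)) p|
      ≤ 4 * C * (Real.exp (2 * a * ‖c‖ ^ 2) * Real.exp (2 * a * r ^ 2)) * r ^ 2 := by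
  have hC := hh.nonneg
  have hU := hh.symm2_right ha c
  have := abs_incr_dilate_le hU.contDiff (symm2_neg h c) hr.le
    (K := 2 * (C * Real.exp (2 * a * ‖c‖ ^ 2)) * Real.exp (2 * a * r ^ 2))
    (fun y hy => (hU.fderiv2_le y).trans (by gcongr)) p
  refine this.trans (le_of_eq ?_)
  ring

theorem continuous_incr_symm2 (hh : Continuous h) :
    Continuous fun q : Vel d × (ℝ × (USphere d × USphere d)) =>
      incr (fun x => symm2 h q.1 (q.2.1 • x)) q.2.2 := by
  simp only [incr, symm2]
  fun_prop

/-- Both factors grow like `e^{2a n²} e^{2a r²}`, which leaves the Gaussian exponent `1 - 4a` in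
each variable. The factor `r²` of `G` supplies the weight required by the kernel, and the constant
`2` comes from `1 + r ≤ 2(1 + r²)`. -/
theorem dissipation_weight_bound {θ a K r x B G P : ℝ} (hθ : θ = 1 - 4 * a) (hB : 0 ≤ B)
    {n : ℝ} (hn : 0 ≤ n) (hr : 0 < r) (hK : 0 ≤ K)
    (hG : |G| ≤ K * (Real.exp (2 * a * n ^ 2) * Real.exp (2 * a * r ^ 2)) * r ^ 2)
    (hP : |P| ≤ x * ((1 + n) * (1 + r) * (Real.exp (2 * a * n ^ 2) * Real.exp (2 * a * r ^ 2)))) :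
    |Real.exp (-n ^ 2) * (Real.exp (-r ^ 2) * B * (G * P))| ≤ 2 * (K * x) *
      (((1 + n) * Real.exp (-θ * n ^ 2)) * (r ^ 2 * (1 + r ^ 2) * Real.exp (-θ * r ^ 2) * B)) := by
  have hx : 0 ≤ x := by
    by_contra hx
    push Not at hx
    have := (abs_nonneg P).trans hP
    have h2 : 0 < (1 + n) * (1 + r) * (Real.exp (2 * a * n ^ 2) * Real.exp (2 * a * r ^ 2)) := by
      positivity
    nlinarith
  have hexp : ∀ t : ℝ, Real.exp (-t ^ 2) * (Real.exp (2 * a * t ^ 2) * Real.exp (2 * a * t ^ 2))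
      = Real.exp (-θ * t ^ 2) := fun t => by
    rw [← Real.exp_add, ← Real.exp_add, hθ]; ring_nf
  rw [abs_mul, abs_mul, abs_mul G, abs_of_pos (Real.exp_pos _),
    abs_of_nonneg (by positivity : 0 ≤ Real.exp (-r ^ 2) * B)]
  calc _ ≤ Real.exp (-n ^ 2) * (Real.exp (-r ^ 2) * B *
        ((K * (Real.exp (2 * a * n ^ 2) * Real.exp (2 * a * r ^ 2)) * r ^ 2) *
        (x * ((1 + n) * (1 + r) * (Real.exp (2 * a * n ^ 2) * Real.exp (2 * a * r ^ 2)))))) := by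
        refine mul_le_mul_of_nonneg_left (mul_le_mul_of_nonneg_left ?_ (by positivity))
          (by positivity)
        exact mul_le_mul hG hP (abs_nonneg _) (by positivity)
    _ = K * x * (((1 + n) * (Real.exp (-n ^ 2) *
          (Real.exp (2 * a * n ^ 2) * Real.exp (2 * a * n ^ 2)))) * (r ^ 2 * (1 + r) *
          (Real.exp (-r ^ 2) * (Real.exp (2 * a * r ^ 2) * Real.exp (2 * a * r ^ 2))) * B)) := by
        ring
    _ ≤ K * x * (((1 + n) * (Real.exp (-n ^ 2) *
          (Real.exp (2 * a * n ^ 2) * Real.exp (2 * a * n ^ 2)))) * (r ^ 2 * (2 * (1 + r ^ 2)) *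
          (Real.exp (-r ^ 2) * (Real.exp (2 * a * r ^ 2) * Real.exp (2 * a * r ^ 2))) * B)) := by
        gcongr
        nlinarith [sq_nonneg (r - 1)]
    _ = _ := by rw [hexp, hexp]; ring

/-- The dissipation of the Dirichlet form, in centre of mass and relative velocities. -/
theorem dissipation_nonpos (hd : 2 ≤ d) (hγ : 0 ≤ γ) (hγd : γ ^ 2 ≤ 8 * d)
    (hb : RadialKernel d γ b) (hh : GaussGrowth a C h) (ha0 : 0 ≤ a) (ha : 4 * a < 1) :
    ∫ q, Real.exp (-‖q.1‖ ^ 2) * (Real.exp (-q.2.1 ^ 2) * b q.2.1 (cosA q.2.2)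
      * (incr (fun x => symm2 h q.1 (q.2.1 • x)) q.2.2
        * incr (fun x => symm2 (ouOp (1 / 2) h) q.1 (q.2.1 • x)) q.2.2)) ∂(collisionMeasure d)
      ≤ 0 := by
  have hC := hh.nonneg
  have hc2 := hh.contDiff
  have hc1 := hh.contDiff_one
  have hcp : ∀ i : Fin d, Continuous (pd i h) := fun i => continuous_pd hc1 i
  have hcpp : ∀ i : Fin d, Continuous (pd i (pd i h)) := fun i =>
    continuous_pd (contDiff_pd (m := 1) hc2 (by norm_num) i) i
  set G : Vel d × (ℝ × (USphere d × USphere d)) → ℝ := fun q =>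
    incr (fun x => symm2 h q.1 (q.2.1 • x)) q.2.2 with hG
  set P : Vel d × (ℝ × (USphere d × USphere d)) → ℝ := fun q =>
    incr (fun x => ouOp 1 (fun c => symm2 h c (q.2.1 • x)) q.1) q.2.2 with hP
  set Q : Vel d × (ℝ × (USphere d × USphere d)) → ℝ := fun q =>
    incr (fun x => ouOp 1 (symm2 h q.1) (q.2.1 • x)) q.2.2 with hQ
  have mG : Measurable G := (continuous_incr_symm2 hc2.continuous).measurable
  have mP : Measurable P := by
    refine Continuous.measurable ?_
    simp only [hP, incr, ouOp_symm2_left hc2]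
    fun_prop
  have mQ : Measurable Q := by
    refine Continuous.measurable ?_
    simp only [hQ, incr, ouOp_symm2_right hc2]
    fun_prop
  have mb : Measurable fun q : Vel d × (ℝ × (USphere d × USphere d)) => b q.2.1 (cosA q.2.2) :=
    hb.measurable_comp.comp measurable_snd
  have m1 : Measurable fun q : Vel d × (ℝ × (USphere d × USphere d)) =>
    Real.exp (-‖q.1‖ ^ 2) := by fun_prop
  have m2 : Measurable fun q : Vel d × (ℝ × (USphere d × USphere d)) =>
    Real.exp (-q.2.1 ^ 2) := by fun_prop
  have bP : ∀ q, 0 < q.2.1 → |P q| ≤ 2 * (d * 3 * (2 * C)) * ((1 + ‖q.1‖) * (1 + q.2.1) *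
      (Real.exp (2 * a * ‖q.1‖ ^ 2) * Real.exp (2 * a * q.2.1 ^ 2))) := by
    intro q hq
    have key : ∀ s : USphere d, |ouOp 1 (fun c => symm2 h c (q.2.1 • (s : Vel d))) q.1|
        ≤ (d * 3 * (2 * C)) * ((1 + ‖q.1‖) * (1 + q.2.1) *
      (Real.exp (2 * a * ‖q.1‖ ^ 2) * Real.exp (2 * a * q.2.1 ^ 2))) := by
      intro s
      have := (hh.symm2_left ha0 (q.2.1 • (s : Vel d))).abs_ouOp_le zero_le_one q.1
      rw [norm_smul_usphere hq] at this
      refine this.trans ?_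
      calc _ = (d * 3 * (2 * C)) * ((1 + ‖q.1‖) * (1 + 0) *
            (Real.exp (2 * a * ‖q.1‖ ^ 2) * Real.exp (2 * a * q.2.1 ^ 2))) := by ring
        _ ≤ _ := by gcongr
    refine (abs_sub _ _).trans ?_
    linarith [key q.2.2.1, key q.2.2.2]
  have bQ : ∀ q, 0 < q.2.1 → |Q q| ≤ 2 * (d * 3 * (2 * C)) * ((1 + ‖q.1‖) * (1 + q.2.1) *
      (Real.exp (2 * a * ‖q.1‖ ^ 2) * Real.exp (2 * a * q.2.1 ^ 2))) := by
    intro q hq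
    have key : ∀ s : USphere d, |ouOp 1 (symm2 h q.1) (q.2.1 • (s : Vel d))|
        ≤ (d * 3 * (2 * C)) * ((1 + ‖q.1‖) * (1 + q.2.1) *
      (Real.exp (2 * a * ‖q.1‖ ^ 2) * Real.exp (2 * a * q.2.1 ^ 2))) := by
      intro s
      have := (hh.symm2_right ha0 q.1).abs_ouOp_le zero_le_one (q.2.1 • (s : Vel d))
      rw [norm_smul_usphere hq] at this
      refine this.trans ?_
      calc _ = (d * 3 * (2 * C)) * ((1 + 0) * (1 + q.2.1) *
            (Real.exp (2 * a * ‖q.1‖ ^ 2) * Real.exp (2 * a * q.2.1 ^ 2))) := by ring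
        _ ≤ _ := by gcongr; positivity
    refine (abs_sub _ _).trans ?_
    linarith [key q.2.2.1, key q.2.2.2]
  have iP : Integrable (fun q => Real.exp (-‖q.1‖ ^ 2) * (Real.exp (-q.2.1 ^ 2) *
      b q.2.1 (cosA q.2.2) * (G q * P q))) (collisionMeasure d) :=
    hb.integrable_collision_of_le (by linarith : 0 < 1 - 4 * a)
      (m1.mul ((m2.mul mb).mul (mG.mul mP))) fun q hq =>
      dissipation_weight_bound rfl (hb.nonneg _ hq _) (norm_nonneg _) hq (by positivity)
        (hh.abs_incr_symm2_le ha0 q.1 hq q.2.2) (bP q hq)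
  have iQ : Integrable (fun q => Real.exp (-‖q.1‖ ^ 2) * (Real.exp (-q.2.1 ^ 2) *
      b q.2.1 (cosA q.2.2) * (G q * Q q))) (collisionMeasure d) :=
    hb.integrable_collision_of_le (by linarith : 0 < 1 - 4 * a)
      (m1.mul ((m2.mul mb).mul (mG.mul mQ))) fun q hq =>
      dissipation_weight_bound rfl (hb.nonneg _ hq _) (norm_nonneg _) hq (by positivity)
        (hh.abs_incr_symm2_le ha0 q.1 hq q.2.2) (bQ q hq)
  -- The kernel does not depend on the centre of mass, so for fixed `(r, k, σ)` integration by parts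
  -- in `c` gives minus the integral of a squared gradient.
  have nP : ∫ q, Real.exp (-‖q.1‖ ^ 2) * (Real.exp (-q.2.1 ^ 2) *
      b q.2.1 (cosA q.2.2) * (G q * P q)) ∂(collisionMeasure d) ≤ 0 := by
    rw [collisionMeasure, integral_prod_symm _ iP]
    refine integral_nonpos_of_ae ?_
    filter_upwards [ae_fst_pos] with q hq
    have hg := (hh.symm2_left ha0 (q.1 • (q.2.2 : Vel d))).sub
      (hh.symm2_left ha0 (q.1 • (q.2.1 : Vel d)))
    have h1 := integral_mul_ouOp_nonpos hg (by linarith)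
    have e : ∀ c, Real.exp (-‖c‖ ^ 2) * (Real.exp (-q.1 ^ 2) * b q.1 (cosA q.2)
        * (G (c, q) * P (c, q))) = (Real.exp (-q.1 ^ 2) * b q.1 (cosA q.2)) *
        (Real.exp (-‖c‖ ^ 2) * ((symm2 h c (q.1 • (q.2.2 : Vel d))
          - symm2 h c (q.1 • (q.2.1 : Vel d))) * ouOp 1 (fun c => symm2 h c (q.1 • (q.2.2 : Vel d))
          - symm2 h c (q.1 • (q.2.1 : Vel d))) c)) := by
      intro c
      rw [ouOp_sub 1 (hh.symm2_left ha0 _).contDiff (hh.symm2_left ha0 _).contDiff]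
      simp only [hG, hP, incr]
      ring
    simp only [e]
    rw [integral_const_mul]
    exact mul_nonpos_of_nonneg_of_nonpos
      (mul_nonneg (Real.exp_pos _).le (hb.nonneg _ hq _)) h1
  -- For fixed `c` this is the relative inequality applied to the even function `symm2 h c`.
  have nQ : ∫ q, Real.exp (-‖q.1‖ ^ 2) * (Real.exp (-q.2.1 ^ 2) *
      b q.2.1 (cosA q.2.2) * (G q * Q q)) ∂(collisionMeasure d) ≤ 0 := by
    rw [collisionMeasure, integral_prod _ iQ]
    refine integral_nonpos fun c => ?_
    simp only
    rw [integral_const_mul]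
    refine mul_nonpos_of_nonneg_of_nonpos (Real.exp_pos _).le ?_
    exact relative_inequality hd hγ hγd hb (hh.symm2_right ha0 c) (symm2_neg h c) (by linarith)
      (by linarith)
  have e : ∀ q, Real.exp (-‖q.1‖ ^ 2) * (Real.exp (-q.2.1 ^ 2) * b q.2.1 (cosA q.2.2)
      * (incr (fun x => symm2 h q.1 (q.2.1 • x)) q.2.2
        * incr (fun x => symm2 (ouOp (1 / 2) h) q.1 (q.2.1 • x)) q.2.2))
      = 1 / 2 * (Real.exp (-‖q.1‖ ^ 2) * (Real.exp (-q.2.1 ^ 2) *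
      b q.2.1 (cosA q.2.2) * (G q * P q))) + 1 / 2 * (Real.exp (-‖q.1‖ ^ 2) *
      (Real.exp (-q.2.1 ^ 2) * b q.2.1 (cosA q.2.2) * (G q * Q q))) := by
    intro q
    simp only [hG, hP, hQ, incr, symm2_ouOp hc2]
    ring
  simp only [hG, e]
  simp only [e] at *
  rw [integral_add (iP.const_mul _) (iQ.const_mul _), integral_const_mul, integral_const_mul]
  linarith

theorem integral_comp_of_measurePreserving {X Y : Type*} [MeasurableSpace X] [MeasurableSpace Y]
    {μ : Measure X} {ν : Measure Y} {T : X → Y} (hT : MeasurePreserving T μ ν) {f : Y → ℝ}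
    (hf : AEStronglyMeasurable f ν) : ∫ x, f (T x) ∂μ = ∫ y, f y ∂ν := by
  rw [← hT.map_eq, integral_map hT.measurable.aemeasurable (by rwa [hT.map_eq])]

theorem integrable_comp_of_measurePreserving {X Y : Type*} [MeasurableSpace X] [MeasurableSpace Y]
    {μ : Measure X} {ν : Measure Y} {T : X → Y} (hT : MeasurePreserving T μ ν) {f : Y → ℝ}
    (hf : Integrable f ν) : Integrable (fun x => f (T x)) μ :=
  hT.integrable_comp_of_integrable hf

/-- The weighted product of the collision difference with the generator. -/
def collisionDensity (b : ℝ → ℝ → ℝ) (h : Vel d → ℝ)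
    (q : Vel d × (ℝ × (USphere d × USphere d))) : ℝ :=
  Real.exp (-‖q.1‖ ^ 2) * (Real.exp (-q.2.1 ^ 2) * b q.2.1 (cosA q.2.2)
      * (incr (fun x => symm2 h q.1 (q.2.1 • x)) q.2.2
        * ouOp (1 / 2) h (q.1 + q.2.1 • (q.2.2.1 : Vel d))))

theorem integrable_collisionDensity (hb : RadialKernel d γ b) (hh : GaussGrowth a C h)
    (ha0 : 0 ≤ a) (ha : 4 * a < 1) : Integrable (collisionDensity b h) (collisionMeasure d) := by
  have hC := hh.nonneg
  have mG := (continuous_incr_symm2 hh.contDiff.continuous).measurable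
  have mo : Measurable fun q : Vel d × (ℝ × (USphere d × USphere d)) =>
      ouOp (1 / 2) h (q.1 + q.2.1 • (q.2.2.1 : Vel d)) := by
    have := continuous_ouOp (1 / 2) hh.contDiff
    refine Continuous.measurable ?_
    fun_prop
  have mb : Measurable fun q : Vel d × (ℝ × (USphere d × USphere d)) => b q.2.1 (cosA q.2.2) :=
    hb.measurable_comp.comp measurable_snd
  have m1 : Measurable fun q : Vel d × (ℝ × (USphere d × USphere d)) =>
    Real.exp (-‖q.1‖ ^ 2) := by fun_prop
  have m2 : Measurable fun q : Vel d × (ℝ × (USphere d × USphere d)) =>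
    Real.exp (-q.2.1 ^ 2) := by fun_prop
  refine hb.integrable_collision_of_le (by linarith : 0 < 1 - 4 * a)
    (m1.mul ((m2.mul mb).mul (mG.mul mo))) fun q hq =>
    dissipation_weight_bound rfl (hb.nonneg _ hq _) (norm_nonneg _) hq (by positivity)
        (hh.abs_incr_symm2_le ha0 q.1 hq q.2.2) (x := d * 2 * C) ?_
  have h1 := hh.abs_ouOp_le (by norm_num : (0 : ℝ) ≤ 1 / 2) (q.1 + q.2.1 • (q.2.2.1 : Vel d))
  have h2 := norm_add_le q.1 (q.2.1 • (q.2.2.1 : Vel d))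
  rw [norm_smul_usphere hq] at h2
  have h3 : ‖q.1 + q.2.1 • (q.2.2.1 : Vel d)‖ ^ 2 ≤ 2 * ‖q.1‖ ^ 2 + 2 * q.2.1 ^ 2 := by
    nlinarith [norm_nonneg (q.1 + q.2.1 • (q.2.2.1 : Vel d)), sq_nonneg (‖q.1‖ - q.2.1)]
  refine h1.trans ?_
  rw [← Real.exp_add]
  have h4 : (0 : ℝ) ≤ 1 + 2 * (1 / 2) := by norm_num
  calc _ ≤ d * (1 + 2 * (1 / 2)) * C * ((1 + ‖q.1‖) * (1 + q.2.1) *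
        Real.exp (2 * a * ‖q.1‖ ^ 2 + 2 * a * q.2.1 ^ 2)) := by
        gcongr
        · nlinarith [mul_nonneg (norm_nonneg q.1) hq.le]
        · nlinarith
    _ = _ := by norm_num

/-- The maps `(k, σ) ↦ (-k, -σ)` and `(k, σ) ↦ (σ, k)` preserve the measure and the angle. They move
the argument of the generator through `c ± rk` and `c ± rσ`, and the swap reverses the sign of the
increment. The four images add up to minus the dissipation integrand, so four times the integral is
nonnegative. -/
theorem integral_collisionDensity_nonneg (hd : 2 ≤ d) (hγ : 0 ≤ γ) (hγd : γ ^ 2 ≤ 8 * d)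
    (hb : RadialKernel d γ b) (hh : GaussGrowth a C h) (ha0 : 0 ≤ a) (ha : 4 * a < 1) :
    0 ≤ ∫ q, collisionDensity b h q ∂(collisionMeasure d) := by
  have hi := integrable_collisionDensity hb hh ha0 ha
  set N : USphere d × USphere d → USphere d × USphere d :=
    Prod.map (sphereMap (LinearIsometryEquiv.neg ℝ)) (sphereMap (LinearIsometryEquiv.neg ℝ)) with hN
  have T : ∀ {F : USphere d × USphere d → USphere d × USphere d},
      MeasurePreserving F (surf2 d) (surf2 d) →
      MeasurePreserving (fun q : Vel d × (ℝ × (USphere d × USphere d)) => (q.1, (q.2.1, F q.2.2)))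
      (collisionMeasure d) (collisionMeasure d) := fun hF =>
    (MeasurePreserving.id _).prod ((MeasurePreserving.id _).prod hF)
  have hNm := measurePreserving_sphereMap_prod (d := d) (LinearIsometryEquiv.neg ℝ)
  have hSm : MeasurePreserving Prod.swap (surf2 d) (surf2 d) := Measure.measurePreserving_swap
  have i1 := integrable_comp_of_measurePreserving (T hNm) hi
  have i2 := integrable_comp_of_measurePreserving (T hSm) hi
  have i3 := integrable_comp_of_measurePreserving (T (hNm.comp hSm)) hi
  have e1 := integral_comp_of_measurePreserving (T hNm) hi.aestronglyMeasurable
  have e2 := integral_comp_of_measurePreserving (T hSm) hi.aestronglyMeasurable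
  have e3 := integral_comp_of_measurePreserving (T (hNm.comp hSm)) hi.aestronglyMeasurable
  have h0 := dissipation_nonpos hd hγ hγd hb hh ha0 ha
  have key : ∀ q : Vel d × (ℝ × (USphere d × USphere d)),
      Real.exp (-‖q.1‖ ^ 2) * (Real.exp (-q.2.1 ^ 2) * b q.2.1 (cosA q.2.2)
      * (incr (fun x => symm2 h q.1 (q.2.1 • x)) q.2.2
        * incr (fun x => symm2 (ouOp (1 / 2) h) q.1 (q.2.1 • x)) q.2.2))
      = -((collisionDensity b h q + collisionDensity b h (q.1, (q.2.1, N q.2.2)))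
        + (collisionDensity b h (q.1, (q.2.1, Prod.swap q.2.2))
          + collisionDensity b h (q.1, (q.2.1, (N ∘ Prod.swap) q.2.2)))) := by
    intro q
    have c1 : cosA (N q.2.2) = cosA q.2.2 := by simp [cosA, hN]
    have c2 : cosA (Prod.swap q.2.2) = cosA q.2.2 := by simp [cosA, real_inner_comm]
    have c3 : cosA (N (Prod.swap q.2.2)) = cosA q.2.2 := by simp [cosA, hN, real_inner_comm]
    simp only [collisionDensity, Function.comp_apply, c1, c2, c3]
    simp only [incr, hN, Prod.map_fst, Prod.map_snd, coe_sphereMap, Prod.fst_swap, Prod.snd_swap,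
      LinearIsometryEquiv.coe_neg, smul_neg, symm2_neg]
    simp only [symm2, ← sub_eq_add_neg]
    ring
  simp only [key] at h0
  rw [integral_neg] at h0
  have e4 := integral_add (hi.add i1) (i2.add i3)
  have e5 := integral_add hi i1
  have e6 := integral_add i2 i3
  simp only [Pi.add_apply] at e4 e5 e6
  rw [e4, e5, e6, e1, e2, e3] at h0
  linarith

end

end Dissipation


/-! ### Collision kernels -/

noncomputable section Kernel

variable {d : ℕ} {B : ℝ → ℝ → ℝ} {γ : ℝ}

/-- The kernel with its values outside `-1 < cos θ < 1` replaced by zero. -/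
def openKernel (B : ℝ → ℝ → ℝ) (r : ℝ) : ℝ → ℝ := (Ioo (-1 : ℝ) 1).indicator (B r)

theorem openKernel_of_mem {x : ℝ} (hx : x ∈ Ioo (-1 : ℝ) 1) (r : ℝ) : openKernel B r x = B r x :=
  indicator_of_mem hx _

theorem openKernel_of_notMem {x : ℝ} (hx : x ∉ Ioo (-1 : ℝ) 1) (r : ℝ) : openKernel B r x = 0 :=
  indicator_of_notMem hx _

theorem dir_smul_usphere {r : ℝ} (hr : 0 < r) (k : USphere d) : dir (r • (k : Vel d)) = k := by
  rw [dir, norm_smul_usphere hr, smul_smul, inv_mul_cancel₀ hr.ne', one_smul]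

theorem norm_dir {z : Vel d} (hz : z ≠ 0) : ‖dir z‖ = 1 := by
  rw [dir, norm_smul, norm_inv, norm_norm, inv_mul_cancel₀ (norm_ne_zero_iff.2 hz)]

namespace IsCollisionKernel

theorem measurable_openKernel (hB : IsCollisionKernel d B) :
    Measurable (Function.uncurry (openKernel B)) := by
  have : Function.uncurry (openKernel B)
      = {p : ℝ × ℝ | p.2 ∈ Ioo (-1 : ℝ) 1}.indicator (Function.uncurry B) := by
    ext ⟨r, x⟩
    by_cases hx : x ∈ Ioo (-1 : ℝ) 1
    · rw [indicator_of_mem (by exact hx)]; exact openKernel_of_mem hx r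
    · rw [indicator_of_notMem (by exact hx)]; exact openKernel_of_notMem hx r
  rw [this]
  exact hB.measurable.indicator (measurable_snd measurableSet_Ioo)

theorem openKernel_nonneg (hB : IsCollisionKernel d B) {r : ℝ} (hr : 0 < r) (x : ℝ) :
    0 ≤ openKernel B r x :=
  indicator_nonneg (fun x hx => hB.nonneg r hr x hx) x

theorem openKernel_differentiableAt (hB : IsCollisionKernel d B) {r : ℝ} (hr : 0 < r) (x : ℝ) :
    DifferentiableAt ℝ (fun s => openKernel B s x) r := by
  by_cases hx : x ∈ Ioo (-1 : ℝ) 1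
  · simpa only [openKernel_of_mem hx] using hB.differentiable r hr x hx
  · simp only [openKernel_of_notMem hx]; fun_prop

/-- The product form needs no positivity of `B`: the convention `c / 0 = ∞` forces the derivative to
vanish wherever `B` does. -/
theorem openKernel_deriv_le (hB : IsCollisionKernel d B) (hγ : gammaBar B ≤ ENNReal.ofReal γ)
    (hγ0 : 0 ≤ γ) {r : ℝ} (hr : 0 < r) (x : ℝ) :
    r * |deriv (fun s => openKernel B s x) r| ≤ γ * openKernel B r x := by
  by_cases hx : x ∈ Ioo (-1 : ℝ) 1
  · simp only [openKernel_of_mem hx]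
    have h1 : ENNReal.ofReal (r * |deriv (fun s => B s x) r|) / ENNReal.ofReal (B r x)
        ≤ ENNReal.ofReal γ :=
      (le_iSup₂ (f := fun x (_ : x ∈ Ioo (-1 : ℝ) 1) =>
        ENNReal.ofReal (r * |deriv (fun s => B s x) r|) / ENNReal.ofReal (B r x)) x hx).trans
        ((le_iSup₂ (f := fun r (_ : r ∈ Ioi (0 : ℝ)) => gammaBarAt B r) r hr).trans hγ)
    rw [ENNReal.div_le_iff_le_mul (Or.inr ENNReal.ofReal_ne_top) (Or.inl ENNReal.ofReal_ne_top),
      ← ENNReal.ofReal_mul hγ0] at h1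
    exact (ENNReal.ofReal_le_ofReal_iff (mul_nonneg hγ0 (hB.nonneg r hr x hx))).1 h1
  · simp [openKernel_of_notMem hx]

/-- The logarithmic derivative in `log r` is at most `γ ≤ n`, so `B(t, x)/t^n` is nonincreasing in
`t`. A finite `γ̄` thus forces polynomial growth, uniformly in the angle. -/
theorem openKernel_le_pow (hB : IsCollisionKernel d B) (hγ : gammaBar B ≤ ENNReal.ofReal γ)
    (hγ0 : 0 ≤ γ) {n : ℕ} (hn : γ ≤ n) {s r : ℝ} (hs : 0 < s) (hsr : s ≤ r) (x : ℝ) :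
    openKernel B r x ≤ (r / s) ^ n * openKernel B s x := by
  have hder : ∀ t : ℝ, 0 < t → HasDerivAt (fun t => openKernel B t x / t ^ n)
      ((deriv (fun t => openKernel B t x) t * t ^ n - openKernel B t x * (n * t ^ (n - 1)))
        / (t ^ n) ^ 2) t := fun t ht =>
    (hB.openKernel_differentiableAt ht x).hasDerivAt.div (hasDerivAt_pow n t) (by positivity)
  have hanti : AntitoneOn (fun t => openKernel B t x / t ^ n) (Ioi 0) := by
    refine antitoneOn_of_deriv_nonpos (convex_Ioi 0)
      (fun t ht => (hder t ht).continuousAt.continuousWithinAt) ?_ ?_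
    · rw [interior_Ioi]
      exact fun t ht => (hder t ht).differentiableAt.differentiableWithinAt
    · rw [interior_Ioi]
      intro t (ht : 0 < t)
      rw [(hder t ht).deriv]
      refine div_nonpos_of_nonpos_of_nonneg ?_ (by positivity)
      have h1 := hB.openKernel_deriv_le hγ hγ0 ht x
      have h2 := hB.openKernel_nonneg ht x
      rcases Nat.eq_zero_or_pos n with rfl | hn0
      · have hγ1 : γ = 0 := le_antisymm (by simpa using hn) hγ0
        rw [hγ1, zero_mul] at h1
        have : |deriv (fun t => openKernel B t x) t| ≤ 0 := by nlinarith
        simp [abs_nonpos_iff.1 this]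
      · have h3 : t ^ n = t * t ^ (n - 1) := by
          rw [← pow_succ', Nat.sub_add_cancel hn0]
        have h4 : t * deriv (fun t => openKernel B t x) t ≤ n * openKernel B t x :=
          (mul_le_mul_of_nonneg_left (le_abs_self _) ht.le).trans
            (h1.trans (mul_le_mul_of_nonneg_right hn h2))
        rw [h3]
        have := mul_le_mul_of_nonneg_right h4 (by positivity : 0 ≤ t ^ (n - 1))
        linarith
  have h := hanti (mem_Ioi.2 hs) (mem_Ioi.2 (hs.trans_le hsr)) hsr
  have hr := hs.trans_le hsr
  simp only at h
  rw [div_le_iff₀ (by positivity)] at h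
  refine h.trans (le_of_eq ?_)
  rw [div_pow]; ring

theorem momentumTransfer_openKernel_le (B : ℝ → ℝ → ℝ) (z : Vel d) :
    momentumTransfer (openKernel B) z ≤ momentumTransfer B z := by
  refine lintegral_mono fun σ => ?_
  by_cases hx : inner ℝ (dir z) (σ : Vel d) ∈ Ioo (-1 : ℝ) 1
  · rw [openKernel_of_mem hx]
  · simp [openKernel_of_notMem hx]

theorem measurable_momentumTransfer (hB : IsCollisionKernel d B) :
    Measurable (momentumTransfer (d := d) (openKernel B)) := by
  have h1 : Measurable fun p : Vel d × USphere d => inner ℝ (dir p.1) (p.2 : Vel d) := by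
    unfold dir
    have h2 : Measurable fun p : Vel d × USphere d => ‖p.1‖⁻¹ • p.1 := by fun_prop
    exact h2.inner (measurable_subtype_coe.comp measurable_snd)
  have h3 : Measurable fun p : Vel d × USphere d => openKernel B ‖p.1‖ (inner ℝ (dir p.1) (p.2 : Vel d)) :=
    hB.measurable_openKernel.comp (measurable_fst.norm.prodMk h1)
  exact Measurable.lintegral_prod_right' (f := fun p : Vel d × USphere d =>
    ENNReal.ofReal ((1 - inner ℝ (dir p.1) (p.2 : Vel d))
      * openKernel B ‖p.1‖ (inner ℝ (dir p.1) (p.2 : Vel d))))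
    ((measurable_const.sub h1).mul h3).ennreal_ofReal

theorem momentumTransfer_congr_norm (hB : IsCollisionKernel d B) {z z' : Vel d}
    (h : ‖z‖ = ‖z'‖) :
    momentumTransfer (openKernel B) z = momentumTransfer (openKernel B) z' := by
  obtain ⟨R, hR⟩ := exists_isometry_map z z' h
  have hdir : dir z' = R (dir z) := by rw [dir, dir, ← hR, R.norm_map, map_smul]
  have hm := hB.measurable_openKernel
  have h1 : Measurable fun σ : USphere d => inner ℝ (dir z') (σ : Vel d) := by fun_prop
  unfold momentumTransfer
  rw [← (measurePreserving_sphereMap R).lintegral_comp (f := fun σ : USphere d =>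
    ENNReal.ofReal ((1 - inner ℝ (dir z') (σ : Vel d))
      * openKernel B ‖z'‖ (inner ℝ (dir z') (σ : Vel d))))
    (((measurable_const.sub h1).mul
      (hm.comp (measurable_const.prodMk h1))).ennreal_ofReal)]
  refine lintegral_congr fun σ => ?_
  rw [coe_sphereMap, hdir, R.inner_map_map, h]

theorem momentumTransfer_le_pow (hB : IsCollisionKernel d B)
    (hγ : gammaBar B ≤ ENNReal.ofReal γ) (hγ0 : 0 ≤ γ) {n : ℕ} (hn : γ ≤ n) (e : USphere d)
    {z : Vel d} (hz : 1 ≤ ‖z‖) : momentumTransfer (openKernel B) z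
      ≤ ENNReal.ofReal (‖z‖ ^ n) * momentumTransfer (openKernel B) (e : Vel d) := by
  have hz0 : 0 < ‖z‖ := one_pos.trans_le hz
  rw [hB.momentumTransfer_congr_norm (z' := ‖z‖ • (e : Vel d)) (norm_smul_usphere hz0 e).symm]
  unfold momentumTransfer
  rw [dir_smul_usphere hz0, norm_smul_usphere hz0, norm_usphere,
    show dir (e : Vel d) = e by simpa using dir_smul_usphere one_pos e,
    ← lintegral_const_mul' _ _ ENNReal.ofReal_ne_top]
  refine lintegral_mono fun σ => ?_
  simp only
  rw [← ENNReal.ofReal_mul (by positivity)]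
  refine ENNReal.ofReal_le_ofReal ?_
  have h1 := hB.openKernel_le_pow hγ hγ0 hn one_pos hz (inner ℝ (e : Vel d) (σ : Vel d))
  rw [div_one] at h1
  have h2 : inner ℝ (e : Vel d) (σ : Vel d) ≤ 1 := by
    have := real_inner_le_norm (e : Vel d) (σ : Vel d)
    simpa using this
  have := mul_le_mul_of_nonneg_left h1 (sub_nonneg.2 h2)
  linarith

end IsCollisionKernel

theorem pow_le_mul_exp {δ : ℝ} (hδ : 0 < δ) {n : ℕ} {r : ℝ} (hr : 1 ≤ r) :
    r ^ 2 * r ^ n ≤ (n + 1).factorial * (1 / δ) ^ (n + 1) * Real.exp (δ * r ^ 2) := by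
  have h1 := Real.pow_div_factorial_le_exp (δ * r ^ 2) (by positivity) (n + 1)
  rw [div_le_iff₀ (by positivity), mul_pow] at h1
  have h2 : r ^ 2 * r ^ n ≤ (r ^ 2) ^ (n + 1) := by
    rw [← pow_add, ← pow_mul]
    exact pow_le_pow_right₀ hr (by omega)
  rw [one_div, inv_pow]
  calc _ ≤ (r ^ 2) ^ (n + 1) := h2
    _ = (δ ^ (n + 1))⁻¹ * (δ ^ (n + 1) * (r ^ 2) ^ (n + 1)) := by field_simp
    _ ≤ (δ ^ (n + 1))⁻¹ * (Real.exp (δ * r ^ 2) * (n + 1).factorial) := by gcongr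
    _ = _ := by ring

theorem lintegral_ofReal_lt_top {X : Type*} [MeasurableSpace X] {μ : Measure X} {f : X → ℝ}
    (hf : Integrable f μ) : ∫⁻ x, ENNReal.ofReal (f x) ∂μ < ⊤ := by
  refine lt_of_le_of_lt (lintegral_mono fun x => ?_) hf.2
  rw [← ofReal_norm]
  exact ENNReal.ofReal_le_ofReal (le_abs_self _)

/-- Inside the unit ball this is the local integrability hypothesis; outside, the momentum transfer
grows at most like a power of `|z|`, which the Gaussian absorbs. -/
theorem IsCollisionKernel.lintegral_momentumTransfer_lt_top (hd : 2 ≤ d)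
    (hB : IsCollisionKernel d B) (hγ : gammaBar B ≤ ENNReal.ofReal γ) (hγ0 : 0 ≤ γ) {δ : ℝ}
    (hδ : 0 < δ) : ∫⁻ z : Vel d, ENNReal.ofReal (‖z‖ ^ 2 * Real.exp (-δ * ‖z‖ ^ 2))
      * momentumTransfer (openKernel B) z < ⊤ := by
  obtain ⟨n, hn⟩ := exists_nat_ge γ
  let e : USphere d := ⟨eb ⟨0, by omega⟩, by simp [eb]⟩
  have he : momentumTransfer (openKernel B) (e : Vel d) < ⊤ :=
    (momentumTransfer_openKernel_le B _).trans_lt (hB.momentum_finite _ (by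
      intro h; have := norm_usphere e; rw [h, norm_zero] at this; exact zero_ne_one this))
  rw [← lintegral_add_compl _ (Metric.isOpen_ball (x := (0 : Vel d)) (ε := 1)).measurableSet]
  refine ENNReal.add_lt_top.2 ⟨?_, ?_⟩
  · refine lt_of_le_of_lt (lintegral_mono fun z => ?_) hB.locally_integrable
    refine mul_le_mul' (ENNReal.ofReal_le_ofReal ?_) (momentumTransfer_openKernel_le B z)
    refine mul_le_of_le_one_right (by positivity) (Real.exp_le_one_iff.2 ?_)
    nlinarith [sq_nonneg ‖z‖]
  · set c : ℝ := (n + 1).factorial * (1 / (δ / 2)) ^ (n + 1) with hc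
    have hi := lintegral_ofReal_lt_top
      ((integrable_exp_neg_mul_norm_sq (d := d) (half_pos hδ)).const_mul c)
    refine lt_of_le_of_lt ?_ (ENNReal.mul_lt_top hi he)
    rw [← lintegral_mul_const' _ _ he.ne]
    refine (setLIntegral_mono' Metric.isOpen_ball.measurableSet.compl fun z hz => ?_).trans
      (setLIntegral_le_lintegral _ _)
    have hz1 : 1 ≤ ‖z‖ := by simpa using hz
    refine (mul_le_mul_right (hB.momentumTransfer_le_pow hγ hγ0 hn e hz1) _).trans ?_
    rw [← mul_assoc, ← ENNReal.ofReal_mul (by positivity)]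
    refine mul_le_mul_left (ENNReal.ofReal_le_ofReal ?_) _
    calc ‖z‖ ^ 2 * Real.exp (-δ * ‖z‖ ^ 2) * ‖z‖ ^ n
        = (‖z‖ ^ 2 * ‖z‖ ^ n) * Real.exp (-δ * ‖z‖ ^ 2) := by ring
      _ ≤ (c * Real.exp (δ / 2 * ‖z‖ ^ 2)) * Real.exp (-δ * ‖z‖ ^ 2) := by
        exact mul_le_mul_of_nonneg_right (pow_le_mul_exp (half_pos hδ) hz1) (Real.exp_pos _).le
      _ = _ := by rw [mul_assoc, ← Real.exp_add]; congr 2; ring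

theorem IsCollisionKernel.lintegral_polar (hd : 2 ≤ d) (hB : IsCollisionKernel d B) {w : ℝ → ℝ}
    (hw : Measurable w) :
    ∫⁻ q : ℝ × (USphere d × USphere d), ENNReal.ofReal (w q.1)
      * ENNReal.ofReal ((1 - cosA q.2) * openKernel B q.1 (cosA q.2)) ∂((radial d).prod (surf2 d))
      = ∫⁻ z : Vel d, ENNReal.ofReal (w ‖z‖) * momentumTransfer (openKernel B) z := by
  have hm := hB.measurable_openKernel
  have h1 : Measurable fun q : ℝ × (USphere d × USphere d) => cosA q.2 :=
    continuous_cosA.measurable.comp measurable_snd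
  have h2 : Measurable fun q : ℝ × (USphere d × USphere d) =>
      ENNReal.ofReal ((1 - cosA q.2) * openKernel B q.1 (cosA q.2)) :=
    ((measurable_const.sub h1).mul (hm.comp (measurable_fst.prodMk h1))).ennreal_ofReal
  have h3 : Measurable fun q : ℝ × (USphere d × USphere d) => ENNReal.ofReal (w q.1)
      * ENNReal.ofReal ((1 - cosA q.2) * openKernel B q.1 (cosA q.2)) :=
    (hw.comp measurable_fst).ennreal_ofReal.mul h2
  have h4 : Measurable fun z : Vel d =>
      ENNReal.ofReal (w ‖z‖) * momentumTransfer (openKernel B) z :=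
    (hw.comp measurable_norm).ennreal_ofReal.mul hB.measurable_momentumTransfer
  have h6 : Measurable fun p : ℝ × USphere d => ENNReal.ofReal (w ‖p.1 • (p.2 : Vel d)‖)
      * momentumTransfer (openKernel B) (p.1 • (p.2 : Vel d)) :=
    h4.comp (measurePreserving_polar hd).measurable
  rw [← (measurePreserving_polar hd).lintegral_comp h4, lintegral_prod _ h6.aemeasurable,
    lintegral_prod _ h3.aemeasurable]
  refine lintegral_congr_ae (radial_ae_pos.mono fun r hr => ?_)
  have h5 : Measurable fun p : USphere d × USphere d =>
      ENNReal.ofReal ((1 - cosA p) * openKernel B r (cosA p)) := 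
    ((measurable_const.sub continuous_cosA.measurable).mul
      (hm.comp (measurable_const.prodMk continuous_cosA.measurable))).ennreal_ofReal
  have h7 : ∀ k : USphere d, ∫⁻ σ : USphere d,
      ENNReal.ofReal ((1 - cosA (k, σ)) * openKernel B r (cosA (k, σ))) ∂(surf d)
      = momentumTransfer (openKernel B) (r • (k : Vel d)) := by
    intro k
    simp only [momentumTransfer, dir_smul_usphere hr, norm_smul_usphere hr, cosA]
  calc ∫⁻ p, ENNReal.ofReal (w r) * ENNReal.ofReal ((1 - cosA p) * openKernel B r (cosA p))
        ∂(surf2 d)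
      = ENNReal.ofReal (w r) * ∫⁻ k, ∫⁻ σ,
        ENNReal.ofReal ((1 - cosA (k, σ)) * openKernel B r (cosA (k, σ))) ∂(surf d) ∂(surf d) := by
        rw [lintegral_const_mul _ h5]
        exact congrArg _ (lintegral_prod _ h5.aemeasurable)
    _ = _ := by
        simp only [h7, norm_smul_usphere hr]
        rw [lintegral_const_mul' _ _ ENNReal.ofReal_ne_top]

/-- The kernel in terms of half the relative speed, cut off at small deviation angles. -/
def truncKernel (B : ℝ → ℝ → ℝ) (ε r : ℝ) : ℝ → ℝ :=
  (Iio (1 - ε)).indicator (openKernel B (2 * r))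

theorem truncKernel_of_lt {ε x : ℝ} (hx : x < 1 - ε) (r : ℝ) :
    truncKernel B ε r x = openKernel B (2 * r) x :=
  indicator_of_mem (s := Iio (1 - ε)) hx _

theorem truncKernel_of_not_lt {ε x : ℝ} (hx : ¬ x < 1 - ε) (r : ℝ) : truncKernel B ε r x = 0 :=
  indicator_of_notMem (s := Iio (1 - ε)) hx _

/-- Where `cos θ < 1 - ε` one has `B ≤ ε⁻¹ (1 - cos θ) B`, so the momentum transfer controls the
truncated kernel. The quantity `r |∂_r B| / B` is invariant under dilation of `r`, so `γ` survives
the passage to half the relative speed. -/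
theorem IsCollisionKernel.radialKernel (hd : 2 ≤ d) (hB : IsCollisionKernel d B)
    (hγ : gammaBar B ≤ ENNReal.ofReal γ) (hγ0 : 0 ≤ γ) {ε : ℝ} (hε : 0 < ε) :
    RadialKernel d γ (truncKernel B ε) := by
  have hdiff : ∀ r, 0 < r → ∀ x, HasDerivAt (fun s => openKernel B (2 * s) x)
      (2 * deriv (fun s => openKernel B s x) (2 * r)) r := by
    intro r hr x
    have h1 := (hB.openKernel_differentiableAt (by linarith : 0 < 2 * r) x).hasDerivAt
    have h2 : HasDerivAt (fun s : ℝ => 2 * s) (2 * 1) r := (hasDerivAt_id r).const_mul 2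
    refine (h1.comp r h2).congr_deriv ?_
    ring
  have hmeas : Measurable (Function.uncurry (truncKernel B ε)) := by
    have : Function.uncurry (truncKernel B ε) = {p : ℝ × ℝ | p.2 ∈ Iio (1 - ε)}.indicator
        (fun p => openKernel B (2 * p.1) p.2) := by
      ext ⟨r, x⟩
      by_cases hx : x < 1 - ε
      · rw [indicator_of_mem (by exact hx)]; exact truncKernel_of_lt hx r
      · rw [indicator_of_notMem (by exact hx)]; exact truncKernel_of_not_lt hx r
    rw [this]
    exact (hB.measurable_openKernel.comp ((measurable_fst.const_mul 2).prodMk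
      measurable_snd)).indicator (measurable_snd measurableSet_Iio)
  have hnn : ∀ r, 0 < r → ∀ x, 0 ≤ truncKernel B ε r x := fun r hr x =>
    indicator_nonneg (fun x _ => hB.openKernel_nonneg (by linarith) x) x
  refine ⟨hmeas, hnn, fun r hr x => ?_, fun r hr x => ?_, fun θ hθ => ?_⟩
  · by_cases hx : x < 1 - ε
    · simpa only [truncKernel_of_lt hx] using (hdiff r hr x).differentiableAt
    · simp only [truncKernel_of_not_lt hx]; fun_prop
  · by_cases hx : x < 1 - ε
    · simp only [truncKernel_of_lt hx]
      rw [(hdiff r hr x).deriv, abs_mul, abs_of_pos two_pos]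
      have := hB.openKernel_deriv_le hγ hγ0 (by linarith : 0 < 2 * r) x
      linarith
    · simp [truncKernel_of_not_lt hx]
  · obtain ⟨n, hn⟩ := exists_nat_ge γ
    have mc : Measurable fun q : ℝ × (USphere d × USphere d) => cosA q.2 :=
      continuous_cosA.measurable.comp measurable_snd
    have mb : Measurable fun q : ℝ × (USphere d × USphere d) => truncKernel B ε q.1 (cosA q.2) :=
      hmeas.comp (measurable_fst.prodMk mc)
    have mw : Measurable fun q : ℝ × (USphere d × USphere d) =>
        q.1 ^ 2 * (1 + q.1 ^ 2) * Real.exp (-θ * q.1 ^ 2) := by fun_prop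
    refine ⟨(mw.mul mb).aestronglyMeasurable, ?_⟩
    have hfin := hB.lintegral_momentumTransfer_lt_top hd hγ hγ0 (half_pos hθ)
    rw [← hB.lintegral_polar hd (w := fun r => r ^ 2 * Real.exp (-(θ / 2) * r ^ 2))
      (by fun_prop)] at hfin
    -- The three factors pay for absorbing `1 + r²` into half of the Gaussian, for comparing `B(2r,
    -- ·)` with `B(r, ·)`, and for the angular truncation.
    set c : ℝ := (1 + 2 / θ) * 2 ^ n * ε⁻¹ with hc
    have hc0 : 0 ≤ c := by positivity
    refine lt_of_le_of_lt ?_ (ENNReal.mul_lt_top (ENNReal.ofReal_lt_top (r := c)) hfin)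
    rw [← lintegral_const_mul' _ _ ENNReal.ofReal_ne_top]
    refine lintegral_mono_ae (ae_fst_pos.mono fun q hq => ?_)
    rw [← ofReal_norm, ← ENNReal.ofReal_mul (by positivity), ← ENNReal.ofReal_mul hc0,
      Real.norm_of_nonneg (mul_nonneg (by positivity) (hnn _ hq _))]
    refine ENNReal.ofReal_le_ofReal ?_
    by_cases hx : cosA q.2 < 1 - ε
    · rw [truncKernel_of_lt hx]
      have h1 := hB.openKernel_le_pow hγ hγ0 hn hq (by linarith : q.1 ≤ 2 * q.1) (cosA q.2)
      rw [mul_div_assoc, div_self hq.ne', mul_one] at h1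
      have h0 := hB.openKernel_nonneg hq (cosA q.2)
      have h2 : openKernel B q.1 (cosA q.2)
          ≤ ε⁻¹ * ((1 - cosA q.2) * openKernel B q.1 (cosA q.2)) := by
        rw [← mul_assoc]
        refine le_mul_of_one_le_left h0 ?_
        rw [inv_mul_eq_div, one_le_div hε]
        linarith
      have h3 : 1 + q.1 ^ 2 ≤ (1 + 2 / θ) * Real.exp (θ / 2 * q.1 ^ 2) := by
        have k1 := Real.add_one_le_exp (θ / 2 * q.1 ^ 2)
        have k2 : 1 ≤ Real.exp (θ / 2 * q.1 ^ 2) := Real.one_le_exp (by positivity)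
        have k3 : q.1 ^ 2 ≤ 2 / θ * Real.exp (θ / 2 * q.1 ^ 2) := by
          rw [div_mul_eq_mul_div, le_div_iff₀ hθ]; linarith
        linarith
      calc _ ≤ q.1 ^ 2 * ((1 + 2 / θ) * Real.exp (θ / 2 * q.1 ^ 2)) * Real.exp (-θ * q.1 ^ 2)
            * (2 ^ n * (ε⁻¹ * ((1 - cosA q.2) * openKernel B q.1 (cosA q.2)))) := by
            refine mul_le_mul (by gcongr) (h1.trans (by gcongr)) ?_ (by positivity)
            exact hB.openKernel_nonneg (by linarith) _
        _ = c * (q.1 ^ 2 * (Real.exp (θ / 2 * q.1 ^ 2) * Real.exp (-θ * q.1 ^ 2))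
            * ((1 - cosA q.2) * openKernel B q.1 (cosA q.2))) := by rw [hc]; ring
        _ = _ := by
            rw [← Real.exp_add]; congr 4; ring_nf
    · rw [truncKernel_of_not_lt hx, mul_zero]
      have h0 := hB.openKernel_nonneg hq (cosA q.2)
      have h2 : cosA q.2 ≤ 1 := by
        have := real_inner_le_norm (q.2.1 : Vel d) (q.2.2 : Vel d)
        simpa [cosA] using this
      have := sub_nonneg.2 h2
      positivity

end Kernel


/-! ### Centre of mass and relative velocities -/

noncomputable section Collision

variable {d : ℕ} {B : ℝ → ℝ → ℝ} {γ : ℝ} {h : Vel d → ℝ}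

/-- The integrand of the truncated linearised collision integral. -/
def collisionIntegrand (B : ℝ → ℝ → ℝ) (h : Vel d → ℝ) (ε : ℝ) :
    (Vel d × Vel d) × USphere d → ℝ :=
  {p | inner ℝ (dir (p.1.1 - p.1.2)) (p.2 : Vel d) < 1 - ε}.indicator fun p =>
    (h (postV p.1.1 p.1.2 p.2) + h (postW p.1.1 p.1.2 p.2) - h p.1.1 - h p.1.2)
      * B ‖p.1.1 - p.1.2‖ (inner ℝ (dir (p.1.1 - p.1.2)) (p.2 : Vel d))

theorem measurable_dir_inner :
    Measurable fun p : (Vel d × Vel d) × USphere d =>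
      inner ℝ (dir (p.1.1 - p.1.2)) (p.2 : Vel d) := by
  unfold dir
  have h2 : Measurable fun p : (Vel d × Vel d) × USphere d =>
    ‖p.1.1 - p.1.2‖⁻¹ • (p.1.1 - p.1.2) := by fun_prop
  exact h2.inner (measurable_subtype_coe.comp measurable_snd)

theorem measurable_collisionIntegrand (hB : Measurable (Function.uncurry B)) (hh : Continuous h)
    (ε : ℝ) : Measurable (collisionIntegrand B h ε) := by
  refine Measurable.indicator ?_ (measurable_dir_inner measurableSet_Iio)
  refine Measurable.mul ?_ (hB.comp (Measurable.prodMk (by fun_prop) measurable_dir_inner))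
  refine Continuous.measurable ?_
  unfold postV postW
  fun_prop

theorem linBoltzmannTrunc_eq (B : ℝ → ℝ → ℝ) (h : Vel d → ℝ) (v : Vel d) (ε : ℝ) :
    linBoltzmannTrunc B h v ε
      = ∫ w, (∫ σ, collisionIntegrand B h ε ((v, w), σ) ∂(surf d)) * maxwellian w := by
  unfold linBoltzmannTrunc
  refine integral_congr_ae (Eventually.of_forall fun w => ?_)
  have hs : MeasurableSet {σ : USphere d | inner ℝ (dir (v - w)) (σ : Vel d) < 1 - ε} :=
    measurableSet_lt (by fun_prop) measurable_const
  simp only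
  rw [← integral_indicator hs]
  rfl

/-- The map is the shear `(x, y) ↦ (y, y + x)`, then the dilation of the first factor by `-2`, then
the shear again. Only finiteness and nonvanishing of the constant are used later. -/
theorem measurePreserving_sum_difference : ∃ c : ℝ≥0∞, c ≠ 0 ∧ c ≠ ⊤ ∧
    MeasurePreserving (fun p : Vel d × Vel d => (p.1 + p.2, p.1 - p.2))
      (volume.prod volume) (c • (volume.prod volume)) := by
  refine ⟨ENNReal.ofReal |((-2 : ℝ) ^ Module.finrank ℝ (Vel d))⁻¹|, ?_, ENNReal.ofReal_ne_top, ?_⟩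
  · simp
  set c := ENNReal.ofReal |((-2 : ℝ) ^ Module.finrank ℝ (Vel d))⁻¹| with hc
  have h1 : MeasurePreserving (fun y : Vel d => (-2 : ℝ) • y) volume (c • volume) :=
    ⟨by fun_prop, Measure.map_addHaar_smul volume (by norm_num)⟩
  have h2 := measurePreserving_prod_add_swap (volume : Measure (Vel d)) (volume : Measure (Vel d))
  have h3 := h1.prod (MeasurePreserving.id (volume : Measure (Vel d)))
  rw [Measure.prod_smul_left] at h3
  have h4 := ((h2.smul_measure c).comp h3).comp h2
  convert h4 using 1
  ext p <;> simp [add_comm]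
  ring

/-- The passage from centre of mass and relative velocities to the two velocities. -/
def toVelocities (q : Vel d × (ℝ × (USphere d × USphere d))) : (Vel d × Vel d) × USphere d :=
  ((q.1 + q.2.1 • (q.2.2.1 : Vel d), q.1 - q.2.1 • (q.2.2.1 : Vel d)), q.2.2.2)

theorem measurePreserving_toVelocities (hd : 2 ≤ d) : ∃ c : ℝ≥0∞, c ≠ 0 ∧ c ≠ ⊤ ∧
    MeasurePreserving (toVelocities (d := d)) (collisionMeasure d)
      (c • (((volume : Measure (Vel d)).prod (volume : Measure (Vel d))).prod (surf d))) := by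
  obtain ⟨c, hc0, hc1, hc⟩ := measurePreserving_sum_difference (d := d)
  refine ⟨c, hc0, hc1, ?_⟩
  have : SFinite ((radial d).prod (surf d)) := inferInstance
  have : SFinite (((radial d).prod (surf d)).prod (surf d)) := Measure.prod.instSFinite
  have h1 := (MeasurePreserving.id (volume : Measure (Vel d))).prod
    (measurePreserving_prodAssoc (radial d) (surf d) (surf d)).symm
  have h2 := (MeasurePreserving.id (volume : Measure (Vel d))).prod
    ((measurePreserving_polar hd).prod (MeasurePreserving.id (surf d)))
  have h3 := (measurePreserving_prodAssoc (volume : Measure (Vel d)) (volume : Measure (Vel d))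
    (surf d)).symm
  have h4 := hc.prod (MeasurePreserving.id (surf d))
  rw [Measure.prod_smul_left] at h4
  exact ((h4.comp h3).comp h2).comp h1

theorem maxwellian_mul_maxwellian (c y : Vel d) :
    maxwellian (c + y) * maxwellian (c - y)
      = ((2 * Real.pi) ^ (-(d : ℝ) / 2)) ^ 2 * (Real.exp (-‖c‖ ^ 2) * Real.exp (-‖y‖ ^ 2)) := by
  have h := parallelogram_law_with_norm ℝ c y
  have e : Real.exp (-‖c + y‖ ^ 2 / 2) * Real.exp (-‖c - y‖ ^ 2 / 2)
      = Real.exp (-‖c‖ ^ 2) * Real.exp (-‖y‖ ^ 2) := by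
    rw [← Real.exp_add, ← Real.exp_add]; congr 1; linarith
  rw [← e, maxwellian, maxwellian]; ring

theorem collisionIntegrand_toVelocities (B : ℝ → ℝ → ℝ) (h : Vel d → ℝ) (ε : ℝ)
    {q : Vel d × (ℝ × (USphere d × USphere d))} (hq : 0 < q.2.1) :
    collisionIntegrand B h ε (toVelocities q) = truncKernel B ε q.2.1 (cosA q.2.2)
      * incr (fun x => symm2 h q.1 (q.2.1 • x)) q.2.2 := by
  obtain ⟨c, r, k, σ⟩ := q
  simp only at hq
  have h1 : (c + r • (k : Vel d)) - (c - r • (k : Vel d)) = (2 * r) • (k : Vel d) := by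
    rw [mul_smul, two_smul]; abel
  have hr : 0 < 2 * r := by linarith
  have h2 : (2⁻¹ : ℝ) • ((c + r • (k : Vel d)) + (c - r • (k : Vel d))) = c := by
    rw [add_add_sub_cancel, ← two_smul ℝ c, smul_smul]; norm_num
  have h3 : 2 * r / 2 = r := by ring
  by_cases hx : inner ℝ (k : Vel d) (σ : Vel d) < 1 - ε
  · rw [truncKernel_of_lt (by exact hx), collisionIntegrand, indicator_of_mem (by
      simp only [toVelocities, mem_ofPred_eq, h1, dir_smul_usphere hr]; exact hx)]
    simp only [toVelocities, postV, postW, h1, h2, dir_smul_usphere hr, norm_smul_usphere hr, h3,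
      incr, cosA, symm2]
    -- At `k·σ = ±1` the outgoing velocities are the incoming ones, possibly exchanged, so the
    -- bracket vanishes and the values of `B` there are immaterial.
    by_cases hI : inner ℝ (k : Vel d) (σ : Vel d) ∈ Ioo (-1 : ℝ) 1
    · rw [openKernel_of_mem hI]; ring
    · rw [openKernel_of_notMem hI, zero_mul]
      have hm : inner ℝ (k : Vel d) (σ : Vel d) = -1 ∨ inner ℝ (k : Vel d) (σ : Vel d) = 1 := by
        have := abs_real_inner_le_norm (k : Vel d) (σ : Vel d)
        rw [norm_usphere, norm_usphere, mul_one, abs_le] at this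
        simp only [mem_Ioo, not_and_or, not_lt] at hI
        rcases hI with hI | hI
        · exact Or.inl (le_antisymm hI this.1)
        · exact Or.inr (le_antisymm this.2 hI)
      have hz : h (c + r • (σ : Vel d)) + h (c - r • (σ : Vel d)) - h (c + r • (k : Vel d))
          - h (c - r • (k : Vel d)) = 0 := by
        rcases hm with hm | hm
        · rw [(inner_eq_neg_one_iff_of_norm_eq_one (norm_usphere k) (norm_usphere σ)).1 hm,
            smul_neg, sub_neg_eq_add, ← sub_eq_add_neg]
          ring
        · rw [(inner_eq_one_iff_of_norm_eq_one (norm_usphere k) (norm_usphere σ)).1 hm]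
          ring
      rw [hz, zero_mul]
  · rw [truncKernel_of_not_lt (by exact hx), collisionIntegrand, indicator_of_notMem (by
      simp only [toVelocities, mem_ofPred_eq, h1, dir_smul_usphere hr]; exact hx), zero_mul]

/-- The truncated collision operator dissipates the Dirichlet form. -/
theorem integral_ouOp_mul_linBoltzmannTrunc_nonneg (hd : 2 ≤ d) (hB : IsCollisionKernel d B)
    (hγ : gammaBar B ≤ ENNReal.ofReal γ) (hγ0 : 0 ≤ γ) (hγd : γ ^ 2 ≤ 8 * d) {a C : ℝ}
    (hh : GaussGrowth a C h) (ha0 : 0 ≤ a) (ha : 4 * a < 1) {ε : ℝ} (hε : 0 < ε) :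
    Integrable (fun v => ouOp (1 / 2) h v * maxwellian v * linBoltzmannTrunc B h v ε) ∧
    0 ≤ ∫ v, ouOp (1 / 2) h v * maxwellian v * linBoltzmannTrunc B h v ε := by
  have hb := hB.radialKernel hd hγ hγ0 hε
  obtain ⟨c, hc0, hc1, hT⟩ := measurePreserving_toVelocities hd
  set F : (Vel d × Vel d) × USphere d → ℝ := fun p => ouOp (1 / 2) h p.1.1 * maxwellian p.1.1
    * (collisionIntegrand B h ε p * maxwellian p.1.2) with hF
  have mM : Measurable (maxwellian (d := d)) := by unfold maxwellian; fun_prop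
  have mF : Measurable F :=
    (((continuous_ouOp (1 / 2) hh.contDiff).measurable.comp measurable_fst.fst).mul
      (mM.comp measurable_fst.fst)).mul
      ((measurable_collisionIntegrand hB.measurable hh.contDiff.continuous ε).mul
      (mM.comp measurable_fst.snd))
  have hFT : (fun q => F (toVelocities q)) =ᵐ[collisionMeasure d] fun q =>
      ((2 * Real.pi) ^ (-(d : ℝ) / 2)) ^ 2 * collisionDensity (truncKernel B ε) h q := by
    filter_upwards [ae_radius_pos] with q hq
    have h1 := maxwellian_mul_maxwellian q.1 (q.2.1 • (q.2.2.1 : Vel d))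
    rw [norm_smul_usphere hq] at h1
    simp only [hF]
    rw [collisionIntegrand_toVelocities B h ε hq, collisionDensity]
    simp only [toVelocities]
    linear_combination (ouOp (1 / 2) h (q.1 + q.2.1 • (q.2.2.1 : Vel d))
      * (truncKernel B ε q.2.1 (cosA q.2.2)
      * incr (fun x => symm2 h q.1 (q.2.1 • x)) q.2.2)) * h1
  have iFT : Integrable (fun q => F (toVelocities q)) (collisionMeasure d) :=
    ((integrable_collisionDensity hb hh ha0 ha).const_mul _).congr hFT.symm
  have iF : Integrable F (((volume : Measure (Vel d)).prod (volume : Measure (Vel d))).prod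
      (surf d)) := by
    rw [← integrable_smul_measure hc0 hc1, ← hT.map_eq]
    exact (integrable_map_measure mF.aestronglyMeasurable hT.measurable.aemeasurable).2 iFT
  have nF : 0 ≤ ∫ p, F p ∂(((volume : Measure (Vel d)).prod (volume : Measure (Vel d))).prod
      (surf d)) := by
    have h1 := integral_comp_of_measurePreserving hT mF.aestronglyMeasurable
    rw [integral_smul_measure, integral_congr_ae hFT, integral_const_mul, smul_eq_mul] at h1
    have h2 := integral_collisionDensity_nonneg hd hγ0 hγd hb hh ha0 ha
    have h3 : 0 < c.toReal := ENNReal.toReal_pos hc0 hc1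
    have h4 : 0 ≤ c.toReal * ∫ p, F p ∂(((volume : Measure (Vel d)).prod
      (volume : Measure (Vel d))).prod (surf d)) := by rw [← h1]; positivity
    exact nonneg_of_mul_nonneg_right h4 h3
  have e : ∀ v, ∫ w, ∫ σ, F ((v, w), σ) ∂(surf d)
      = ouOp (1 / 2) h v * maxwellian v * linBoltzmannTrunc B h v ε := by
    intro v
    simp only [hF, integral_const_mul, integral_mul_const]
    rw [← linBoltzmannTrunc_eq]
  have i1 := iF.integral_prod_left
  constructor
  · have := i1.integral_prod_left
    simpa only [e] using this
  · rw [integral_prod _ iF, integral_prod _ i1] at nF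
    simpa only [e] using nF

end Collision


/-! ### Bounds for the truncated collision operator -/

noncomputable section Bound

variable {d : ℕ} {B : ℝ → ℝ → ℝ} {γ : ℝ} {h : Vel d → ℝ}

theorem abs_taylor_one_le {U : Vel d → ℝ} (hU : ContDiff ℝ 2 U) {R K : ℝ}
    (hK : ∀ y, ‖y‖ ≤ R → ‖fderiv ℝ (fderiv ℝ U) y‖ ≤ K) {x y : Vel d} (hx : ‖x‖ ≤ R)
    (hy : ‖y‖ ≤ R) : |U y - U x - fderiv ℝ U x (y - x)| ≤ K * ‖y - x‖ ^ 2 := by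
  have hK0 : 0 ≤ K := (norm_nonneg (fderiv ℝ (fderiv ℝ U) x)).trans (hK x hx)
  have hball : segment ℝ x y ⊆ Metric.closedBall (0 : Vel d) R :=
    (convex_closedBall (0 : Vel d) R).segment_subset (by simpa using hx) (by simpa using hy)
  have h1 : ∀ z ∈ segment ℝ x y, ‖fderiv ℝ U z - fderiv ℝ U x‖ ≤ K * ‖y - x‖ := by
    intro z hz
    have h2 := (convex_closedBall (0 : Vel d) R).norm_image_sub_le_of_norm_fderiv_le (𝕜 := ℝ)
      (f := fderiv ℝ U) (C := K) (x := x) (y := z)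
      (fun z _ => (hU.fderiv_right (m := 1) (by norm_num)).differentiable one_ne_zero z)
      (fun z hz => hK z (by simpa using hz)) (by simpa using hx) (hball hz)
    refine h2.trans ?_
    gcongr
    exact norm_sub_le_of_mem_segment hz
  have h3 := (convex_segment x y).norm_image_sub_le_of_norm_fderiv_le' (𝕜 := ℝ) (f := U)
    (φ := fderiv ℝ U x) (C := K * ‖y - x‖) (fun z _ => hU.differentiable (by norm_num) z) h1
    (left_mem_segment ℝ x y) (right_mem_segment ℝ x y)
  rw [Real.norm_eq_abs] at h3
  refine h3.trans (le_of_eq ?_)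
  ring

/-- The reflection `σ ↦ 2 (k·σ) k - σ` about the line spanned by `k`. -/
def reflectAbout (k : USphere d) : Vel d ≃ₗᵢ[ℝ] Vel d := (ℝ ∙ (k : Vel d)).reflection

theorem reflectAbout_apply (k : USphere d) (x : Vel d) :
    reflectAbout k x = (2 * inner ℝ (k : Vel d) x) • (k : Vel d) - x := by
  rw [reflectAbout, Submodule.reflection_singleton_apply, norm_usphere]
  simp [two_smul, two_mul, add_smul]

theorem inner_reflectAbout (k : USphere d) (x : Vel d) :
    inner ℝ (k : Vel d) (reflectAbout k x) = inner ℝ (k : Vel d) x := by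
  rw [reflectAbout_apply, inner_sub_right, inner_smul_right, real_inner_self_eq_norm_sq,
    norm_usphere]
  ring

/-- A single increment is of order `|σ - k|`, the square root of what the momentum transfer can
control. Pairing `σ` with its reflection about `k` cancels the first-order part orthogonal to `k`;
the part along `k` is of order `1 - k·σ`, like the two Taylor remainders. The constant is `2 + 2 +
2`. -/
theorem abs_reflect_le {U : Vel d → ℝ} (hU : ContDiff ℝ 2 U) (he : ∀ y, U (-y) = U y) {r K : ℝ}
    (hr : 0 < r) (hK : ∀ y, ‖y‖ ≤ r → ‖fderiv ℝ (fderiv ℝ U) y‖ ≤ K) (k σ : USphere d) :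
    |(U (r • (σ : Vel d)) - U (r • (k : Vel d)))
      + (U (r • (reflectAbout k σ : Vel d)) - U (r • (k : Vel d)))|
      ≤ 6 * K * r ^ 2 * (1 - inner ℝ (k : Vel d) (σ : Vel d)) := by
  set x := inner ℝ (k : Vel d) (σ : Vel d) with hx
  set τ : USphere d := sphereMap (reflectAbout k) σ with hτ
  have hτv : (τ : Vel d) = reflectAbout k σ := coe_sphereMap _ _
  have hkk := (norm_smul_usphere hr k).le
  have hsq : ∀ s : USphere d, inner ℝ (k : Vel d) (s : Vel d) = x →
      ‖r • (s : Vel d) - r • (k : Vel d)‖ ^ 2 = 2 * r ^ 2 * (1 - x) := by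
    intro s hs
    rw [← smul_sub, norm_smul, mul_pow, norm_sub_sq_real, norm_usphere, norm_usphere,
      real_inner_comm, hs, Real.norm_eq_abs, sq_abs]
    ring
  have h1 := abs_taylor_one_le hU hK hkk (norm_smul_usphere hr σ).le
  have h2 := abs_taylor_one_le hU hK hkk (norm_smul_usphere hr τ).le
  rw [hsq σ rfl] at h1
  rw [hsq τ (by rw [hτv, inner_reflectAbout])] at h2
  have h3 : fderiv ℝ U (r • (k : Vel d)) (r • (σ : Vel d) - r • (k : Vel d))
      + fderiv ℝ U (r • (k : Vel d)) (r • (τ : Vel d) - r • (k : Vel d))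
      = -(2 * r * (1 - x)) * fderiv ℝ U (r • (k : Vel d)) k := by
    have e := map_smul (fderiv ℝ U (r • (k : Vel d))) (-(2 * r * (1 - x))) (k : Vel d)
    rw [smul_eq_mul] at e
    rw [← e, ← map_add, hτv, reflectAbout_apply, ← hx]
    congr 1
    module
  have hx1 : x ≤ 1 := by
    have := real_inner_le_norm (k : Vel d) (σ : Vel d)
    rwa [norm_usphere, norm_usphere, mul_one] at this
  have h4 : |fderiv ℝ U (r • (k : Vel d)) k| ≤ K * r := by
    have := (fderiv ℝ U (r • (k : Vel d))).le_opNorm (k : Vel d)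
    rw [norm_usphere, mul_one] at this
    have h5 := norm_fderiv_le_of_even hU he hK hkk
    rw [norm_smul_usphere hr] at h5
    exact this.trans h5
  have h5 : |-(2 * r * (1 - x)) * fderiv ℝ U (r • (k : Vel d)) k| ≤ 2 * r * (1 - x) * (K * r) := by
    rw [abs_mul, abs_neg, abs_of_nonneg (by have := sub_nonneg.2 hx1; positivity)]
    have := sub_nonneg.2 hx1
    gcongr
  rw [← h3] at h5
  rw [← hτv]
  rw [abs_le] at *
  constructor <;> nlinarith [h1.1, h1.2, h2.1, h2.2, h5.1, h5.2]

/-- The truncated region depends only on `k·σ`, so the reflection about `k` preserves it and the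
pairing of `abs_reflect_le` is available for every `ε`. This is what makes the bound uniform in `ε`.
-/
theorem enorm_integral_collisionIntegrand_le (hB : IsCollisionKernel d B) {a C : ℝ}
    (hh : GaussGrowth a C h) (ha : 0 ≤ a) {ε : ℝ} (v w : Vel d) :
    ‖∫ σ, collisionIntegrand B h ε ((v, w), σ) ∂(surf d)‖ₑ
      ≤ ENNReal.ofReal (3 * C * ‖v - w‖ ^ 2 * Real.exp (a * (‖v‖ ^ 2 + ‖w‖ ^ 2)))
        * momentumTransfer (openKernel B) (v - w) := by
  have hC := hh.nonneg
  by_cases hvw : v - w = 0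
  · have e : ∀ σ : USphere d, collisionIntegrand B h ε ((v, w), σ) = 0 := by
      intro σ
      rw [collisionIntegrand]
      refine indicator_apply_eq_zero.2 fun _ => ?_
      have hv : v = w := sub_eq_zero.1 hvw
      subst hv
      simp [postV, postW, ← two_smul ℝ, smul_smul]
      left; ring
    simp [e]
  set k : USphere d := ⟨dir (v - w), by simpa using norm_dir hvw⟩ with hk
  set r : ℝ := ‖v - w‖ / 2 with hr
  have hr0 : 0 < r := by have := norm_pos_iff.2 hvw; positivity
  set c : Vel d := (2⁻¹ : ℝ) • (v + w) with hc
  have hrk : r • (k : Vel d) = (2⁻¹ : ℝ) • (v - w) := by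
    simp only [hk, hr, dir, smul_smul]
    congr 1
    have := norm_ne_zero_iff.2 hvw
    field_simp
  have h2rk : (2 * r) • (k : Vel d) = v - w := by
    rw [mul_smul, hrk, smul_smul]; norm_num
  have hT : ∀ σ : USphere d, ((v, w), σ) = toVelocities (c, (r, (k, σ))) := by
    intro σ
    simp only [toVelocities, hrk, hc, Prod.mk.injEq, and_true]
    constructor <;> module
  set b : USphere d → ℝ := fun σ => truncKernel B ε r (inner ℝ (k : Vel d) (σ : Vel d)) with hb
  set U := symm2 h c with hU
  set f : USphere d → ℝ := fun σ => b σ * (U (r • (σ : Vel d)) - U (r • (k : Vel d))) with hf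
  have hJ : ∀ σ, collisionIntegrand B h ε ((v, w), σ) = f σ := fun σ => by
    rw [hT, collisionIntegrand_toVelocities B h ε hr0]
    rfl
  simp only [hJ]
  -- If the angular integrand is not integrable, its integral is zero by convention and the bound is
  -- trivial.
  by_cases hfi : Integrable f (surf d)
  swap
  · rw [integral_undef hfi]; simp
  have hm := measurePreserving_sphereMap (reflectAbout k)
  have hfi' := integrable_comp_of_measurePreserving hm hfi
  have e1 := integral_comp_of_measurePreserving hm hfi.aestronglyMeasurable
  set K : ℝ := 2 * (C * Real.exp (2 * a * ‖c‖ ^ 2)) * Real.exp (2 * a * r ^ 2) with hKdef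
  have hK0 : 0 ≤ K := by positivity
  have hUG := hh.symm2_right ha c
  have hKb : ∀ y, ‖y‖ ≤ r → ‖fderiv ℝ (fderiv ℝ U) y‖ ≤ K := fun y hy =>
    (hUG.fderiv2_le y).trans (by rw [hKdef]; gcongr)
  have hpt : ∀ σ, |f σ + f (sphereMap (reflectAbout k) σ)|
      ≤ 6 * K * r ^ 2 * ((1 - inner ℝ (k : Vel d) (σ : Vel d))
        * openKernel B (2 * r) (inner ℝ (k : Vel d) (σ : Vel d))) := by
    intro σ
    have h1 : b (sphereMap (reflectAbout k) σ) = b σ := by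
      simp only [hb, coe_sphereMap, inner_reflectAbout]
    have hb0 := hB.openKernel_nonneg (by linarith : 0 < 2 * r)
      (inner ℝ (k : Vel d) (σ : Vel d))
    have hb1 : 0 ≤ b σ ∧ b σ ≤ openKernel B (2 * r) (inner ℝ (k : Vel d) (σ : Vel d)) := by
      simp only [hb]
      by_cases hx : inner ℝ (k : Vel d) (σ : Vel d) < 1 - ε
      · rw [truncKernel_of_lt hx]; exact ⟨hb0, le_rfl⟩
      · rw [truncKernel_of_not_lt hx]; exact ⟨le_rfl, hb0⟩
    have h2 := abs_reflect_le hUG.contDiff (symm2_neg h c) hr0 hKb k σ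
    simp only [hf, h1, ← mul_add, coe_sphereMap]
    rw [abs_mul, abs_of_nonneg hb1.1]
    calc _ ≤ openKernel B (2 * r) (inner ℝ (k : Vel d) (σ : Vel d))
          * (6 * K * r ^ 2 * (1 - inner ℝ (k : Vel d) (σ : Vel d))) :=
          mul_le_mul hb1.2 h2 (abs_nonneg _) hb0
      _ = _ := by ring
  have e2 : 2 * ∫ σ, f σ ∂(surf d) = ∫ σ, (f σ + f (sphereMap (reflectAbout k) σ)) ∂(surf d) := by
    rw [integral_add hfi hfi', e1]; ring
  have hmT : momentumTransfer (openKernel B) (v - w) = ∫⁻ σ : USphere d,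
      ENNReal.ofReal ((1 - inner ℝ (k : Vel d) (σ : Vel d))
        * openKernel B (2 * r) (inner ℝ (k : Vel d) (σ : Vel d))) ∂(surf d) := by
    have : ‖v - w‖ = 2 * r := by rw [hr]; ring
    rw [momentumTransfer, this]
  -- With `r = |v - w|/2` the constant is `6 · 2C / 4 = 3C`, and the parallelogram law gives `2(|c|²
  -- + r²) = |v|² + |w|²`.
  have hconst : 6 * K * r ^ 2 = 3 * C * ‖v - w‖ ^ 2 * Real.exp (a * (‖v‖ ^ 2 + ‖w‖ ^ 2)) := by
    have hp := parallelogram_law_with_norm ℝ v w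
    have hexp : Real.exp (2 * a * ‖c‖ ^ 2) * Real.exp (2 * a * r ^ 2)
        = Real.exp (a * (‖v‖ ^ 2 + ‖w‖ ^ 2)) := by
      rw [← Real.exp_add, hc, norm_smul, hr]
      congr 1
      norm_num
      linear_combination (a / 2) * hp
    rw [← hexp, hKdef, hr]; ring
  calc ‖∫ σ, f σ ∂(surf d)‖ₑ ≤ ‖2 * ∫ σ, f σ ∂(surf d)‖ₑ := by
        rw [← ofReal_norm, ← ofReal_norm]
        refine ENNReal.ofReal_le_ofReal ?_
        rw [norm_mul, Real.norm_ofNat]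
        linarith [norm_nonneg (∫ σ, f σ ∂(surf d))]
    _ ≤ ∫⁻ σ, ‖f σ + f (sphereMap (reflectAbout k) σ)‖ₑ ∂(surf d) := by
        rw [e2]; exact enorm_integral_le_lintegral_enorm _
    _ ≤ ∫⁻ σ, ENNReal.ofReal (6 * K * r ^ 2) * ENNReal.ofReal
        ((1 - inner ℝ (k : Vel d) (σ : Vel d))
        * openKernel B (2 * r) (inner ℝ (k : Vel d) (σ : Vel d))) ∂(surf d) := by
        refine lintegral_mono fun σ => ?_
        rw [← ofReal_norm, ← ENNReal.ofReal_mul (by positivity)]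
        exact ENNReal.ofReal_le_ofReal (hpt σ)
    _ = _ := by
        rw [lintegral_const_mul' _ _ ENNReal.ofReal_ne_top, ← hmT, hconst]

theorem exists_abs_linBoltzmannTrunc_le (hd : 2 ≤ d) (hB : IsCollisionKernel d B)
    (hγ : gammaBar B ≤ ENNReal.ofReal γ) (hγ0 : 0 ≤ γ) {a C : ℝ} (ha : 0 ≤ a) (ha4 : a < 1 / 4) :
    ∃ K : ℝ, ∀ h : Vel d → ℝ, GaussGrowth a C h → ∀ ε v,
      |linBoltzmannTrunc B h v ε| ≤ K * Real.exp (‖v‖ ^ 2 / 4) := by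
  -- Then `δ|v - w|² ≤ (1/4 - a)(|v|² + |w|²)`, so `a(|v|² + |w|²) - |w|²/2 ≤ |v|²/4 - δ|v - w|²`:
  -- the Gaussian in `w` pays for the growth in `w` and leaves decay in `v - w`.
  set δ : ℝ := (1 / 4 - a) / 2 with hδ
  have hδ0 : 0 < δ := by linarith
  have hfin := hB.lintegral_momentumTransfer_lt_top hd hγ hγ0 hδ0
  set I := ∫⁻ z : Vel d, ENNReal.ofReal (‖z‖ ^ 2 * Real.exp (-δ * ‖z‖ ^ 2))
      * momentumTransfer (openKernel B) z with hI
  set m : ℝ := (2 * Real.pi) ^ (-(d : ℝ) / 2) with hm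
  have hm0 : 0 ≤ m := by positivity
  refine ⟨3 * C * m * I.toReal, fun h hh ε v => ?_⟩
  have hC := hh.nonneg
  have key : ‖linBoltzmannTrunc B h v ε‖ₑ
      ≤ ENNReal.ofReal (3 * C * m * Real.exp (‖v‖ ^ 2 / 4)) * I := by
    rw [linBoltzmannTrunc_eq]
    refine (enorm_integral_le_lintegral_enorm _).trans ?_
    have hIv : I = ∫⁻ w : Vel d, ENNReal.ofReal (‖v - w‖ ^ 2 * Real.exp (-δ * ‖v - w‖ ^ 2))
        * momentumTransfer (openKernel B) (v - w) :=
      (lintegral_sub_left_eq_self (fun z : Vel d => ENNReal.ofReal (‖z‖ ^ 2 *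
        Real.exp (-δ * ‖z‖ ^ 2)) * momentumTransfer (openKernel B) z) v).symm
    rw [hIv, ← lintegral_const_mul' _ _ ENNReal.ofReal_ne_top]
    refine lintegral_mono fun w => ?_
    have hMw : ‖(maxwellian w : ℝ)‖ₑ = ENNReal.ofReal (maxwellian w) := by
      rw [← ofReal_norm, Real.norm_of_nonneg (by unfold maxwellian; positivity)]
    suffices hreal : 3 * C * ‖v - w‖ ^ 2 * Real.exp (a * (‖v‖ ^ 2 + ‖w‖ ^ 2)) * maxwellian w
        ≤ 3 * C * m * Real.exp (‖v‖ ^ 2 / 4) * (‖v - w‖ ^ 2 * Real.exp (-δ * ‖v - w‖ ^ 2)) by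
      rw [enorm_mul, ← mul_assoc, ← ENNReal.ofReal_mul (by positivity), hMw]
      refine (mul_le_mul_left (enorm_integral_collisionIntegrand_le hB hh ha v w) _).trans ?_
      rw [mul_right_comm, ← ENNReal.ofReal_mul (by positivity)]
      exact mul_le_mul_left (ENNReal.ofReal_le_ofReal hreal) _
    have hle : Real.exp (a * (‖v‖ ^ 2 + ‖w‖ ^ 2)) * Real.exp (-‖w‖ ^ 2 / 2)
        ≤ Real.exp (‖v‖ ^ 2 / 4) * Real.exp (-δ * ‖v - w‖ ^ 2) := by
      rw [← Real.exp_add, ← Real.exp_add]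
      refine Real.exp_le_exp.2 ?_
      have h1 := parallelogram_law_with_norm ℝ v w
      have h2 : ‖v - w‖ ^ 2 ≤ 2 * ‖v‖ ^ 2 + 2 * ‖w‖ ^ 2 := by
        nlinarith [sq_nonneg ‖v + w‖]
      have h3 := mul_le_mul_of_nonneg_left h2 hδ0.le
      nlinarith [sq_nonneg ‖w‖]
    calc 3 * C * ‖v - w‖ ^ 2 * Real.exp (a * (‖v‖ ^ 2 + ‖w‖ ^ 2)) * maxwellian w
        = 3 * C * m * ‖v - w‖ ^ 2 *
          (Real.exp (a * (‖v‖ ^ 2 + ‖w‖ ^ 2)) * Real.exp (-‖w‖ ^ 2 / 2)) := by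
          rw [maxwellian]; ring
      _ ≤ 3 * C * m * ‖v - w‖ ^ 2 *
          (Real.exp (‖v‖ ^ 2 / 4) * Real.exp (-δ * ‖v - w‖ ^ 2)) := by gcongr
      _ = _ := by ring
  rw [← ENNReal.ofReal_toReal hfin.ne, ← ENNReal.ofReal_mul (by positivity), ← ofReal_norm,
    ENNReal.ofReal_le_ofReal_iff (by positivity), Real.norm_eq_abs] at key
  refine key.trans (le_of_eq ?_)
  ring

end Bound


/-! ### Decay of the Dirichlet form along solutions -/

noncomputable section Decay

variable {d : ℕ} {B : ℝ → ℝ → ℝ} {γ : ℝ}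

/-- Reversing time turns left slopes into right slopes. Left slopes are the natural ones here, since
the convexity estimate involves the generator at the later of the two times only. -/
theorem le_of_left_slope_le {E : ℝ → ℝ} {s t : ℝ} (hst : s ≤ t) (hc : ContinuousOn E (Icc s t))
    (h : ∀ τ ∈ Ioc s t, ∀ r, 0 < r → ∀ᶠ σ in 𝓝[<] τ, E τ - E σ < r * (τ - σ)) : E t ≤ E s := by
  have hc' : ContinuousOn (fun x => -E (-x)) (Icc (-t) (-s)) :=
    (hc.comp continuousOn_neg fun x hx => ⟨by linarith [hx.2], by linarith [hx.1]⟩).neg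
  have := image_le_of_liminf_slope_right_le_deriv_boundary (f := fun x => -E (-x))
    (B := fun _ => -E t) (B' := fun _ => 0) hc' (by simp)
    continuousOn_const (fun x _ => hasDerivWithinAt_const _ _ _) (fun x hx r hr => by
      have h1 := h (-x) ⟨by linarith [hx.2], by linarith [hx.1]⟩ r hr
      have h2 : Tendsto (fun z : ℝ => -z) (𝓝[>] x) (𝓝[<] (-x)) := tendsto_neg_nhdsGT
      refine Eventually.frequently ?_
      filter_upwards [h2.eventually h1, self_mem_nhdsWithin] with z hz (hxz : x < z)
      rw [slope_def_field, div_lt_iff₀ (by linarith)]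
      linarith) (x := -s) ⟨by linarith, le_rfl⟩
  simpa using this

section

variable {a C : ℝ} {f g : Vel d → ℝ}

theorem maxwellian_eq (v : Vel d) :
    maxwellian v = (2 * Real.pi) ^ (-(d : ℝ) / 2) * Real.exp (-(1 / 2) * ‖v‖ ^ 2) := by
  rw [maxwellian]; congr 2; ring

theorem continuous_maxwellian : Continuous (maxwellian (d := d)) := by unfold maxwellian; fun_prop

theorem dirichletForm_eq (f : Vel d → ℝ) : dirichletForm f = (2 * Real.pi) ^ (-(d : ℝ) / 2)
    * ∫ v, Real.exp (-(1 / 2) * ‖v‖ ^ 2) * ∑ i, pd i f v * pd i f v := by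
  rw [dirichletForm, ← integral_const_mul]
  refine integral_congr_ae (Eventually.of_forall fun v => ?_)
  simp only [norm_gradient_sq, maxwellian_eq, ← pow_two]
  ring

/-- Convexity, `|x|² - |y|² ≤ 2(x - y)·x`, followed by moving the gradient off `f - g`. Difference
quotients in time then involve `h` alone, so `∂_t ∇h` need not exist. -/
theorem dirichletForm_sub_le (hf : GaussGrowth a C f) (hg : GaussGrowth a C g) (ha : 4 * a < 1) :
    dirichletForm f - dirichletForm g
      ≤ -2 * ∫ v, (f v - g v) * (ouOp (1 / 2) f v * maxwellian v) := by
  have h2 : 2 * a < 1 / 2 := by linarith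
  obtain ⟨-, i1, -⟩ := integral_gauss_by_parts h2 hf hf
  obtain ⟨-, i2, -⟩ := integral_gauss_by_parts h2 hg hg
  obtain ⟨-, i3, e3⟩ := integral_gauss_by_parts h2 (hf.sub hg) hf
  have hpd : ∀ i v, pd i (fun v => f v - g v) v = pd i f v - pd i g v := fun i v =>
    pd_sub (hf.contDiff_one.differentiable one_ne_zero v)
      (hg.contDiff_one.differentiable one_ne_zero v) i
  have hle : (∫ v, Real.exp (-(1 / 2) * ‖v‖ ^ 2) * ∑ i, pd i f v * pd i f v)
      - ∫ v, Real.exp (-(1 / 2) * ‖v‖ ^ 2) * ∑ i, pd i g v * pd i g v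
      ≤ 2 * ∫ v, Real.exp (-(1 / 2) * ‖v‖ ^ 2) *
        ∑ i, pd i (fun v => f v - g v) v * pd i f v := by
    rw [← integral_sub i1 i2, ← integral_const_mul]
    refine integral_mono (i1.sub i2) (i3.const_mul 2) fun v => ?_
    rw [← mul_sub, mul_left_comm]
    refine mul_le_mul_of_nonneg_left ?_ (Real.exp_pos _).le
    rw [← Finset.sum_sub_distrib, Finset.mul_sum]
    refine Finset.sum_le_sum fun i _ => ?_
    rw [hpd]
    nlinarith [sq_nonneg (pd i f v - pd i g v)]
  have hm : (0 : ℝ) ≤ (2 * Real.pi) ^ (-(d : ℝ) / 2) := by positivity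
  have e4 : ∫ v, (f v - g v) * (ouOp (1 / 2) f v * maxwellian v)
      = (2 * Real.pi) ^ (-(d : ℝ) / 2) *
        ∫ v, Real.exp (-(1 / 2) * ‖v‖ ^ 2) * ((f v - g v) * ouOp (1 / 2) f v) := by
    rw [← integral_const_mul]
    refine integral_congr_ae (Eventually.of_forall fun v => ?_)
    simp only [maxwellian_eq]
    ring
  rw [dirichletForm_eq, dirichletForm_eq, e4, e3]
  have := mul_le_mul_of_nonneg_left hle hm
  linarith

/-- An integrable majorant of `e^{|v|²/4} |Δf - v·∇f| M`. -/
def genMajorant (d : ℕ) (a C : ℝ) (v : Vel d) : ℝ :=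
  (2 * Real.pi) ^ (-(d : ℝ) / 2) * (d * 2 * C)
    * ((1 + ‖v‖) * Real.exp (-(1 / 4 - a) * ‖v‖ ^ 2))

theorem integrable_genMajorant (ha : 4 * a < 1) : Integrable (genMajorant d a C) :=
  (integrable_one_add_norm_mul_exp (by linarith)).const_mul _

/-- The exponents add up to `1/4 + a - 1/2 = -(1/4 - a)`, negative because `a < 1/4`. -/
theorem abs_mul_ouOp_le (hf : GaussGrowth a C f) {p K : ℝ} (v : Vel d)
    (hp : |p| ≤ K * Real.exp (‖v‖ ^ 2 / 4)) :
    |p * (ouOp (1 / 2) f v * maxwellian v)| ≤ K * genMajorant d a C v := by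
  have h1 := hf.abs_ouOp_le (by norm_num : (0 : ℝ) ≤ 1 / 2) v
  have hM : 0 ≤ maxwellian v := by unfold maxwellian; positivity
  have hC := hf.nonneg
  rw [abs_mul, abs_mul, abs_of_nonneg hM]
  calc _ ≤ (K * Real.exp (‖v‖ ^ 2 / 4)) * ((d * (1 + 2 * (1 / 2)) * C
        * ((1 + ‖v‖) * Real.exp (a * ‖v‖ ^ 2))) * maxwellian v) := by
        refine mul_le_mul hp (mul_le_mul_of_nonneg_right h1 hM) (by positivity)
          ((abs_nonneg _).trans hp)
    _ = K * ((2 * Real.pi) ^ (-(d : ℝ) / 2) * (d * 2 * C) * ((1 + ‖v‖) * (Real.exp (‖v‖ ^ 2 / 4)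
        * Real.exp (a * ‖v‖ ^ 2) * Real.exp (-(1 / 2) * ‖v‖ ^ 2)))) := by
        rw [maxwellian_eq]; ring
    _ = _ := by
        rw [← Real.exp_add, ← Real.exp_add, genMajorant]
        congr 4; ring_nf

/-- The bound on `q` makes `u` Lipschitz in time with an admissible weight. This gives continuity of
the Dirichlet form and dominates the difference quotients, whose limit has the sign assumed for the
generator pairing. -/
theorem dirichletForm_le_of_evolution {u q : ℝ → Vel d → ℝ} {s t K : ℝ} (hst : s ≤ t)
    (ha : 4 * a < 1) (hu : ∀ τ ∈ Icc s t, GaussGrowth a C (u τ))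
    (hq : ∀ τ ∈ Icc s t, ∀ v, HasDerivWithinAt (fun τ => u τ v) (q τ v) (Icc s t) τ)
    (hqK : ∀ τ ∈ Icc s t, ∀ v, |q τ v| ≤ K * Real.exp (‖v‖ ^ 2 / 4))
    (hpos : ∀ τ ∈ Icc s t, 0 ≤ ∫ v, q τ v * (ouOp (1 / 2) (u τ) v * maxwellian v)) :
    dirichletForm (u t) ≤ dirichletForm (u s) := by
  have hlip : ∀ τ ∈ Icc s t, ∀ σ ∈ Icc s t, ∀ v,
      |u τ v - u σ v| ≤ K * Real.exp (‖v‖ ^ 2 / 4) * |τ - σ| := fun τ hτ σ hσ v =>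
    (convex_Icc s t).norm_image_sub_le_of_norm_hasDerivWithin_le (fun x hx => hq x hx v)
      (fun x hx => hqK x hx v) hσ hτ
  set I := ∫ v, genMajorant d a C v with hI
  have hE : ∀ τ ∈ Icc s t, ∀ σ ∈ Icc s t,
      dirichletForm (u τ) - dirichletForm (u σ) ≤ 2 * (K * I) * |τ - σ| := by
    intro τ hτ σ hσ
    refine (dirichletForm_sub_le (hu τ hτ) (hu σ hσ) ha).trans ?_
    have h1 := norm_integral_le_of_norm_le
      (f := fun v => (u τ v - u σ v) * (ouOp (1 / 2) (u τ) v * maxwellian v))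
      (((integrable_genMajorant ha).const_mul (K * |τ - σ|)))
      (Eventually.of_forall fun v => abs_mul_ouOp_le (hu τ hτ) v
        ((hlip τ hτ σ hσ v).trans_eq (by ring)))
    rw [integral_const_mul, Real.norm_eq_abs] at h1
    have := neg_le_of_abs_le h1
    rw [← hI] at this
    linarith
  refine le_of_left_slope_le (E := fun τ => dirichletForm (u τ)) hst ?_ ?_
  · refine LipschitzOnWith.continuousOn (K := (2 * (K * I)).toNNReal)
      (LipschitzOnWith.of_dist_le_mul fun τ hτ σ hσ => ?_)
    rw [Real.dist_eq, Real.dist_eq]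
    have h1 := hE τ hτ σ hσ
    have h2 := hE σ hσ τ hτ
    rw [abs_sub_comm] at h2
    refine (abs_sub_le_iff.2 ⟨h1, h2⟩).trans ?_
    exact mul_le_mul_of_nonneg_right (Real.le_coe_toNNReal _) (abs_nonneg _)
  · intro τ hτ r hr
    have hτ' : τ ∈ Icc s t := Ioc_subset_Icc_self hτ
    have hmem : ∀ᶠ σ in 𝓝[<] τ, σ ∈ Ico s τ := Ico_mem_nhdsLT hτ.1
    have hlim : Tendsto (fun σ => ∫ v, slope (fun τ => u τ v) τ σ
        * (ouOp (1 / 2) (u τ) v * maxwellian v)) (𝓝[<] τ)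
        (𝓝 (∫ v, q τ v * (ouOp (1 / 2) (u τ) v * maxwellian v))) := by
      refine tendsto_integral_filter_of_dominated_convergence (fun v => K * genMajorant d a C v)
        ?_ ?_ ((integrable_genMajorant ha).const_mul K) (Eventually.of_forall fun v => ?_)
      · filter_upwards [hmem] with σ hσ
        have hσ' : σ ∈ Icc s t := ⟨hσ.1, hσ.2.le.trans hτ.2⟩
        have c1 := (hu τ hτ').contDiff.continuous
        have c2 := (hu σ hσ').contDiff.continuous
        have c3 := continuous_ouOp (1 / 2) (hu τ hτ').contDiff
        have c4 := continuous_maxwellian (d := d)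
        refine Continuous.aestronglyMeasurable ?_
        simp only [slope_def_field]
        fun_prop
      · filter_upwards [hmem] with σ hσ
        have hσ' : σ ∈ Icc s t := ⟨hσ.1, hσ.2.le.trans hτ.2⟩
        refine Eventually.of_forall fun v => abs_mul_ouOp_le (hu τ hτ') v ?_
        have hne : 0 < |σ - τ| := abs_pos.2 (by linarith [hσ.2])
        rw [slope_def_field, abs_div, div_le_iff₀ hne]
        exact hlip σ hσ' τ hτ' v
      · refine Tendsto.mul_const _ ?_
        refine (hasDerivWithinAt_iff_tendsto_slope.1 (hq τ hτ' v)).mono_left ?_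
        rw [← nhdsWithin_Ico_eq_nhdsLT hτ.1]
        exact nhdsWithin_mono _ fun σ hσ => ⟨⟨hσ.1, hσ.2.le.trans hτ.2⟩, hσ.2.ne⟩
    -- The limit is nonpositive, hence strictly below the positive number `r`, and so are the nearby
    -- difference quotients.
    have hev := (hlim.const_mul (-2)).eventually_lt_const (u := r) (by linarith [hpos τ hτ'])
    filter_upwards [hev, hmem] with σ h1 hσ
    have hσ' : σ ∈ Icc s t := ⟨hσ.1, hσ.2.le.trans hτ.2⟩
    have h2 := dirichletForm_sub_le (hu τ hτ') (hu σ hσ') ha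
    have hpos' : 0 < τ - σ := by linarith [hσ.2]
    have e : ∫ v, (u τ v - u σ v) * (ouOp (1 / 2) (u τ) v * maxwellian v)
        = (τ - σ) * ∫ v, slope (fun τ => u τ v) τ σ
        * (ouOp (1 / 2) (u τ) v * maxwellian v) := by
      rw [← integral_const_mul]
      refine integral_congr_ae (Eventually.of_forall fun v => ?_)
      have hne : σ - τ ≠ 0 := by linarith
      simp only [slope_def_field]
      field_simp
      ring
    rw [e] at h2
    have h3 := mul_lt_mul_of_pos_right h1 hpos'
    linarith

end

theorem dirichletFormDecays_of_gammaBar_le (hd : 2 ≤ d) (hB : IsCollisionKernel d B)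
    (hγ0 : 0 ≤ γ) (hγ : gammaBar B ≤ ENNReal.ofReal γ) (hγd : γ ^ 2 ≤ 8 * d) :
    DirichletFormDecays d B := by
  intro J hJ h hsol s hs t ht hst
  obtain ⟨a₀, C, ha₀, hgrow⟩ := hsol.growth s hs t ht
  have hsub : Icc s t ⊆ J := hJ.out hs ht
  -- The growth exponent may be negative; enlarging it to a nonnegative one only weakens the bound.
  set a := max a₀ 0 with ha
  have ha0 : 0 ≤ a := le_max_right _ _
  have ha4 : a < 1 / 4 := max_lt ha₀ (by norm_num)
  have hu : ∀ τ ∈ Icc s t, GaussGrowth a C (h τ) := fun τ hτ =>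
    GaussGrowth.mono (a := a₀) (C := C) ⟨(hsol.contDiff τ (hsub hτ)).of_le (by norm_num),
      fun n hn v => hgrow τ hτ n (by omega) v⟩ (le_max_left _ _) le_rfl
  obtain ⟨K, hK⟩ := exists_abs_linBoltzmannTrunc_le hd hB hγ hγ0 (C := C) ha0 ha4
  choose! q hq1 hq2 using hsol.equation
  refine dirichletForm_le_of_evolution (u := h) (q := q) (K := K) hst (by linarith) hu
    (fun τ hτ v => (hq2 τ (hsub hτ) v).mono hsub) (fun τ hτ v => ?_) (fun τ hτ => ?_)
  -- The constant `K` depends on neither `ε` nor `τ`, so the bound passes to the principal value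
  -- uniformly on the time interval.
  · exact le_of_tendsto (hq1 τ (hsub hτ) v).abs (Eventually.of_forall fun ε => hK _ (hu τ hτ) ε v)
  -- The same constant dominates the pairing with the generator, so its nonnegativity for the
  -- truncated operators survives `ε ↓ 0`.
  · have hlim : Tendsto (fun ε => ∫ v, linBoltzmannTrunc B (h τ) v ε
        * (ouOp (1 / 2) (h τ) v * maxwellian v)) (𝓝[>] 0)
        (𝓝 (∫ v, q τ v * (ouOp (1 / 2) (h τ) v * maxwellian v))) := by
      refine tendsto_integral_filter_of_dominated_convergence (fun v => K * genMajorant d a C v)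
        ?_ (Eventually.of_forall fun ε => Eventually.of_forall fun v =>
          abs_mul_ouOp_le (hu τ hτ) v (hK _ (hu τ hτ) ε v))
        ((integrable_genMajorant (by linarith)).const_mul K)
        (Eventually.of_forall fun v => (hq1 τ (hsub hτ) v).mul_const _)
      filter_upwards [self_mem_nhdsWithin] with ε hε
      refine ((integral_ouOp_mul_linBoltzmannTrunc_nonneg hd hB hγ hγ0 hγd (hu τ hτ) ha0
        (by linarith) hε).1.congr (Eventually.of_forall fun v => ?_)).aestronglyMeasurable
      simp only; ring
    refine ge_of_tendsto hlim ?_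
    filter_upwards [self_mem_nhdsWithin] with ε hε
    refine (integral_ouOp_mul_linBoltzmannTrunc_nonneg hd hB hγ hγ0 hγd (hu τ hτ) ha0
        (by linarith) hε).2.trans_eq ?_
    exact integral_congr_ae (Eventually.of_forall fun v => by simp only; ring)

end Decay

/-! ### The theorem -/

theorem mainTheorem11 (d : ℕ) (hd : 2 ≤ d) (B : ℝ → ℝ → ℝ) (hB : IsCollisionKernel d B) :
    (gammaBar B ≤ 4 → DirichletFormDecays d B) ∧
    (gammaBar B ≤ ENNReal.ofReal (Real.sqrt (8 * (d : ℝ))) → DirichletFormDecays d B) ∧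
    lambdaOneRP d = 2 * (d : ℝ≥0∞) ∧
    (∀ r : ℝ, 0 < r → lambdaOneRP d ≤ pStar d (B r)) := by
  have hd2 : (2 : ℝ) ≤ d := by exact_mod_cast hd
  refine ⟨fun h => ?_, fun h => ?_, lambdaOneRP_eq hd, fun r _ => ?_⟩
  -- Here `4² = 16 ≤ 8d` because `d ≥ 2`.
  · exact dirichletFormDecays_of_gammaBar_le (γ := 4) hd hB (by norm_num) (by simpa using h)
      (by linarith)
  · exact dirichletFormDecays_of_gammaBar_le hd hB (Real.sqrt_nonneg _) h
      (Real.sq_sqrt (by positivity)).le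
  · rw [lambdaOneRP_eq hd]
    exact le_pStar hd hB.measurable.of_uncurry_left
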